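/- Let $k$ be a field, let $r\ge 1$, and let $\vec e=(e_1\le\dots\le e_r)$ be a tuple of integers. Let $M,D$ be integers such that $\vec e\,'=((-M)^{r-1},D)$ satisfies $\vec e\,'<\vec e$, that is, $\vec e\,'\neq\vec e$, the two tuples have the same sum, and $e'_1+\dots+e'_j\le e_1+\dots+e_j$ for all $j$. Let $$U=H^1(\mathbb P^1_k,\mathcal End\,\mathcal O(\vec e\,'))=\mathrm{Ext}^1(\mathcal O(D),\mathcal O(-M)^{r-1}),$$ regarded as an affine space over $k$, and let $\overline\Sigma_{\vec e}\subseteq U$ be the splitting locus of $\vec e$: the closure, with its reduced structure, of the set of points of $U$ at which the middle term of the universal extension $0\to\mathcal O(-M)^{r-1}\to\mathcal E\to\mathcal O(D)\to0$ is isomorphic to $\mathcal O(\vec e)=\bigoplus_i\mathcal O(e_i)$. Let $\omega$ be the canonical module of $\overline\Sigma_{\vec e}$, that is, $\omega=\mathrm{Ext}^c_{R}(R/I,R)$, where $R$ is the coordinate ring of $U$ and $I\subseteq R$ is the ideal of $\overline\Sigma_{\vec e}$, of height $c$. Write $[\omega]$ for the class of $\omega$ in the divisor class group $A^1(\overline\Sigma_{\vec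 e})$ of divisorial fractional ideals (equivalently, rank one reflexive modules, with $[P]+[Q]=[(P\otimes Q)^{\vee\vee}]$) modulo principal ones; the class of a module isomorphic to a fractional ideal $J$ is that of the divisorial hull of $J$. Then $\omega$ has a well-defined class $[\omega]$, and for every integer $N\ge 0$ the reflexive tensor power $(\omega^{\otimes N})^{\vee\vee}$ is locally free if and only if $N[\omega]=0$ in $A^1(\overline\Sigma_{\vec e})$. -/

import Mathlib

open scoped TensorProduct LaurentPolynomial Polynomial nonZeroDivisors

noncomputable section

universe u

namespace SplittingLoci

section ProjectiveLine

/-! ### Vector bundles on the projective line over a field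

A vector bundle on `ℙ¹` over a field `K` is trivial on the two standard charts `Spec K[t]` and
`Spec K[t⁻¹]`, so it is given by an invertible matrix `A` over `K[t, t⁻¹]`: a section is a pair
`(s₀, s₁)` of vectors over `K[t]` and over `K[t⁻¹]` with `s₀ = A s₁`. With this convention the
`1 × 1` matrix `t ^ n` gives the line bundle `𝒪(n)`. -/

variable {K : Type*} [Field K]

/-- The inclusion `K[X] → K[t, t⁻¹]` with `X ↦ t⁻¹`; its image is the coordinate ring of the second
chart. -/
def polyToLaurentInv (K : Type*) [Field K] : K[X] →+* K[T;T⁻¹] :=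
  (LaurentPolynomial.invert (R := K)).toRingEquiv.toRingHom.comp Polynomial.toLaurent

/-- The vector bundles on `ℙ¹` with transition matrices `A` and `B` are isomorphic: there are
changes of frame `U` on `Spec K[t]` and `V` on `Spec K[t⁻¹]` which are compatible with the gluings. -/
def BundleIso {ι : Type*} [Fintype ι] [DecidableEq ι] (A B : Matrix ι ι K[T;T⁻¹]) : Prop :=
  ∃ U V : GL ι K[X],
    (U : Matrix ι ι K[X]).map Polynomial.toLaurent * A =
      B * (V : Matrix ι ι K[X]).map (polyToLaurentInv K)

/-- The transition matrix of `𝒪(e) = 𝒪(e₁) ⊕ ⋯ ⊕ 𝒪(eᵣ)`. -/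
def splitBundle (K : Type*) [Field K] {r : ℕ} (e : Fin r → ℤ) :
    Matrix (Fin r) (Fin r) K[T;T⁻¹] :=
  Matrix.diagonal fun i => LaurentPolynomial.T (e i)

/-- The index set of the coordinates of `H¹(ℙ¹, 𝓔nd 𝒪((-M)ⁿ, D)) = Ext¹(𝒪(D), 𝒪(-M)ⁿ)`,
which is `n` copies of `H¹(ℙ¹, 𝒪(-M-D))`, a space of dimension `M + D - 1`. -/
abbrev ExtIndex (n : ℕ) (M D : ℤ) : Type := Fin n × Fin (M + D - 1).toNat

/-- The transition matrix of the middle term of the extension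
`0 → 𝒪(-M)ⁿ → E → 𝒪(D) → 0` with coordinates `v`. Its off-diagonal block is the Čech cocycle
`bᵢ = ∑ⱼ v(i,j) t ^ (j + 1 - M)`; the powers `t ^ a` with `-M < a < D` are a basis of
`K[t, t⁻¹] / (t ^ (-M) K[t⁻¹] + t ^ D K[t])`, that is of `Ext¹(𝒪(D), 𝒪(-M))`. -/
def extensionBundle {n : ℕ} {M D : ℤ} (v : ExtIndex n M D → K) :
    Matrix (Fin (n + 1)) (Fin (n + 1)) K[T;T⁻¹] :=
  Matrix.reindex finSumFinEquiv finSumFinEquiv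
    (Matrix.fromBlocks
      (Matrix.diagonal fun _ : Fin n => LaurentPolynomial.T (-M))
      (Matrix.of fun (i : Fin n) (_ : Fin 1) =>
        ∑ j : Fin (M + D - 1).toNat,
          LaurentPolynomial.C (v (i, j)) * LaurentPolynomial.T ((j : ℤ) + 1 - M))
      0
      (Matrix.diagonal fun _ : Fin 1 => LaurentPolynomial.T D))

end ProjectiveLine

section SplittingTypes

/-- The tuple `((-M)ⁿ, D)`. -/
def unbalancedType (n : ℕ) (M D : ℤ) : Fin (n + 1) → ℤ :=
  Fin.snoc (α := fun _ => ℤ) (fun _ : Fin n => -M) D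

/-- The order on splitting types of the same rank and degree: `a ≤ b` if
`a₁ + ⋯ + aⱼ ≤ b₁ + ⋯ + bⱼ` for all `j`. -/
def SplittingLE {r : ℕ} (a b : Fin r → ℤ) : Prop :=
  ∑ i, a i = ∑ i, b i ∧ ∀ j : Fin r, ∑ i ∈ Finset.Iic j, a i ≤ ∑ i ∈ Finset.Iic j, b i

/-- The strict order on splitting types. -/
def SplittingLT {r : ℕ} (a b : Fin r → ℤ) : Prop := SplittingLE a b ∧ a ≠ b

end SplittingTypes

section SplittingLocus

variable (k : Type u) [Field k] (n : ℕ) (M D : ℤ)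

/-- The coordinate ring of the affine space `H¹(ℙ¹, 𝓔nd 𝒪((-M)ⁿ, D))` over `k`. -/
abbrev ExtRing : Type u := MvPolynomial (ExtIndex n M D) k

variable {k n M D}

/-- The coordinates, in its residue field, of a point of the affine space. -/
def pointCoords (p : PrimeSpectrum (ExtRing k n M D)) :
    ExtIndex n M D → p.asIdeal.ResidueField :=
  fun i => algebraMap (ExtRing k n M D) p.asIdeal.ResidueField (MvPolynomial.X i)

variable (k M D)

/-- The set of (scheme-theoretic) points of the affine space `H¹(ℙ¹, 𝓔nd 𝒪((-M)ⁿ, D))` at which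
the fibre of the universal extension is isomorphic to `𝒪(e)`. -/
def openSplittingLocus (e : Fin (n + 1) → ℤ) : Set (PrimeSpectrum (ExtRing k n M D)) :=
  {p | BundleIso (extensionBundle (pointCoords p)) (splitBundle p.asIdeal.ResidueField e)}

/-- The ideal of the splitting locus `Σ̄ₑ`, the closure of `openSplittingLocus` with its reduced
scheme structure. -/
def splittingIdeal (e : Fin (n + 1) → ℤ) : Ideal (ExtRing k n M D) :=
  PrimeSpectrum.vanishingIdeal (openSplittingLocus k M D e)

/-- The coordinate ring of the splitting locus `Σ̄ₑ ⊆ H¹(ℙ¹, 𝓔nd 𝒪((-M)ⁿ, D))`. -/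
abbrev SplittingRing (e : Fin (n + 1) → ℤ) : Type u :=
  ExtRing k n M D ⧸ splittingIdeal k M D e

end SplittingLocus

section CanonicalModule

open CategoryTheory Abelian

/-- `Ext^c_R(R/I, R)` where `c` is the height of `I`. When `R` is a polynomial ring over a field
and `Spec R/I` is integral, this is the canonical module of `R/I`. -/
def CanonicalModule {R : Type u} [CommRing R] (I : Ideal R) : Type u :=
  Ext (ModuleCat.of R (R ⧸ I)) (ModuleCat.of R R) I.height.toNat

variable {R : Type u} [CommRing R] (I : Ideal R)

instance : AddCommGroup (CanonicalModule I) :=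
  inferInstanceAs (AddCommGroup (Ext (ModuleCat.of R (R ⧸ I)) (ModuleCat.of R R) I.height.toNat))

instance : Module R (CanonicalModule I) :=
  inferInstanceAs (Module R (Ext (ModuleCat.of R (R ⧸ I)) (ModuleCat.of R R) I.height.toNat))

theorem canonicalModule_isTorsionBySet :
    Module.IsTorsionBySet R (CanonicalModule I) (I : Set R) := by
  intro x a
  obtain ⟨a, ha⟩ := a
  change Ext (ModuleCat.of R (R ⧸ I)) (ModuleCat.of R R) I.height.toNat at x
  have h0 : a • 𝟙 (ModuleCat.of R (R ⧸ I)) = 0 := by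
    refine ModuleCat.hom_ext (LinearMap.ext fun y => ?_)
    change R ⧸ I at y
    change a • y = (0 : R ⧸ I)
    rw [Algebra.smul_def, Ideal.Quotient.algebraMap_eq, Ideal.Quotient.eq_zero_iff_mem.mpr ha,
      zero_mul]
  have h1 : a • x = (a • Ext.mk₀ (𝟙 (ModuleCat.of R (R ⧸ I)))).comp x (zero_add _) := by
    rw [Ext.smul_comp, Ext.mk₀_id_comp]
  change a • x = 0
  rw [h1, ← Ext.mk₀_smul, h0, Ext.mk₀_zero, Ext.zero_comp]

/-- The canonical module is a module over `R/I`, since `I` annihilates it. -/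
instance : Module (R ⧸ I) (CanonicalModule I) := (canonicalModule_isTorsionBySet I).module

end CanonicalModule

section Modules

/-- The sheaf on `Spec S` associated with `P` is locally free: `Spec S` is covered by basic open
sets `D(f)` on which `P` is free. -/
def IsLocallyFree (S : Type*) [CommRing S] (P : Type*) [AddCommGroup P] [Module S P] : Prop :=
  ∀ p : PrimeSpectrum S, ∃ f : S, f ∉ p.asIdeal ∧
    Module.Free (Localization.Away f) (LocalizedModule (Submonoid.powers f) P)

/-- The `N`-th reflexive tensor power `(P^{⊗ N})^{∨∨}` of an `S`-module `P`. -/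
abbrev ReflexivePower (S : Type*) [CommRing S] (P : Type*) [AddCommGroup P] [Module S P]
    (N : ℕ) : Type _ :=
  Module.Dual S (Module.Dual S (⨂[S]^N P))

end Modules

section ClassGroup

variable (S : Type*) [CommRing S]

/-- Fractional ideals of `S` which contain a unit of the total ring of fractions; for an integral
domain these are the nonzero fractional ideals. -/
def RegularFractionalIdeal : Submonoid (FractionalIdeal S⁰ (FractionRing S)) where
  carrier := {J | ∃ x ∈ J, IsUnit x}
  one_mem' := ⟨1, FractionalIdeal.one_mem_one S⁰, isUnit_one⟩
  mul_mem' := by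
    rintro J L ⟨x, hx, hxu⟩ ⟨y, hy, hyu⟩
    exact ⟨x * y, FractionalIdeal.mul_mem_mul hx hy, hxu.mul hyu⟩

variable {S}

/-- The divisorial hull `J_v = (S : (S : J))`. For Noetherian integral domains `S`, the submodules
`J_v` are exactly the reflexive rank one `S`-submodules of the fraction field, and `J_v` is the
reflexive hull of `J`. -/
def divisorialHull (J : Submodule S (FractionRing S)) : Submodule S (FractionRing S) :=
  1 / (1 / J)

theorem one_div_divisorialHull (J : Submodule S (FractionRing S)) :
    1 / divisorialHull J = 1 / J := by
  apply le_antisymm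
  · intro x hx
    rw [Submodule.mem_div_iff_forall_mul_mem] at hx ⊢
    intro y hy
    refine hx y ?_
    rw [divisorialHull, Submodule.mem_div_iff_forall_mul_mem]
    intro z hz
    rw [mul_comm]
    exact Submodule.mem_div_iff_forall_mul_mem.mp hz y hy
  · intro x hx
    rw [Submodule.mem_div_iff_forall_mul_mem]
    intro y hy
    rw [mul_comm]
    exact Submodule.mem_div_iff_forall_mul_mem.mp hy x hx

theorem divisorialHull_eq_iff {J L : Submodule S (FractionRing S)} :
    divisorialHull J = divisorialHull L ↔ 1 / J = 1 / L := by
  constructor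
  · intro h
    rw [← one_div_divisorialHull J, h, one_div_divisorialHull]
  · intro h
    rw [divisorialHull, h, divisorialHull]

theorem one_div_mul (J L : Submodule S (FractionRing S)) : 1 / (J * L) = (1 / J) / L := by
  apply le_antisymm
  · rw [Submodule.le_div_iff_mul_le, Submodule.le_div_iff_mul_le, mul_assoc, mul_comm L J,
      ← Submodule.le_div_iff_mul_le]
  · rw [Submodule.le_div_iff_mul_le, mul_comm J L, ← mul_assoc, ← Submodule.le_div_iff_mul_le,
      ← Submodule.le_div_iff_mul_le]

/-- If `J`, `J'` have the same divisorial hull, so have `J L` and `J' L`. -/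
theorem divisorialHull_mul_congr {J J' : Submodule S (FractionRing S)}
    (L : Submodule S (FractionRing S)) (h : divisorialHull J = divisorialHull J') :
    divisorialHull (J * L) = divisorialHull (J' * L) := by
  rw [divisorialHull_eq_iff] at h ⊢
  rw [one_div_mul, one_div_mul, h]

/-- Linear equivalence of fractional ideals: the divisorial hulls `J_v` and `L_v` differ by a
principal fractional ideal `x S`, that is `J_v = x L_v = (x L)_v`. -/
def LinEquiv (J L : FractionalIdeal S⁰ (FractionRing S)) : Prop :=
  ∃ x : (FractionRing S)ˣ,
    divisorialHull (J : Submodule S (FractionRing S)) =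
      divisorialHull (Submodule.span S {(x : FractionRing S)} * (L : Submodule S (FractionRing S)))

theorem LinEquiv.refl (J : FractionalIdeal S⁰ (FractionRing S)) : LinEquiv J J :=
  ⟨1, by rw [Units.val_one, ← Submodule.one_eq_span, one_mul]⟩

theorem LinEquiv.symm {J L : FractionalIdeal S⁰ (FractionRing S)} (h : LinEquiv J L) :
    LinEquiv L J := by
  obtain ⟨x, hx⟩ := h
  refine ⟨x⁻¹, ?_⟩
  have := divisorialHull_mul_congr (Submodule.span S {((x⁻¹ : (FractionRing S)ˣ) : FractionRing S)}) hx
  rw [mul_comm, this, mul_comm, ← mul_assoc, Submodule.span_mul_span, Set.singleton_mul_singleton,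
    Units.inv_mul, ← Submodule.one_eq_span, one_mul]

theorem LinEquiv.trans {I J L : FractionalIdeal S⁰ (FractionRing S)} (h : LinEquiv I J)
    (h' : LinEquiv J L) : LinEquiv I L := by
  obtain ⟨x, hx⟩ := h
  obtain ⟨y, hy⟩ := h'
  refine ⟨x * y, ?_⟩
  have := divisorialHull_mul_congr (Submodule.span S {(x : FractionRing S)}) hy
  rw [hx, mul_comm, this, mul_comm, ← mul_assoc, Submodule.span_mul_span,
    Set.singleton_mul_singleton, Units.val_mul]

theorem LinEquiv.mul {I J I' J' : FractionalIdeal S⁰ (FractionRing S)} (h : LinEquiv I J)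
    (h' : LinEquiv I' J') : LinEquiv (I * I') (J * J') := by
  obtain ⟨x, hx⟩ := h
  obtain ⟨y, hy⟩ := h'
  refine ⟨x * y, ?_⟩
  have h1 := divisorialHull_mul_congr (I' : Submodule S (FractionRing S)) hx
  have h2 := divisorialHull_mul_congr
    (Submodule.span S {(x : FractionRing S)} * (J : Submodule S (FractionRing S))) hy
  rw [FractionalIdeal.coe_mul, FractionalIdeal.coe_mul, h1, mul_comm, h2, Units.val_mul,
    ← Set.singleton_mul_singleton, ← Submodule.span_mul_span]
  congr 1
  ring

variable (S)

/-- Linear equivalence as a congruence relation on the monoid of regular fractional ideals. -/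
def linEquivCon : Con (RegularFractionalIdeal S) where
  r J L := LinEquiv (J : FractionalIdeal S⁰ (FractionRing S)) L
  iseqv := ⟨fun _ => LinEquiv.refl _, LinEquiv.symm, LinEquiv.trans⟩
  mul' := LinEquiv.mul

/-- The divisor class group of `S`, written additively: fractional ideals up to equality of
divisorial hulls (that is, divisors) modulo principal ones, with addition induced by the product
of fractional ideals. Equivalently, its elements are the isomorphism classes of reflexive modules
of rank one with `[P] + [Q] = [(P ⊗ Q)^{∨∨}]`. For every integral domain this is a commutative
monoid; for a normal Noetherian domain it is a group, the Weil divisor class group of `Spec S`. -/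
abbrev DivisorClassGroup : Type _ := Additive (linEquivCon S).Quotient

variable {S}

/-- The class of a fractional ideal; it only depends on the divisorial hull. -/
def divisorClass (J : RegularFractionalIdeal S) : DivisorClassGroup S :=
  Additive.ofMul (J : (linEquivCon S).Quotient)

/-- Over a normal Noetherian domain the divisor classes form a group. -/
theorem DivisorClassGroup.exists_add_eq_zero [IsDomain S] [IsNoetherianRing S]
    [IsIntegrallyClosed S] (c : DivisorClassGroup S) : ∃ d, c + d = 0 := by
  obtain ⟨J, rfl⟩ : ∃ J : RegularFractionalIdeal S, divisorClass J = c := Quotient.exists_rep c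
  obtain ⟨J, x, hx, hxu⟩ := J
  have hJ : J ≠ 0 := by
    rintro rfl
    exact hxu.ne_zero ((FractionalIdeal.mem_zero_iff S⁰).mp hx)
  obtain ⟨a, ha, haJ⟩ := J.isFractional
  have hau : IsUnit (algebraMap S (FractionRing S) a) :=
    IsLocalization.map_units (FractionRing S) (⟨a, ha⟩ : S⁰)
  have haL : algebraMap S (FractionRing S) a ∈ 1 / J := by
    rw [FractionalIdeal.mem_div_iff_of_ne_zero hJ]
    intro y hy
    obtain ⟨s, hs⟩ := haJ y hy
    rw [FractionalIdeal.mem_one_iff]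
    exact ⟨s, by rw [hs, Algebra.smul_def]⟩
  refine ⟨divisorClass ⟨1 / J, _, haL, hau⟩, ?_⟩
  have hL : ((1 / J : FractionalIdeal S⁰ (FractionRing S)) : Submodule S (FractionRing S)) =
      1 / (J : Submodule S (FractionRing S)) := by
    rw [FractionalIdeal.coe_div hJ, FractionalIdeal.coe_one]
  have key : LinEquiv (J * (1 / J)) 1 := by
    refine ⟨1, ?_⟩
    rw [Units.val_one, ← Submodule.one_eq_span, one_mul, divisorialHull_eq_iff,
      FractionalIdeal.coe_mul, one_div_mul, ← hL, FractionalIdeal.coe_one]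
    have h11 : (1 : Submodule S (FractionRing S)) / 1 = 1 := by
      apply le_antisymm
      · intro y hy
        simpa using Submodule.mem_div_iff_forall_mul_mem.mp hy 1 (Submodule.one_le.mp le_rfl)
      · rw [Submodule.le_div_iff_mul_le, one_mul]
    rw [h11]
    apply le_antisymm
    · intro y hy
      have hint : IsIntegral S y := by
        refine isIntegral_of_smul_mem_submodule
          ((1 / J : FractionalIdeal S⁰ (FractionRing S)) : Submodule S (FractionRing S)) ?_
          (FractionalIdeal.fg_of_isNoetherianRing le_rfl _) y
          (fun z hz => Submodule.mem_div_iff_forall_mul_mem.mp hy z hz)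
        intro h0
        rw [h0] at hL
        have : algebraMap S (FractionRing S) a ∈ (⊥ : Submodule S (FractionRing S)) := by
          rw [← h0]; exact haL
        exact hau.ne_zero ((Submodule.mem_bot S).mp this)
      obtain ⟨s, rfl⟩ := IsIntegrallyClosed.isIntegral_iff.mp hint
      exact Submodule.algebraMap_mem s
    · rw [Submodule.le_div_iff_mul_le, one_mul]
  exact congrArg Additive.ofMul ((Con.eq (linEquivCon S)).mpr key)

/-- `c` is the class `[P]` of the `S`-module `P`: some fractional ideal isomorphic to `P` has
class `c`. -/
def HasDivisorClass (P : Type*) [AddCommGroup P] [Module S P] (c : DivisorClassGroup S) : Prop :=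
  ∃ J : RegularFractionalIdeal S,
    Nonempty (P ≃ₗ[S] (J : FractionalIdeal S⁰ (FractionRing S))) ∧ divisorClass J = c

end ClassGroup

end SplittingLoci

end

/-!
The splitting locus `Σ` is an irreducible cone, and it is the cone structure which turns the
vanishing of a local obstruction into the vanishing of a global one.

*The locus is integral.* Let two points of type `e` be given, over a common field `κ`, each with an
isomorphism from the extension bundle to `𝒪(e)`, encoded as a matrix of polynomials of determinant
one (`IsFrame`). Over the semilocal ring of the affine line at `0` and `1`, interpolate linearly the
columns which give the map `𝒪(-M)ⁿ → 𝒪(e)`. Completing these columns by a last one to a frame is a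
surjectivity problem between finitely generated modules, solvable at both points, hence solvable by
Nakayama's lemma, and the resulting frame determines its extension class
(`IsFrame.eq_of_castSucc_eq`). So both points are specialisations of one point of type `e`
(`exists_isFrame_interpolating`), whence the ideal of `Σ` is prime (`isPrime_splittingIdeal`). That
a point may be replaced by any point over an extension of its residue field rests on Grothendieck's
splitting theorem (`exists_bundleIso_diagonal`) and the uniqueness of the splitting type
(`BundleIso.of_map`). Scaling an extension class does not change the bundle, so the ideal is
homogeneous (`isHomogeneous_splittingIdeal`).

*The canonical module is a homogeneous ideal.* Let `P` be a homogeneous prime of height `c` in a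
polynomial ring `R`. As `R` is Cohen–Macaulay, `P` contains a homogeneous regular sequence of length
`c`; if `F` is the ideal it generates, Rees' theorem (`ext_of_isWeaklyRegular`) identifies
`Ext^c(R / P, R)` with `(F : P) / F`. This module is torsion-free over `R / P` because `F` is
unmixed, and of rank one because, `R` being regular, another regular sequence in `P` generates `P`
generically. So it is isomorphic to a nonzero homogeneous ideal `J` of `R / P`
(`exists_homogeneous_ideal_equiv_canonicalModule`), and `[ω]` is the class of `J`.

*The equivalence.* The reflexive power `(ω^{⊗ N})^{∨∨}` is isomorphic to the divisorial hull of
`J ^ N` (`exists_reflexivePower_equiv`), and `N[ω] = 0` says that this hull is principal. The hull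
is isomorphic to a homogeneous ideal, being computed by ideal quotients. If it is locally free, it
is principal near the vertex of the cone, and the graded form of Nakayama's lemma
(`exists_le_span_sup`) makes it principal globally. The converse is clear, since a nonzero principal
fractional ideal is free.
-/

noncomputable section

universe u

namespace SplittingLoci

/-! ### Ext and regular sequences -/

section Rees

open CategoryTheory Abelian RingTheory.Sequence

variable {R : Type u} [CommRing R]

theorem smul_ext_eq_zero {M N : ModuleCat.{u} R} {r : R} (hr : r ∈ Module.annihilator R M) {j : ℕ}
    (x : Ext M N j) : r • x = 0 := by
  have h0 : r • 𝟙 M = 0 :=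
    ModuleCat.hom_ext (LinearMap.ext fun y => Module.mem_annihilator.mp hr y)
  have h1 : r • x = (r • Ext.mk₀ (𝟙 M)).comp x (zero_add _) := by
    rw [Ext.smul_comp, Ext.mk₀_id_comp]
  rw [h1, ← Ext.mk₀_smul, h0, Ext.mk₀_zero, Ext.zero_comp]

/-- Rees' theorem: a weakly `N`-regular sequence `rs` of length `m` in the annihilator of `M` makes
`Ext^j(M, N)` vanish for `j < m` and identifies `Ext^m(M, N)` with `Hom(M, N / rs N)`. -/
theorem ext_of_isWeaklyRegular (M : ModuleCat.{u} R) (rs : List R) :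
    ∀ N : ModuleCat.{u} R, IsWeaklyRegular N rs → (∀ r ∈ rs, r ∈ Module.annihilator R M) →
      (∀ j < rs.length, Subsingleton (Ext M N j)) ∧
        Nonempty (Ext M N rs.length ≃ₗ[R]
          (M →ₗ[R] N ⧸ (Ideal.ofList rs • ⊤ : Submodule R N))) := by
  induction rs with
  | nil =>
    intro N _ _
    refine ⟨fun j hj => absurd hj (Nat.not_lt_zero j), ⟨?_⟩⟩
    have h0 : (Ideal.ofList ([] : List R) • ⊤ : Submodule R N) = ⊥ := by
      rw [Ideal.ofList_nil, Submodule.bot_smul]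
    exact (Ext.linearEquiv₀ (R := R)).trans ((ModuleCat.homLinearEquiv (S := R)).trans
      (LinearEquiv.congrRight (Submodule.quotEquivOfEqBot _ h0).symm))
  | cons x rs ih =>
    intro N hreg hann
    rw [isWeaklyRegular_cons_iff] at hreg
    have hx : x ∈ Module.annihilator R M := hann x List.mem_cons_self
    obtain ⟨ihv, ⟨ihe⟩⟩ := ih (ModuleCat.of R (QuotSMulTop x N)) hreg.2
      fun r hr => hann r (List.mem_cons_of_mem x hr)
    have hS : (N.smulShortComplex x).ShortExact := hreg.1.smulShortComplex_shortExact
    let δ (j : ℕ) : Ext M (ModuleCat.of R (QuotSMulTop x N)) j →ₗ[R] Ext M N (j + 1) :=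
      hS.extClass.postcompOfLinear R M rfl
    have hδ (j : ℕ) : Function.Surjective (δ j) := by
      intro y
      refine Ext.covariant_sequence_exact₁ M hS y ?_ rfl
      have h1 : y.comp (Ext.mk₀ (x • 𝟙 N)) (add_zero (j + 1)) = 0 := by
        rw [Ext.mk₀_smul, Ext.comp_smul, Ext.comp_mk₀_id]
        exact smul_ext_eq_zero hx y
      exact h1
    have hv (j : ℕ) (hj : j < (x :: rs).length) : Subsingleton (Ext M N j) := by
      cases j with
      | zero =>
        have := IsSMulRegular.linearMap_subsingleton_of_mem_annihilator (M := N) hreg.1 hx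
        exact ((Ext.linearEquiv₀ (R := R)).trans
          (ModuleCat.homLinearEquiv (S := R))).toEquiv.subsingleton
      | succ j =>
        have := ihv j (by simpa using hj)
        exact (hδ j).subsingleton
    refine ⟨hv, ⟨?_⟩⟩
    have hinj : Function.Injective (δ rs.length) := by
      rw [← LinearMap.ker_eq_bot, LinearMap.ker_eq_bot']
      intro y hy
      obtain ⟨z, rfl⟩ := Ext.covariant_sequence_exact₃ M hS y rfl hy
      have : Subsingleton (Ext M (N.smulShortComplex x).X₂ rs.length) := hv rs.length (by simp)
      rw [Subsingleton.elim z 0, Ext.zero_comp]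
      rfl
    let e₁ : Ext M N (rs.length + 1) ≃ₗ[R] Ext M (ModuleCat.of R (QuotSMulTop x N)) rs.length :=
      (LinearEquiv.ofBijective _ ⟨hinj, hδ rs.length⟩).symm
    let e₂ : (M →ₗ[R] QuotSMulTop x N ⧸ (Ideal.ofList rs • ⊤ : Submodule R (QuotSMulTop x N)))
        ≃ₗ[R] (M →ₗ[R] N ⧸ (Ideal.ofList (x :: rs) • ⊤ : Submodule R N)) :=
      LinearEquiv.congrRight
        (Submodule.quotOfListConsSMulTopEquivQuotSMulTopInner N x rs).symm
    exact e₁.trans (LinearEquiv.trans ihe e₂)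

end Rees

/-! ### Cohen–Macaulay rings -/

section CohenMacaulay

open CategoryTheory Abelian RingTheory.Sequence

/-- Every prime ideal contains a weakly regular sequence at least as long as its height. For
Noetherian rings this is the Cohen–Macaulay property: inside a proper ideal weakly regular sequences
are regular after localisation, so their length is at most the height. -/
def IsGradeFull (R : Type*) [CommRing R] : Prop :=
  ∀ Q : Ideal R, Q.IsPrime →
    ∃ rs : List R, (∀ r ∈ rs, r ∈ Q) ∧ IsWeaklyRegular R rs ∧ Q.height ≤ rs.length

variable {R : Type u} [CommRing R]

theorem isWeaklyRegular_append_singleton_iff {rs : List R} {f : R} :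
    IsWeaklyRegular R (rs ++ [f]) ↔
      IsWeaklyRegular R rs ∧ ∀ z, f * z ∈ Ideal.ofList rs → z ∈ Ideal.ofList rs := by
  rw [isWeaklyRegular_append_iff, isWeaklyRegular_singleton_iff,
    isSMulRegular_quotient_iff_mem_of_smul_mem]
  simp only [smul_eq_mul, Ideal.mul_top]

theorem IsGradeFull.exists_length_eq (hR : IsGradeFull R) (Q : Ideal R) [hQ : Q.IsPrime]
    {m : ℕ} (hm : (m : ℕ∞) ≤ Q.height) :
    ∃ rs : List R, (∀ r ∈ rs, r ∈ Q) ∧ IsWeaklyRegular R rs ∧ rs.length = m := by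
  obtain ⟨rs, h1, h2, h3⟩ := hR Q hQ
  refine ⟨rs.take m, fun r hr => h1 r (List.mem_of_mem_take hr), ?_, ?_⟩
  · rw [← List.take_append_drop m rs, isWeaklyRegular_append_iff] at h2
    exact h2.1
  · rw [List.length_take]
    exact min_eq_left (Nat.cast_le.mp (hm.trans h3))

/-- Unmixedness: the associated primes of an ideal generated by a regular sequence have height at
most the length of the sequence. For a `Q` of larger height, Rees' theorem for a longer sequence in
`Q` makes `Ext^m(R / Q, R)` vanish, `m` being the length of `rs`, while it is
`Hom(R / Q, R / rs)`. -/
theorem IsGradeFull.height_le (hR : IsGradeFull R) {rs : List R} (hrs : IsWeaklyRegular R rs)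
    {Q : Ideal R} [hQ : Q.IsPrime] (hle : Ideal.ofList rs ≤ Q) {z : R} (hz : z ∉ Ideal.ofList rs)
    (hQz : ∀ q ∈ Q, q * z ∈ Ideal.ofList rs) : Q.height ≤ rs.length := by
  by_contra! hlt
  obtain ⟨rs', h1, h2, h3⟩ := hR Q hQ
  have hann : ∀ r ∈ Q, r ∈ Module.annihilator R (ModuleCat.of R (R ⧸ Q)) := by
    intro r hr
    change r ∈ Module.annihilator R (R ⧸ Q)
    rwa [Ideal.annihilator_quotient]
  obtain ⟨hv, -⟩ := ext_of_isWeaklyRegular (ModuleCat.of R (R ⧸ Q)) rs' (ModuleCat.of R R) h2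
    fun r hr => hann r (h1 r hr)
  obtain ⟨-, ⟨e⟩⟩ := ext_of_isWeaklyRegular (ModuleCat.of R (R ⧸ Q)) rs (ModuleCat.of R R) hrs
    fun r hr => hann r (hle (Ideal.subset_span hr))
  have := hv rs.length (Nat.cast_lt.mp (hlt.trans_le h3))
  have hs : Subsingleton ((R ⧸ Q) →ₗ[R] R ⧸ (Ideal.ofList rs • ⊤ : Submodule R R)) :=
    e.symm.toEquiv.subsingleton
  let φ : (R ⧸ Q) →ₗ[R] R ⧸ (Ideal.ofList rs • ⊤ : Submodule R R) :=
    Submodule.liftQ Q ((Submodule.mkQ _).comp (LinearMap.mulRight R z)) fun q hq => by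
      rw [LinearMap.mem_ker, LinearMap.comp_apply, Submodule.mkQ_apply,
        Submodule.Quotient.mk_eq_zero, smul_eq_mul, Ideal.mul_top]
      exact hQz q hq
  have h0 : φ (Submodule.Quotient.mk 1) = 0 := by rw [Subsingleton.elim φ 0]; rfl
  rw [Submodule.liftQ_apply, LinearMap.comp_apply, Submodule.mkQ_apply,
    Submodule.Quotient.mk_eq_zero, smul_eq_mul, Ideal.mul_top] at h0
  exact hz (by simpa using h0)

/-- An element outside finitely many primes of height at most the length of a weakly regular
sequence extends that sequence; the primes are the associated ones. -/
theorem IsGradeFull.exists_avoid [IsNoetherianRing R] (hR : IsGradeFull R) {rs : List R}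
    (hrs : IsWeaklyRegular R rs) :
    ∃ s : Finset (Ideal R), (∀ Q ∈ s, Q.IsPrime ∧ Q.height ≤ rs.length) ∧
      ∀ z ∉ Ideal.ofList rs, ∃ Q ∈ s, ∀ f, f * z ∈ Ideal.ofList rs → f ∈ Q := by
  refine ⟨(associatedPrimes.finite R (R ⧸ Ideal.ofList rs)).toFinset, ?_, ?_⟩
  · intro Q hQ
    rw [Set.Finite.mem_toFinset, AssociatedPrimes.mem_iff, isAssociatedPrime_iff] at hQ
    obtain ⟨hp, x, rfl⟩ := hQ
    refine ⟨hp, ?_⟩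
    obtain ⟨z, rfl⟩ := Ideal.Quotient.mk_surjective x
    have key (f : R) : f ∈ (⊥ : Submodule R (R ⧸ Ideal.ofList rs)).colon
        {Ideal.Quotient.mk (Ideal.ofList rs) z} ↔ f * z ∈ Ideal.ofList rs := by
      rw [Submodule.mem_colon_singleton, Submodule.mem_bot, Algebra.smul_def,
        Ideal.Quotient.algebraMap_eq, ← map_mul, Ideal.Quotient.eq_zero_iff_mem]
    refine hR.height_le hrs (z := z) ?_ ?_ ?_
    · intro f hf
      exact (key f).mpr (Ideal.mul_mem_right z _ hf)
    · intro hz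
      exact hp.one_notMem ((key 1).mpr (by rwa [one_mul]))
    · intro q hq
      exact (key q).mp hq
  · intro z hz
    have hz' : Ideal.Quotient.mk (Ideal.ofList rs) z ≠ 0 := by
      rwa [Ne, Ideal.Quotient.eq_zero_iff_mem]
    obtain ⟨Q, hQ, hle⟩ := exists_le_isAssociatedPrime_of_isNoetherianRing R _ hz'
    refine ⟨Q, by rwa [Set.Finite.mem_toFinset], fun f hf => hle ?_⟩
    rw [Submodule.mem_colon_singleton, Submodule.mem_bot, Algebra.smul_def,
        Ideal.Quotient.algebraMap_eq, ← map_mul, Ideal.Quotient.eq_zero_iff_mem]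
    exact hf

open Polynomial in
theorem height_le_height_comap_C_add_one [IsNoetherianRing R] (Q : Ideal R[X]) [Q.IsPrime] :
    Q.height ≤ (Q.comap C).height + 1 := by
  let p : Ideal R := Q.comap C
  let Rₚ := Localization.AtPrime p
  let _ : Algebra R[X] Rₚ[X] := Polynomial.algebra R Rₚ
  let T := Submonoid.map (C : R →+* R[X]).toMonoidHom p.primeCompl
  have : IsLocalization T Rₚ[X] := Polynomial.isLocalization _ _
  have disj : Disjoint (T : Set R[X]) Q := by
    refine Set.disjoint_left.mpr fun a ⟨b, hb⟩ ha => hb.1 ?_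
    rw [← hb.2] at ha
    exact ha
  let Q' : Ideal Rₚ[X] := Q.map (algebraMap R[X] Rₚ[X])
  have hQ' : Q'.IsPrime := IsLocalization.isPrime_of_isPrime_disjoint T _ _ ‹_› disj
  obtain ⟨N, hN, hle⟩ := Q'.exists_le_maximal hQ'.ne_top
  have h1 : Q.height = Q'.height := (IsLocalization.height_map_of_disjoint T _ disj).symm
  have h2 : IsLocalRing.maximalIdeal Rₚ ≤ N.comap C := by
    rw [← Localization.AtPrime.map_eq_maximalIdeal, Ideal.map_le_iff_le_comap]
    intro a ha
    apply hle
    have : algebraMap R[X] Rₚ[X] (C a) ∈ Q' := Ideal.mem_map_of_mem _ ha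
    have h3 : algebraMap R[X] Rₚ[X] (C a) = C (algebraMap R Rₚ a) := by
      change Polynomial.map (algebraMap R Rₚ) (C a) = _
      rw [Polynomial.map_C]
    rwa [h3] at this
  have h4 : N.LiesOver (IsLocalRing.maximalIdeal Rₚ) :=
    ⟨(IsLocalRing.maximalIdeal.isMaximal Rₚ).eq_of_le (Ideal.comap_ne_top _ hN.ne_top) h2⟩
  have h5 := Polynomial.height_eq_height_add_one (IsLocalRing.maximalIdeal Rₚ) N
  have h6 : (IsLocalRing.maximalIdeal Rₚ).height = p.height := by
    rw [← Localization.AtPrime.map_eq_maximalIdeal]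
    exact IsLocalization.height_map_of_disjoint p.primeCompl p
      (Set.disjoint_left.mpr fun a ha hb => ha hb)
  calc Q.height = Q'.height := h1
    _ ≤ N.height := Ideal.height_mono hle
    _ = p.height + 1 := by rw [h5, h6]

open Polynomial in
theorem IsGradeFull.polynomial [IsNoetherianRing R] (hR : IsGradeFull R) : IsGradeFull R[X] := by
  intro Q hQ
  let q : Ideal R := Q.comap C
  have hq : q.IsPrime := Ideal.comap_isPrime _ _
  obtain ⟨m, hm⟩ := ENat.ne_top_iff_exists.mp (q.height_ne_top hq.ne_top)
  obtain ⟨rs, h1, h2, h3⟩ := hR.exists_length_eq q hm.le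
  have hreg : IsWeaklyRegular R[X] (rs.map (algebraMap R R[X])) := h2.of_flat
  have hmem : ∀ r ∈ rs.map (algebraMap R R[X]), r ∈ Q := by
    intro r hr
    obtain ⟨a, ha, rfl⟩ := List.mem_map.mp hr
    exact h1 a ha
  have hqQ : q.map C ≤ Q := Ideal.map_comap_le
  have hover : Q.LiesOver q := ⟨rfl⟩
  by_cases hQq : Q ≤ q.map C
  · refine ⟨_, hmem, hreg, ?_⟩
    have := Ideal.height_le_height_add_of_liesOver q Q
    have h0 : Q.map (Ideal.Quotient.mk (q.map (algebraMap R R[X]))) = ⊥ := by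
      rw [Ideal.map_eq_bot_iff_le_ker, Ideal.mk_ker]
      exact hQq
    have hnt : Nontrivial (R[X] ⧸ q.map (algebraMap R R[X])) :=
      Ideal.Quotient.nontrivial_iff.mpr fun h => hQ.ne_top (top_le_iff.mp (h ▸ hqQ))
    rw [h0, Ideal.height_bot, add_zero, ← hm] at this
    rwa [List.length_map, h3]
  · -- `Q` is larger than `q R[X]`, so the sequence can be extended by some `f ∈ Q`
    obtain ⟨s, hs1, hs2⟩ := hR.exists_avoid h2
    have havoid : ∃ f ∈ Q, ∀ P ∈ s, f ∉ P.map C := by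
      by_contra! hcon
      have : (Q : Set R[X]) ⊆ ⋃ P ∈ (s : Set (Ideal R)), (P.map C : Ideal R[X]) := by
        intro f hf
        obtain ⟨P, hP, hfP⟩ := hcon f hf
        exact Set.mem_biUnion hP hfP
      rw [Ideal.subset_union_prime ⊥ ⊥ fun P hP _ _ =>
        @Ideal.isPrime_map_C_of_isPrime R _ P (hs1 P hP).1] at this
      obtain ⟨P, hP, hle⟩ := this
      have hPp := (hs1 P hP).1
      have hqP : q ≤ P := by
        intro a ha
        have := Ideal.mem_map_C_iff.mp (hle (show C a ∈ Q from ha)) 0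
        rwa [coeff_C_zero] at this
      have : q = P := Ideal.eq_of_le_of_height_le q hqP (by
        rw [← hm, ← h3]; exact (hs1 P hP).2)
      exact hQq (this ▸ hle)
    obtain ⟨f, hfQ, hf⟩ := havoid
    refine ⟨rs.map (algebraMap R R[X]) ++ [f], ?_, ?_, ?_⟩
    · intro r hr
      rcases List.mem_append.mp hr with hr | hr
      · exact hmem r hr
      · rwa [List.mem_singleton.mp hr]
    · refine isWeaklyRegular_append_singleton_iff.mpr ⟨hreg, fun z hz => ?_⟩
      have hker (g : R[X]) : g ∈ Ideal.ofList (rs.map (algebraMap R R[X])) ↔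
          g.map (Ideal.Quotient.mk (Ideal.ofList rs)) = 0 := by
        rw [← Ideal.map_ofList, Polynomial.algebraMap_eq, Ideal.mem_map_C_iff, Polynomial.ext_iff]
        simp only [coeff_map, coeff_zero, Ideal.Quotient.eq_zero_iff_mem]
      rw [hker] at hz ⊢
      rw [Polynomial.map_mul] at hz
      by_contra hz0
      have hnz : f.map (Ideal.Quotient.mk (Ideal.ofList rs)) ∉ (R ⧸ Ideal.ofList rs)[X]⁰ :=
        fun h => hz0 ((mem_nonZeroDivisors_iff.mp h).1 _ hz)
      -- by McCoy's theorem, a zero divisor is annihilated by a constant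
      obtain ⟨a, ha, haf⟩ := Polynomial.notMem_nonZeroDivisors_iff.mp hnz
      obtain ⟨b, rfl⟩ := Ideal.Quotient.mk_surjective a
      rw [Ne, Ideal.Quotient.eq_zero_iff_mem] at ha
      obtain ⟨P, hP, hPf⟩ := hs2 b ha
      refine hf P hP (Ideal.mem_map_C_iff.mpr fun i => hPf _ ?_)
      have := congrArg (fun g => coeff g i) haf
      simp only [coeff_smul, coeff_map, coeff_zero, smul_eq_mul, ← map_mul,
        Ideal.Quotient.eq_zero_iff_mem] at this
      rwa [mul_comm]
    · rw [List.length_append, List.length_map, h3, List.length_singleton, Nat.cast_add, hm]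
      exact height_le_height_comap_C_add_one Q

theorem IsGradeFull.of_ringEquiv {R' : Type u} [CommRing R'] (e : R ≃+* R') (hR : IsGradeFull R) :
    IsGradeFull R' := by
  intro Q hQ
  obtain ⟨rs, h1, h2, h3⟩ := hR (Q.comap e) (Ideal.comap_isPrime _ _)
  refine ⟨rs.map e, ?_, ?_, ?_⟩
  · intro r hr
    obtain ⟨a, ha, rfl⟩ := List.mem_map.mp hr
    exact h1 a ha
  · refine (AddEquiv.isWeaklyRegular_congr (e := e.toAddEquiv) ?_).mp h2
    exact List.forall₂_map_right_iff.mpr (List.forall₂_same.mpr fun r _ x => map_mul e r x)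
  · rwa [List.length_map, ← RingEquiv.height_comap e Q]

theorem isGradeFull_mvPolynomial (k : Type u) [Field k] (σ : Type) [Finite σ] :
    IsGradeFull (MvPolynomial σ k) := by
  induction σ using Finite.induction_empty_option with
  | of_equiv e h => exact h.of_ringEquiv (MvPolynomial.renameEquiv k e).toRingEquiv
  | h_empty =>
    have h : IsGradeFull k := by
      intro Q hQ
      refine ⟨[], by simp, IsWeaklyRegular.nil k k, ?_⟩
      rw [(Ideal.eq_bot_or_top Q).resolve_right hQ.ne_top, Ideal.height_bot]
      simp
    exact h.of_ringEquiv (MvPolynomial.isEmptyRingEquiv k PEmpty).symm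
  | h_option h =>
    exact h.polynomial.of_ringEquiv (MvPolynomial.optionEquivLeft k _).symm.toRingEquiv

end CohenMacaulay

/-! ### Prime avoidance -/

/-- The maximal members of a finite set are pairwise incomparable and dominate it; avoiding a finite
set of primes amounts to avoiding the maximal ones. -/
theorem exists_antichain_dominating {α : Type*} [PartialOrder α] (s : Finset α) :
    ∃ t ⊆ s, (∀ a ∈ t, ∀ b ∈ t, a ≤ b → a = b) ∧ ∀ a ∈ s, ∃ b ∈ t, a ≤ b := by
  classical
  refine ⟨s.filter (Maximal (· ∈ s)), Finset.filter_subset _ _, fun a ha b hb hle => ?_,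
    fun a ha => ?_⟩
  · exact (Finset.mem_filter.mp ha).2.eq_of_le (Finset.mem_filter.mp hb).1 hle
  · obtain ⟨b, hle, hb⟩ := s.exists_le_maximal ha
    exact ⟨b, Finset.mem_filter.mpr ⟨hb.1, hb⟩, hle⟩

section Graded

open DirectSum

variable {A σ : Type*} [CommRing A] [SetLike σ A] [AddSubgroupClass σ A] {𝒜 : ℕ → σ} [GradedRing 𝒜]

theorem isHomogeneous_colon {I J : Ideal A} (hI : I.IsHomogeneous 𝒜) (hJ : J.IsHomogeneous 𝒜) :
    Ideal.IsHomogeneous 𝒜 (I.colon (J : Set A)) := by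
  classical
  intro n r hr
  rw [Submodule.mem_colon] at hr ⊢
  intro j hj
  rw [← DirectSum.sum_support_decompose 𝒜 j, Finset.smul_sum]
  refine Ideal.sum_mem _ fun m _ => ?_
  rw [smul_eq_mul, ← coe_decompose_mul_add_of_right_mem 𝒜 (SetLike.coe_mem (decompose 𝒜 j m))]
  exact hI _ (hr _ (hJ m hj))

theorem exists_homogeneous_notMem {I J : Ideal A} (hI : I.IsHomogeneous 𝒜) (h : ¬ I ≤ J) :
    ∃ d, ∃ f ∈ 𝒜 d, f ∈ I ∧ f ∉ J := by
  classical
  obtain ⟨f, hf, hfJ⟩ := SetLike.not_le_iff_exists.mp h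
  by_contra! hcon
  refine hfJ ?_
  rw [← DirectSum.sum_support_decompose 𝒜 f]
  exact Ideal.sum_mem _ fun m _ => hcon m _ (SetLike.coe_mem _) (hI m hf)

/-- Homogeneous prime avoidance for pairwise incomparable homogeneous primes. As the only element of
`I` of degree zero is `0`, two forms in `I` can be raised to powers of the same degree and added. -/
theorem exists_homogeneous_notMem_of_pairwise {I : Ideal A} (hI : I.IsHomogeneous 𝒜)
    (hpos : ∀ f ∈ I, f ∈ 𝒜 0 → f = 0) (s : Finset (Ideal A)) (hs : ∀ Q ∈ s, Q.IsPrime)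
    (hh : ∀ Q ∈ s, Q.IsHomogeneous 𝒜) (hIs : ∀ Q ∈ s, ¬ I ≤ Q)
    (hinc : ∀ Q ∈ s, ∀ Q' ∈ s, Q ≤ Q' → Q = Q') :
    ∃ d, 0 < d ∧ ∃ f ∈ 𝒜 d, f ∈ I ∧ ∀ Q ∈ s, f ∉ Q := by
  classical
  induction s using Finset.induction_on with
  | empty => exact ⟨1, one_pos, 0, zero_mem _, I.zero_mem, by simp⟩
  | insert Q s hQs ih =>
    simp only [Finset.mem_insert, forall_eq_or_imp] at hs hh hIs hinc
    obtain ⟨d, hd, f, hfd, hfI, hf⟩ := ih hs.2 hh.2 hIs.2 fun Q hQ => (hinc.2 Q hQ).2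
    by_cases hfQ : f ∉ Q
    · exact ⟨d, hd, f, hfd, hfI, by simpa only [Finset.mem_insert, forall_eq_or_imp] using ⟨hfQ, hf⟩⟩
    have hQ := hs.1
    -- a form in `I` and in all members of `s` but not in `Q`
    obtain ⟨b, u, hub, huI, huQ⟩ := exists_homogeneous_notMem hI hIs.1
    have hv (Q' : Ideal A) (hQ' : Q' ∈ s) : ∃ d, ∃ v ∈ 𝒜 d, v ∈ Q' ∧ v ∉ Q :=
      exists_homogeneous_notMem (hh.2 Q' hQ') fun hle =>
        hQs ((hinc.2 Q' hQ').1 hle ▸ hQ')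
    choose! a v hva hvQ' hvQ using hv
    let g := u * ∏ Q' ∈ s, v Q'
    have hgI : g ∈ I := I.mul_mem_right _ huI
    have hgQ : g ∉ Q := fun h => (hQ.mem_or_mem h).elim huQ fun h => by
      obtain ⟨Q', hQ', h⟩ := Ideal.IsPrime.prod_mem_iff.mp h
      exact hvQ Q' hQ' h
    have hgd : g ∈ 𝒜 (b + ∑ Q' ∈ s, a Q') :=
      SetLike.mul_mem_graded hub (SetLike.prod_mem_graded 𝒜 _ _ fun Q' hQ' => hva Q' hQ')
    have hgpos : 0 < b + ∑ Q' ∈ s, a Q' := by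
      rw [Nat.pos_iff_ne_zero]
      intro h0
      rw [h0] at hgd
      exact hgQ (hpos g hgI hgd ▸ Q.zero_mem)
    have hgs (Q' : Ideal A) (hQ' : Q' ∈ s) : g ∈ Q' :=
      Q'.mul_mem_left _ (Ideal.mem_of_dvd _ (Finset.dvd_prod_of_mem v hQ') (hvQ' Q' hQ'))
    generalize b + ∑ Q' ∈ s, a Q' = e at hgd hgpos
    have h1 : f ^ e ∈ 𝒜 (d * e) := by
      rw [mul_comm]; exact SetLike.pow_mem_graded e hfd
    have h2 : g ^ d ∈ 𝒜 (d * e) := SetLike.pow_mem_graded d hgd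
    refine ⟨d * e, Nat.mul_pos hd hgpos, f ^ e + g ^ d, add_mem h1 h2,
      I.add_mem (I.pow_mem_of_mem hfI e hgpos) (I.pow_mem_of_mem hgI d hd), ?_⟩
    simp only [Finset.mem_insert, forall_eq_or_imp]
    refine ⟨fun h => hgQ ?_, fun Q' hQ' h => hf Q' hQ' ?_⟩
    · exact hQ.mem_of_pow_mem d
        ((Q.add_mem_iff_right (Q.pow_mem_of_mem (not_not.mp hfQ) e hgpos)).mp h)
    · exact (hs.2 Q' hQ').mem_of_pow_mem e
        ((Q'.add_mem_iff_left (Q'.pow_mem_of_mem (hgs Q' hQ') d hd)).mp h)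

/-- Homogeneous prime avoidance: a form avoids a prime as soon as it avoids its homogeneous core. -/
theorem exists_homogeneous_notMem_of_forall {I : Ideal A} (hI : I.IsHomogeneous 𝒜)
    (hpos : ∀ f ∈ I, f ∈ 𝒜 0 → f = 0) (s : Finset (Ideal A)) (hs : ∀ Q ∈ s, Q.IsPrime)
    (hIs : ∀ Q ∈ s, ¬ I ≤ Q) :
    ∃ d, ∃ f ∈ 𝒜 d, f ∈ I ∧ ∀ Q ∈ s, f ∉ Q := by
  classical
  let t := s.image fun Q => (Q.homogeneousCore 𝒜).toIdeal
  have ht : ∀ Q ∈ t, Q.IsPrime ∧ Q.IsHomogeneous 𝒜 ∧ ¬ I ≤ Q := by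
    intro Q hQ
    obtain ⟨Q', hQ', rfl⟩ := Finset.mem_image.mp hQ
    exact ⟨(hs Q' hQ').homogeneousCore, HomogeneousIdeal.isHomogeneous _,
      fun h => hIs Q' hQ' (h.trans (Ideal.toIdeal_homogeneousCore_le 𝒜 Q'))⟩
  obtain ⟨t', ht', hinc, hdom⟩ := exists_antichain_dominating t
  obtain ⟨d, -, f, hfd, hfI, hf⟩ := exists_homogeneous_notMem_of_pairwise hI hpos
    t' (fun Q hQ => (ht Q (ht' hQ)).1) (fun Q hQ => (ht Q (ht' hQ)).2.1)
    (fun Q hQ => (ht Q (ht' hQ)).2.2) hinc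
  refine ⟨d, f, hfd, hfI, fun Q hQ hfQ => ?_⟩
  obtain ⟨Q', hQ', hle⟩ := hdom _ (Finset.mem_image_of_mem _ hQ)
  exact hf Q' hQ' (hle (Ideal.mem_homogeneousCore_of_homogeneous_of_mem ⟨d, hfd⟩ hfQ))

end Graded

/-- Prime avoidance for a coset `x + J`. -/
theorem exists_add_notMem {A : Type*} [CommRing A] (x : A) (J : Ideal A) (s : Finset (Ideal A))
    (hs : ∀ Q ∈ s, Q.IsPrime) (hJ : ∀ Q ∈ s, ¬ J ≤ Q) : ∃ j ∈ J, ∀ Q ∈ s, x + j ∉ Q := by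
  classical
  obtain ⟨t, hts, hinc, hdom⟩ := exists_antichain_dominating s
  -- `j` has to lie in the maximal members without `x` and to avoid those which contain `x`
  obtain ⟨I, hI⟩ : ∃ I : Ideal A, I = ∏ Q ∈ t with x ∉ Q, Q := ⟨_, rfl⟩
  have h0 : ∃ j ∈ J * I, ∀ Q ∈ t, x ∈ Q → j ∉ Q := by
    by_contra! hcon
    have hsub : ((J * I : Ideal A) : Set A) ⊆
        ⋃ Q ∈ ((t.filter (x ∈ ·) : Finset (Ideal A)) : Set (Ideal A)), (Q : Set A) := by
      intro j hj
      obtain ⟨Q, hQ, hx, h⟩ := hcon j hj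
      exact Set.mem_biUnion (Finset.mem_coe.mpr (Finset.mem_filter.mpr ⟨hQ, hx⟩)) h
    rw [Ideal.subset_union_prime (f := fun Q : Ideal A => Q) ⊥ ⊥ fun Q hQ _ _ =>
      hs Q (hts (Finset.mem_filter.mp hQ).1)] at hsub
    obtain ⟨Q, hQ, hle⟩ := hsub
    obtain ⟨hQt, hxQ⟩ := Finset.mem_filter.mp hQ
    have hQp := hs Q (hts hQt)
    rcases hQp.mul_le.mp hle with h | h
    · exact hJ Q (hts hQt) h
    · rw [hI] at h
      obtain ⟨Q', hQ', h⟩ := hQp.prod_le.mp h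
      obtain ⟨hQ't, hxQ'⟩ := Finset.mem_filter.mp hQ'
      exact hxQ' (hinc Q' hQ't Q hQt h ▸ hxQ)
  obtain ⟨j, hj, hjt⟩ := h0
  have hJI : J * I ≤ J := Ideal.mul_le_left
  have hJI' : J * I ≤ I := Ideal.mul_le_right
  refine ⟨j, hJI hj, fun Q hQ hxj => ?_⟩
  obtain ⟨Q', hQ', hle⟩ := hdom Q hQ
  have hxj' := hle hxj
  by_cases hx : x ∈ Q'
  · exact hjt Q' hQ' hx ((Q'.add_mem_iff_right hx).mp hxj')
  · have hmem : Q' ∈ t.filter (x ∉ ·) := Finset.mem_filter.mpr ⟨hQ', hx⟩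
    have hIQ : I ≤ Q' := by
      rw [hI, ← Finset.mul_prod_erase _ _ hmem]
      exact Ideal.mul_le_left
    exact hx ((Q'.add_mem_iff_left (hIQ (hJI' hj))).mp hxj')

/-! ### Regular sequences in a prime ideal -/

section Sequences

open RingTheory.Sequence DirectSum

variable {R : Type u} [CommRing R] [IsNoetherianRing R]

/-- A homogeneous prime contains regular sequences of forms of any length up to its height. -/
theorem IsGradeFull.exists_homogeneous_sequence {σ : Type*} [SetLike σ R] [AddSubgroupClass σ R]
    {𝒜 : ℕ → σ} [GradedRing 𝒜] (hR : IsGradeFull R) {P : Ideal R} [P.IsPrime]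
    (hP : P.IsHomogeneous 𝒜) (hpos : ∀ f ∈ P, f ∈ 𝒜 0 → f = 0) (m : ℕ) (hm : (m : ℕ∞) ≤ P.height) :
    ∃ rs : List R, (∀ r ∈ rs, r ∈ P) ∧ (Ideal.ofList rs).IsHomogeneous 𝒜 ∧ IsWeaklyRegular R rs ∧
      rs.length = m := by
  induction m with
  | zero =>
    refine ⟨[], by simp, ?_, IsWeaklyRegular.nil R R, rfl⟩
    rw [Ideal.ofList_nil]
    exact Ideal.IsHomogeneous.bot 𝒜
  | succ m ih =>
    have hlt : (m : ℕ∞) < P.height :=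
      (Nat.cast_lt.mpr (Nat.lt_succ_self m)).trans_le hm
    obtain ⟨rs, h1, h2, h3, h4⟩ := ih hlt.le
    obtain ⟨s, hs, hs'⟩ := hR.exists_avoid h3
    obtain ⟨d, f, hfd, hfP, hf⟩ := exists_homogeneous_notMem_of_forall hP hpos s
      (fun Q hQ => (hs Q hQ).1) fun Q hQ hle =>
        ((Ideal.height_mono hle).trans (hs Q hQ).2).not_gt (by rwa [h4])
    refine ⟨rs ++ [f], ?_, ?_, ?_, by simp [h4]⟩
    · intro r hr
      rcases List.mem_append.mp hr with hr | hr
      · exact h1 r hr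
      · rwa [List.mem_singleton.mp hr]
    · rw [Ideal.ofList_append, Ideal.ofList_singleton]
      exact h2.sup (Ideal.homogeneous_span 𝒜 _ fun x hx => ⟨d, by rwa [Set.mem_singleton_iff.mp hx]⟩)
    · refine isWeaklyRegular_append_singleton_iff.mpr ⟨h3, fun z hz => ?_⟩
      by_contra hz'
      obtain ⟨Q, hQ, h⟩ := hs' z hz'
      exact hf Q hQ (h f hz)

/-- At most `height P` elements of `P` become a regular sequence after adding suitable elements of
`P ^ 2` to them. Locally at `P` this changes nothing, by Nakayama's lemma, if they generate `P`
there. -/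
theorem IsGradeFull.exists_sequence_congr (hR : IsGradeFull R) {P : Ideal R} [P.IsPrime]
    (hs : List R) (hhs : ∀ h ∈ hs, h ∈ P) (hm : (hs.length : ℕ∞) ≤ P.height) :
    ∃ rs : List R, (∀ r ∈ rs, r ∈ P) ∧ IsWeaklyRegular R rs ∧ rs.length = hs.length ∧
      ∀ h ∈ hs, h ∈ Ideal.ofList rs ⊔ P ^ 2 := by
  induction hs using List.reverseRecOn with
  | nil => exact ⟨[], by simp, IsWeaklyRegular.nil R R, rfl, by simp⟩
  | append_singleton hs x ih =>
    rw [List.length_append, List.length_singleton] at hm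
    have hlt : (hs.length : ℕ∞) < P.height :=
      (Nat.cast_lt.mpr (Nat.lt_succ_self _)).trans_le hm
    obtain ⟨rs, h1, h2, h3, h4⟩ := ih (fun h hh => hhs h (List.mem_append_left _ hh)) hlt.le
    obtain ⟨s, hs1, hs'⟩ := hR.exists_avoid h2
    obtain ⟨j, hjP, hj⟩ := exists_add_notMem x (P ^ 2) s (fun Q hQ => (hs1 Q hQ).1)
      fun Q hQ hle => by
        have := (hs1 Q hQ).1
        exact ((Ideal.height_mono (Ideal.IsPrime.le_of_pow_le hle)).trans (hs1 Q hQ).2).not_gt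
          (by rwa [h3])
    have hxP : x ∈ P := hhs x (by simp)
    refine ⟨rs ++ [x + j], ?_, ?_, by simp [h3], ?_⟩
    · intro r hr
      rcases List.mem_append.mp hr with hr | hr
      · exact h1 r hr
      · rw [List.mem_singleton.mp hr]
        exact P.add_mem hxP (Ideal.pow_le_self two_ne_zero hjP)
    · refine isWeaklyRegular_append_singleton_iff.mpr ⟨h2, fun z hz => ?_⟩
      by_contra hz'
      obtain ⟨Q, hQ, h⟩ := hs' z hz'
      exact hj Q hQ (h _ hz)
    · intro h hh
      rw [Ideal.ofList_append, Ideal.ofList_singleton]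
      rcases List.mem_append.mp hh with hh | hh
      · have hle : Ideal.ofList rs ⊔ P ^ 2 ≤ Ideal.ofList rs ⊔ Ideal.span {x + j} ⊔ P ^ 2 :=
          sup_le_sup_right le_sup_left _
        exact hle (h4 h hh)
      · rw [List.mem_singleton.mp hh]
        have h5 := Ideal.sub_mem (Ideal.ofList rs ⊔ Ideal.span {x + j} ⊔ P ^ 2)
          (Ideal.mem_sup_left (Ideal.mem_sup_right (Ideal.mem_span_singleton_self (x + j))))
          (Ideal.mem_sup_right hjP)
        rwa [add_sub_cancel_right] at h5

/-- In a regular Cohen–Macaulay domain, every prime `P` contains a regular sequence which generates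
`P` generically. -/
theorem IsGradeFull.exists_generic_sequence {R : Type u} [CommRing R] [IsDomain R]
    [IsRegularRing R] (hR : IsGradeFull R) (P : Ideal R) [hPp : P.IsPrime] :
    ∃ rs : List R, (∀ r ∈ rs, r ∈ P) ∧ IsWeaklyRegular R rs ∧ (rs.length : ℕ∞) = P.height ∧
      ∃ s ∉ P, ∀ p ∈ P, s * p ∈ Ideal.ofList rs := by
  classical
  let L := Localization.AtPrime P
  have hreg : IsRegularLocalRing L := isRegularRing_iff.mp ‹_› P
  let m := IsLocalRing.maximalIdeal L
  have hmap : P.map (algebraMap R L) = m := Localization.AtPrime.map_eq_maximalIdeal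
  have hfg : m.FG := m.fg_of_isNoetherianRing
  have hcard : (m.spanFinrank : ℕ∞) = P.height := by
    have := IsRegularLocalRing.spanFinrank_maximalIdeal (R := L)
    rw [IsLocalization.AtPrime.ringKrullDim_eq_height P L] at this
    exact_mod_cast this
  have hfin := Submodule.FG.finite_generators hfg
  -- numerators of a minimal generating set
  have hnum : ∀ g ∈ hfin.toFinset, ∃ h ∈ P, ∃ t : L, g = t * algebraMap R L h := by
    intro g hg
    have hgm : g ∈ m := Submodule.FG.generators_mem m ((Set.Finite.mem_toFinset _).mp hg)
    rw [← hmap, IsLocalization.mem_map_algebraMap_iff P.primeCompl] at hgm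
    obtain ⟨⟨h, t⟩, hgt⟩ := hgm
    refine ⟨h, h.2, IsLocalization.mk' L 1 t, ?_⟩
    rw [← hgt, mul_left_comm, IsLocalization.mk'_spec, map_one, mul_one]
  choose! h hhP t ht using hnum
  let hs := hfin.toFinset.toList.map h
  have hlen : (hs.length : ℕ∞) = P.height := by
    rw [List.length_map, Finset.length_toList, ← Set.ncard_eq_toFinset_card _ hfin,
      Submodule.FG.generators_ncard hfg, hcard]
  have hhs : ∀ x ∈ hs, x ∈ P := by
    intro x hx
    obtain ⟨g, hg, rfl⟩ := List.mem_map.mp hx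
    exact hhP g (Finset.mem_toList.mp hg)
  obtain ⟨rs, h1, h2, h3, h4⟩ := hR.exists_sequence_congr hs hhs hlen.le
  -- `rs` generates `m` modulo `m ^ 2`
  have hle : m ≤ (Ideal.ofList rs).map (algebraMap R L) := by
    refine Submodule.le_of_le_smul_of_le_jacobson_bot hfg
      (IsLocalRing.jacobson_eq_maximalIdeal ⊥ bot_ne_top).ge ?_
    have : m = Submodule.span L (hfin.toFinset : Set L) := by
      rw [Set.Finite.coe_toFinset, Submodule.span_generators]
    have hsup : (Ideal.ofList rs).map (algebraMap R L) ⊔ m • m =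
        (Ideal.ofList rs ⊔ P ^ 2).map (algebraMap R L) := by
      rw [Ideal.map_sup, Ideal.map_pow, hmap, pow_two, smul_eq_mul]
    rw [hsup]
    conv_lhs => rw [this]
    rw [Submodule.span_le]
    intro g hg
    rw [SetLike.mem_coe, ht g hg]
    exact Ideal.mul_mem_left _ _ (Ideal.mem_map_of_mem _ (h4 _ (List.mem_map.mpr
      ⟨g, Finset.mem_toList.mpr hg, rfl⟩)))
  refine ⟨rs, h1, h2, by rw [h3, hlen], ?_⟩
  obtain ⟨T, hT⟩ := P.fg_of_isNoetherianRing
  have hT' : ∀ p ∈ T, ∃ s ∉ P, s * p ∈ Ideal.ofList rs := by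
    intro p hp
    have hpP : p ∈ P := hT ▸ Ideal.subset_span hp
    have := hle (hmap ▸ Ideal.mem_map_of_mem _ hpP : algebraMap R L p ∈ m)
    rw [IsLocalization.mem_map_algebraMap_iff P.primeCompl] at this
    obtain ⟨⟨a, s⟩, has⟩ := this
    rw [← map_mul] at has
    refine ⟨s, s.2, ?_⟩
    rw [mul_comm, IsLocalization.injective L P.primeCompl_le_nonZeroDivisors has]
    exact a.2
  choose! s hsP hs using hT'
  refine ⟨∏ p ∈ T, s p, fun h => ?_, fun p hp => ?_⟩
  · obtain ⟨p, hp, h⟩ := Ideal.IsPrime.prod_mem_iff.mp h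
    exact hsP p hp h
  · have hle' : P ≤ (Ideal.ofList rs).colon {∏ p ∈ T, s p} := by
      conv_lhs => rw [← hT]
      refine Ideal.span_le.mpr fun p hp => ?_
      rw [SetLike.mem_coe, Submodule.mem_colon_singleton, smul_eq_mul]
      obtain ⟨c, hc⟩ := Finset.dvd_prod_of_mem s hp
      rw [hc, show p * (s p * c) = s p * p * c by ring]
      exact Ideal.mul_mem_right _ _ (hs p hp)
    have := hle' hp
    rwa [Submodule.mem_colon_singleton, smul_eq_mul, mul_comm] at this

end Sequences

/-! ### The canonical module as a homogeneous ideal -/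

section CanonicalIdeal

open RingTheory.Sequence DirectSum CategoryTheory Abelian

variable {R : Type u} [CommRing R]

/-- The canonical module embeds into `R / (rs)` with image `((rs) : P) / (rs)`, for a
regular sequence `rs` in `P` of the right length. -/
theorem exists_canonicalModule_embedding {P : Ideal R} {rs : List R} (hP : ∀ r ∈ rs, r ∈ P)
    (hreg : IsWeaklyRegular R rs) (hlen : (rs.length : ℕ∞) = P.height) :
    ∃ ψ : CanonicalModule P →ₗ[R] R ⧸ Ideal.ofList rs, Function.Injective ψ ∧
      ∀ z : R, Ideal.Quotient.mk _ z ∈ LinearMap.range ψ ↔ ∀ p ∈ P, p * z ∈ Ideal.ofList rs := by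
  obtain ⟨-, ⟨e⟩⟩ := ext_of_isWeaklyRegular (ModuleCat.of R (R ⧸ P)) rs (ModuleCat.of R R) hreg
    fun r hr => by
      change r ∈ Module.annihilator R (R ⧸ P)
      rw [Ideal.annihilator_quotient]
      exact hP r hr
  have hl : P.height.toNat = rs.length := by rw [← hlen, ENat.toNat_natCast]
  have e' : Ext (ModuleCat.of R (R ⧸ P)) (ModuleCat.of R R) P.height.toNat ≃ₗ[R]
      ((R ⧸ P) →ₗ[R] R ⧸ (Ideal.ofList rs • ⊤ : Submodule R R)) := by
    rw [hl]
    exact e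
  let e₁ : CanonicalModule P ≃ₗ[R] ((R ⧸ P) →ₗ[R] R ⧸ (Ideal.ofList rs • ⊤ : Submodule R R)) := e'
  have htop : (Ideal.ofList rs • ⊤ : Submodule R R) = Ideal.ofList rs := by
    rw [smul_eq_mul, Ideal.mul_top]
  let e₂ : (R ⧸ (Ideal.ofList rs • ⊤ : Submodule R R)) ≃ₗ[R] R ⧸ Ideal.ofList rs :=
    Submodule.quotEquivOfEq _ _ htop
  let e₃ : CanonicalModule P ≃ₗ[R] ((R ⧸ P) →ₗ[R] R ⧸ Ideal.ofList rs) :=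
    e₁.trans (LinearEquiv.congrRight e₂)
  let ev : ((R ⧸ P) →ₗ[R] R ⧸ Ideal.ofList rs) →ₗ[R] R ⧸ Ideal.ofList rs :=
    LinearMap.applyₗ (Submodule.Quotient.mk 1)
  refine ⟨ev.comp e₃.toLinearMap, ?_, fun z => ?_⟩
  · have hev : Function.Injective ev := by
      intro f g hfg
      refine LinearMap.ext fun y => ?_
      obtain ⟨r, rfl⟩ := Submodule.Quotient.mk_surjective P y
      have hr : (Submodule.Quotient.mk r : R ⧸ P) = r • Submodule.Quotient.mk 1 := by
        rw [← Submodule.Quotient.mk_smul, smul_eq_mul, mul_one]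
      rw [hr, map_smul, map_smul]
      exact congrArg (r • ·) hfg
    exact Function.Injective.comp (g := ev) (f := e₃) hev e₃.injective
  · rw [LinearMap.range_comp_of_range_eq_top _ (LinearEquiv.range e₃)]
    constructor
    · rintro ⟨f, hf⟩ p hp
      rw [← Ideal.Quotient.eq_zero_iff_mem, map_mul, ← hf]
      change p • f (Submodule.Quotient.mk 1) = 0
      rw [← map_smul, ← Submodule.Quotient.mk_smul, smul_eq_mul, mul_one,
        (Submodule.Quotient.mk_eq_zero P).mpr hp, map_zero]
    · intro h
      refine ⟨Submodule.liftQ P ((Submodule.mkQ _).comp (LinearMap.mulRight R z)) fun p hp => ?_, ?_⟩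
      · rw [LinearMap.mem_ker, LinearMap.comp_apply, Submodule.mkQ_apply,
          Submodule.Quotient.mk_eq_zero]
        exact h p hp
      · change Submodule.Quotient.mk (1 * z) = _
        rw [one_mul]
        rfl

/-- The canonical module of the quotient of a graded regular Cohen–Macaulay domain by a homogeneous
prime ideal `P` is isomorphic to a nonzero homogeneous ideal of that quotient, namely to `𝔟 / P`. It
is `(F : P) / F` for a homogeneous regular sequence; the generic regular sequence serves only to
bound the rank. -/
theorem exists_homogeneous_ideal_equiv_canonicalModule [IsDomain R] [IsRegularRing R]
    (hR : IsGradeFull R) {σ : Type*} [SetLike σ R] [AddSubgroupClass σ R]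
    {𝒜 : ℕ → σ} [GradedRing 𝒜] {P : Ideal R} [hPp : P.IsPrime]
    (hP : P.IsHomogeneous 𝒜) (hpos : ∀ f ∈ P, f ∈ 𝒜 0 → f = 0) :
    ∃ 𝔟 : Ideal R, 𝔟.IsHomogeneous 𝒜 ∧ P < 𝔟 ∧
      Nonempty (CanonicalModule P ≃ₗ[R ⧸ P] 𝔟.map (Ideal.Quotient.mk P)) := by
  obtain ⟨c, hc⟩ := ENat.ne_top_iff_exists.mp (P.height_ne_top hPp.ne_top)
  obtain ⟨f, hfP, hfh, hf, hfc⟩ := hR.exists_homogeneous_sequence hP hpos c hc.le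
  obtain ⟨g, hgP, hg, hgc, s, hsP, hsg⟩ := hR.exists_generic_sequence P
  obtain ⟨ψ, hψ, hψr⟩ := exists_canonicalModule_embedding hfP hf (hc ▸ congrArg _ hfc)
  obtain ⟨χ, hχ, hχr⟩ := exists_canonicalModule_embedding hgP hg hgc
  have hFP : Ideal.ofList f ≤ P := Ideal.span_le.mpr hfP
  generalize hF : Ideal.ofList f = F at hfh ψ hψ hψr hFP
  have hGP : Ideal.ofList g ≤ P := Ideal.span_le.mpr hgP
  -- `(F : P) / F` is torsion-free over `R / P`
  have htf : ∀ a ∉ P, ∀ z, (∀ p ∈ P, p * z ∈ F) → a * z ∈ F → z ∈ F := by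
    intro a ha z hz haz
    by_contra hzF
    obtain ⟨t, ht, ht'⟩ := hR.exists_avoid hf
    rw [hF] at ht'
    obtain ⟨Q, hQ, h⟩ := ht' z hzF
    have hlt : P < Q := SetLike.lt_iff_le_and_exists.mpr
      ⟨fun p hp => h p (hz p hp), a, h a haz, ha⟩
    have := (Ideal.height_strict_mono_of_isPrime hlt).trans_le (ht Q hQ).2
    rw [hfc, hc] at this
    exact lt_irrefl _ this
  have htf' : ∀ a ∉ P, ∀ x : CanonicalModule P, a • x = 0 → x = 0 := by
    intro a ha x hx
    obtain ⟨z, hz⟩ := Ideal.Quotient.mk_surjective (ψ x)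
    have h1 : a * z ∈ F := by
      rw [← Ideal.Quotient.eq_zero_iff_mem, map_mul, hz]
      change a • ψ x = 0
      rw [← map_smul, hx, map_zero]
    have h2 := htf a ha z ((hψr z).mp ⟨x, hz.symm⟩) h1
    rw [← Ideal.Quotient.eq_zero_iff_mem, hz] at h2
    exact hψ (h2.trans (map_zero ψ).symm)
  -- `(F : P) / F` has rank one over `R / P`
  obtain ⟨x₀, hx₀⟩ := (hχr s).mpr fun p hp => by rw [mul_comm]; exact hsg p hp
  have hrank : ∀ x : CanonicalModule P, ∃ a : R, s • x = a • x₀ := by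
    intro x
    obtain ⟨z, hz⟩ := Ideal.Quotient.mk_surjective (χ x)
    refine ⟨z, hχ ?_⟩
    rw [map_smul, map_smul, hx₀, ← hz]
    change Ideal.Quotient.mk _ (s * z) = Ideal.Quotient.mk _ (z * s)
    rw [mul_comm]
  have hx₀0 : x₀ ≠ 0 := by
    rintro rfl
    rw [map_zero, eq_comm, Ideal.Quotient.eq_zero_iff_mem] at hx₀
    exact hsP (hGP hx₀)
  set C := F.colon (P : Set R) with hC
  have hCmem (z : R) : z ∈ C ↔ Ideal.Quotient.mk F z ∈ LinearMap.range ψ := by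
    rw [hψr, hC, Submodule.mem_colon]
    exact forall₂_congr fun p _ => by rw [smul_eq_mul, mul_comm]
  have hCh : C.IsHomogeneous 𝒜 := isHomogeneous_colon hfh hP
  have hCF : ¬ C ≤ F := by
    obtain ⟨z, hz⟩ := Ideal.Quotient.mk_surjective (ψ x₀)
    intro hle
    have := hle ((hCmem z).mpr ⟨x₀, hz.symm⟩)
    rw [← Ideal.Quotient.eq_zero_iff_mem, hz] at this
    exact hx₀0 (hψ (this.trans (map_zero ψ).symm))
  -- since the rank is one, the class of a form `w` generates `(F : P) / F` generically
  obtain ⟨d, w, hwd, hwC, hwF⟩ := exists_homogeneous_notMem hCh hCF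
  have hPw : ∀ p ∈ P, p * w ∈ F := (hψr w).mp ((hCmem w).mp hwC)
  obtain ⟨y, hy⟩ := (hCmem w).mp hwC
  obtain ⟨a, ha⟩ := hrank y
  have hy0 : y ≠ 0 := by
    rintro rfl
    rw [map_zero, eq_comm, Ideal.Quotient.eq_zero_iff_mem] at hy
    exact hwF hy
  have haP : a ∉ P := by
    intro haP
    have h0 : a • x₀ = 0 := @canonicalModule_isTorsionBySet R _ P x₀ ⟨a, haP⟩
    exact hy0 (htf' s hsP y (ha.trans h0))
  set W := Ideal.span {w} ⊔ F with hW
  have hWh : W.IsHomogeneous 𝒜 := Ideal.IsHomogeneous.sup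
    (Ideal.homogeneous_span 𝒜 _ fun v hv => ⟨d, by rwa [Set.mem_singleton_iff.mp hv]⟩) hfh
  have hT : ¬ W.colon (C : Set R) ≤ P := by
    intro hle
    refine hPp.mul_notMem haP hsP (hle ?_)
    rw [Submodule.mem_colon]
    intro z hz
    obtain ⟨x, hx⟩ := (hCmem z).mp hz
    obtain ⟨b, hb⟩ := hrank x
    have h1 : (a * s) • x = (b * s) • y := by
      rw [mul_smul, hb, mul_smul, ha, ← mul_smul, ← mul_smul, mul_comm]
    have h2 : Ideal.Quotient.mk F (a * s * z) = Ideal.Quotient.mk F (b * s * w) := by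
      have := congrArg ψ h1
      rw [map_smul, map_smul, hx, hy] at this
      exact this
    rw [Ideal.Quotient.mk_eq_mk_iff_sub_mem] at h2
    rw [smul_eq_mul, ← sub_add_cancel (a * s * z) (b * s * w)]
    exact W.add_mem (Ideal.mem_sup_right h2)
      (Ideal.mem_sup_left (Ideal.mul_mem_left _ _ (Ideal.mem_span_singleton_self w)))
  -- a form `t` outside `P` with `t (F : P) ⊆ (w) + F`
  obtain ⟨d', t, htd, htW, htP⟩ := exists_homogeneous_notMem (isHomogeneous_colon hWh hCh) hT
  rw [Submodule.mem_colon] at htW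
  -- `(F : P) / F ≅ t (F : P) / F`, which is `w 𝔟 / F` for the ideal `𝔟 = (t (F : P) + F : w)`
  set E := Ideal.span {t} * C ⊔ F with hE
  have hEh : E.IsHomogeneous 𝒜 := Ideal.IsHomogeneous.sup (Ideal.IsHomogeneous.mul
    (Ideal.homogeneous_span 𝒜 _ fun v hv => ⟨d', by rwa [Set.mem_singleton_iff.mp hv]⟩) hCh) hfh
  have hspanw : (Ideal.span {w}).IsHomogeneous 𝒜 :=
    Ideal.homogeneous_span 𝒜 _ fun v hv => ⟨d, by rwa [Set.mem_singleton_iff.mp hv]⟩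
  set 𝔟 := E.colon ((Ideal.span {w} : Ideal R) : Set R) with h𝔟
  have h𝔟mem (b : R) : b ∈ 𝔟 ↔ b * w ∈ E := by
    rw [h𝔟, Submodule.mem_colon]
    refine ⟨fun h => h w (Ideal.mem_span_singleton_self w), fun h v hv => ?_⟩
    obtain ⟨v', rfl⟩ := Ideal.mem_span_singleton.mp hv
    rw [smul_eq_mul, ← mul_assoc]
    exact Ideal.mul_mem_right _ _ h
  have hP𝔟 : P ≤ 𝔟 := fun p hp => (h𝔟mem p).mpr (Ideal.mem_sup_right (hPw p hp))
  refine ⟨𝔟, isHomogeneous_colon hEh hspanw, lt_of_le_of_ne hP𝔟 ?_, ?_⟩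
  · intro h
    have : t ∈ 𝔟 := (h𝔟mem t).mpr
      (Ideal.mem_sup_left (Ideal.mul_mem_mul (Ideal.mem_span_singleton_self t) hwC))
    exact htP (h ▸ this)
  -- multiplication by `w` embeds `R / P` into `R / F`
  let ρ : (R ⧸ P) →ₗ[R] R ⧸ F :=
    Submodule.liftQ P ((Submodule.mkQ F).comp (LinearMap.mulRight R w)) fun p hp => by
      rw [LinearMap.mem_ker, LinearMap.comp_apply, Submodule.mkQ_apply,
        Submodule.Quotient.mk_eq_zero]
      exact hPw p hp
  have hρ (b : R) : ρ (Ideal.Quotient.mk P b) = Ideal.Quotient.mk F (b * w) := rfl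
  have hρi : Function.Injective ρ := by
    rw [← LinearMap.ker_eq_bot, LinearMap.ker_eq_bot']
    intro b hb
    obtain ⟨b, rfl⟩ := Ideal.Quotient.mk_surjective b
    rw [hρ, Ideal.Quotient.eq_zero_iff_mem] at hb
    rw [Ideal.Quotient.eq_zero_iff_mem]
    by_contra hbP
    exact hwF (htf b hbP w hPw hb)
  have htψ : Function.Injective (t • ψ) := by
    rw [← LinearMap.ker_eq_bot, LinearMap.ker_eq_bot']
    intro x hx
    rw [LinearMap.smul_apply, ← map_smul] at hx
    exact htf' t htP x (hψ (hx.trans (map_zero ψ).symm))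
  let B : Submodule R (R ⧸ P) := (𝔟.map (Ideal.Quotient.mk P)).restrictScalars R
  have hB (b : R) : Ideal.Quotient.mk P b ∈ B ↔ b ∈ 𝔟 := by
    change _ ∈ 𝔟.map (Ideal.Quotient.mk P) ↔ _
    rw [Ideal.mem_quotient_iff_mem hP𝔟]
  have hrange : LinearMap.range (t • ψ) = LinearMap.range (ρ.comp B.subtype) := by
    ext v
    constructor
    · rintro ⟨x, rfl⟩
      obtain ⟨z, hz⟩ := Ideal.Quotient.mk_surjective (ψ x)
      have hzC : z ∈ C := (hCmem z).mpr ⟨x, hz.symm⟩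
      obtain ⟨u, hu, v, hv, huv⟩ := Submodule.mem_sup.mp (htW z hzC)
      obtain ⟨b, rfl⟩ := Ideal.mem_span_singleton'.mp hu
      have hbE : b * w ∈ E := by
        have : b * w = t * z - v := by rw [← smul_eq_mul t z, ← huv, add_sub_cancel_right]
        rw [this]
        exact E.sub_mem (Ideal.mem_sup_left (Ideal.mul_mem_mul
          (Ideal.mem_span_singleton_self t) hzC)) (Ideal.mem_sup_right hv)
      refine ⟨⟨Ideal.Quotient.mk P b, (hB b).mpr ((h𝔟mem b).mpr hbE)⟩, ?_⟩
      rw [LinearMap.comp_apply, Submodule.subtype_apply, hρ, LinearMap.smul_apply, ← hz]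
      change _ = Ideal.Quotient.mk F (t * z)
      rw [Ideal.Quotient.mk_eq_mk_iff_sub_mem, ← smul_eq_mul t z, ← huv, sub_add_cancel_left]
      exact F.neg_mem hv
    · rintro ⟨⟨b, hb⟩, rfl⟩
      obtain ⟨b, rfl⟩ := Ideal.Quotient.mk_surjective b
      obtain ⟨u, hu, v, hv, huv⟩ := Submodule.mem_sup.mp ((h𝔟mem b).mp ((hB b).mp hb))
      obtain ⟨z, hz, rfl⟩ := Ideal.mem_span_singleton_mul.mp hu
      obtain ⟨x, hx⟩ := (hCmem z).mp hz
      refine ⟨x, ?_⟩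
      rw [LinearMap.comp_apply, Submodule.subtype_apply, hρ, LinearMap.smul_apply, hx]
      change Ideal.Quotient.mk F (t * z) = _
      rw [Ideal.Quotient.mk_eq_mk_iff_sub_mem, ← huv, sub_add_cancel_left]
      exact F.neg_mem hv
  have hρB : Function.Injective (ρ.comp B.subtype) :=
    Function.Injective.comp (g := ρ) (f := B.subtype) hρi B.injective_subtype
  let e : CanonicalModule P ≃ₗ[R] B :=
    (LinearEquiv.ofInjective _ htψ).trans ((LinearEquiv.ofEq _ _ hrange).trans
      (LinearEquiv.ofInjective _ hρB).symm)
  refine ⟨{ e.toAddEquiv with map_smul' := fun r x => ?_ }⟩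
  obtain ⟨r, rfl⟩ := Ideal.Quotient.mk_surjective r
  exact e.map_smul r x

end CanonicalIdeal

/-! ### Divisor classes and reflexive powers over a domain -/

section Divisors

variable {S : Type*} [CommRing S]

local notation "K" => FractionRing S

/-- A linear map from a submodule of the fraction field is multiplication by an element of that
field. -/
theorem linearMap_mul_comm [IsDomain S] (L : Submodule S K) (φ : L →ₗ[S] K) (x y : L) :
    φ x * (y : K) = φ y * (x : K) := by
  obtain ⟨p, q, hq, hx⟩ := IsFractionRing.div_surjective (A := S) (x : K)
  obtain ⟨p', q', hq', hy⟩ := IsFractionRing.div_surjective (A := S) (y : K)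
  have hq0 : algebraMap S K q ≠ 0 := IsFractionRing.to_map_ne_zero_of_mem_nonZeroDivisors hq
  have hq0' : algebraMap S K q' ≠ 0 := IsFractionRing.to_map_ne_zero_of_mem_nonZeroDivisors hq'
  have h : (q * p') • x = (q' * p) • y := by
    apply Subtype.ext
    rw [Submodule.coe_smul, Submodule.coe_smul, Algebra.smul_def, Algebra.smul_def, ← hx, ← hy,
      map_mul, map_mul]
    field_simp
  have h2 := congrArg φ h
  rw [map_smul, map_smul, Algebra.smul_def, Algebra.smul_def, map_mul, map_mul] at h2
  rw [← hx, ← hy]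
  field_simp
  linear_combination h2

/-- Let `μ : M → K` be such that every functional on `M` is a multiple of `μ`. Then the dual of `M`
is `(S : μ(M))`. -/
theorem exists_dual_equiv [IsDomain S] {M : Type*} [AddCommGroup M] [Module S M] (μ : M →ₗ[S] K)
    (m₀ : M) (hm₀ : μ m₀ ≠ 0) (h : ∀ (φ : Module.Dual S M) (m : M),
      algebraMap S K (φ m) * μ m₀ = algebraMap S K (φ m₀) * μ m) :
    Nonempty (Module.Dual S M ≃ₗ[S] (1 / LinearMap.range μ : Submodule S K)) := by
  let ev : Module.Dual S M →ₗ[S] K :=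
    (LinearMap.mulRight S (μ m₀)⁻¹).comp ((Algebra.linearMap S K).comp (LinearMap.applyₗ m₀))
  have hev (φ : Module.Dual S M) : ev φ = algebraMap S K (φ m₀) * (μ m₀)⁻¹ := rfl
  have hev' (φ : Module.Dual S M) (m : M) : ev φ * μ m = algebraMap S K (φ m) := by
    rw [hev, mul_right_comm, ← h φ m, mul_assoc, mul_inv_cancel₀ hm₀, mul_one]
  have hinj : Function.Injective ev := by
    intro φ ψ hφ
    refine LinearMap.ext fun m => IsFractionRing.injective S K ?_
    rw [← hev', hφ, hev']
  have hrange : LinearMap.range ev = 1 / LinearMap.range μ := by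
    ext x
    rw [Submodule.mem_div_iff_forall_mul_mem]
    constructor
    · rintro ⟨φ, rfl⟩ _ ⟨m, rfl⟩
      rw [hev']
      exact Submodule.algebraMap_mem _
    · intro hx
      have hmem (m : M) :
          (LinearMap.mulLeft S x).comp μ m ∈ LinearMap.range (Algebra.linearMap S K) := by
        have := hx (μ m) ⟨m, rfl⟩
        rwa [Submodule.one_eq_range] at this
      let e := LinearEquiv.ofInjective (Algebra.linearMap S K) (IsFractionRing.injective S K)
      let φ : Module.Dual S M := e.symm.toLinearMap.comp (LinearMap.codRestrict _ _ hmem)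
      have hφ (m : M) : algebraMap S K (φ m) = x * μ m := by
        change ((e (e.symm _) : LinearMap.range (Algebra.linearMap S K)) : K) = _
        rw [LinearEquiv.apply_symm_apply]
        rfl
      refine ⟨φ, ?_⟩
      rw [hev, hφ, mul_assoc, mul_inv_cancel₀ hm₀, mul_one]
  exact ⟨(LinearEquiv.ofInjective ev hinj).trans (LinearEquiv.ofEq _ _ hrange)⟩

theorem exists_dual_equiv_of_ne_bot [IsDomain S] (L : Submodule S K) (hL : L ≠ ⊥) :
    Nonempty (Module.Dual S L ≃ₗ[S] (1 / L : Submodule S K)) := by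
  obtain ⟨x, hx, hx0⟩ := (Submodule.ne_bot_iff L).mp hL
  have := exists_dual_equiv L.subtype ⟨x, hx⟩ hx0 fun φ m =>
    linearMap_mul_comm L ((Algebra.linearMap S K).comp φ) m ⟨x, hx⟩
  rwa [Submodule.range_subtype] at this

theorem pow_le_iff (L : Submodule S K) (N : ℕ) (L' : Submodule S K) :
    L ^ N ≤ L' ↔ ∀ y : Fin N → L, ∏ i, (y i : K) ∈ L' := by
  rw [Submodule.pow_eq_span_pow_set, Submodule.span_le]
  constructor
  · intro h y
    refine h (Set.mem_pow.mpr ⟨fun i => ⟨y i, (y i).2⟩, ?_⟩)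
    rw [List.prod_ofFn]
  · intro h x hx
    obtain ⟨y, rfl⟩ := Set.mem_pow.mp hx
    rw [List.prod_ofFn]
    exact h y

/-- The product map on a tensor power of a module embedded in the fraction field. -/
def tensorPowerMul {P : Type*} [AddCommGroup P] [Module S P] (ι : P →ₗ[S] K) (N : ℕ) :
    (⨂[S]^N P) →ₗ[S] K :=
  PiTensorProduct.lift
    ((MultilinearMap.mkPiAlgebra S (Fin N) K).compLinearMap fun _ => ι)

theorem tensorPowerMul_tprod {P : Type*} [AddCommGroup P] [Module S P] (ι : P →ₗ[S] K) (N : ℕ)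
    (y : Fin N → P) : tensorPowerMul ι N (PiTensorProduct.tprod S y) = ∏ i, ι (y i) := by
  rw [tensorPowerMul, PiTensorProduct.lift.tprod]
  rfl

theorem range_tensorPowerMul {P : Type*} [AddCommGroup P] [Module S P] (ι : P →ₗ[S] K) (N : ℕ) :
    LinearMap.range (tensorPowerMul ι N) = LinearMap.range ι ^ N := by
  apply le_antisymm
  · rw [LinearMap.range_eq_map, ← PiTensorProduct.span_tprod_eq_top, Submodule.map_span,
      Submodule.span_le]
    rintro _ ⟨_, ⟨y, rfl⟩, rfl⟩
    rw [tensorPowerMul_tprod]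
    exact (pow_le_iff (LinearMap.range ι) N _).mp le_rfl fun i => ⟨ι (y i), ⟨y i, rfl⟩⟩
  · rw [pow_le_iff]
    intro y
    choose z hz using fun i => (y i).2
    refine ⟨PiTensorProduct.tprod S z, ?_⟩
    rw [tensorPowerMul_tprod]
    exact Finset.prod_congr rfl fun i _ => hz i

/-- The reflexive powers of a module isomorphic to a fractional ideal `J` are the divisorial hulls
of the powers of `J`. The tensor power may have torsion, but functionals on it factor through
`J ^ N`. -/
theorem exists_reflexivePower_equiv [IsDomain S] {P : Type*} [AddCommGroup P] [Module S P]
    {J : RegularFractionalIdeal S} (e : P ≃ₗ[S] (J : FractionalIdeal S⁰ K)) (N : ℕ) :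
    Nonempty (ReflexivePower S P N ≃ₗ[S]
      divisorialHull (((J : FractionalIdeal S⁰ K) : Submodule S K) ^ N)) := by
  obtain ⟨J, x, hx, hxu⟩ := J
  let ι : P →ₗ[S] K := (J : Submodule S K).subtype.comp e.toLinearMap
  have hιr : LinearMap.range ι = J := by
    rw [LinearMap.range_comp_of_range_eq_top _ (LinearEquiv.range e), Submodule.range_subtype]
  have hι : Function.Injective ι :=
    Function.Injective.comp (g := (J : Submodule S K).subtype) (f := e)
      (Submodule.injective_subtype _) e.injective
  obtain ⟨b, hb⟩ : ∃ b, ι b = x := by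
    change x ∈ LinearMap.range ι
    rw [hιr]; exact hx
  have hb0 : ι b ≠ 0 := hb ▸ hxu.ne_zero
  obtain ⟨e₁⟩ := exists_dual_equiv (tensorPowerMul ι N) (PiTensorProduct.tprod S fun _ => b)
    (by rw [tensorPowerMul_tprod]; exact Finset.prod_ne_zero_iff.mpr fun _ _ => hb0) (by
      intro φ
      let A : (⨂[S]^N P) →ₗ[S] K := (LinearMap.mulRight S (tensorPowerMul ι N
        (PiTensorProduct.tprod S fun _ => b))).comp ((Algebra.linearMap S K).comp φ)
      let B : (⨂[S]^N P) →ₗ[S] K := (LinearMap.mulLeft S (algebraMap S K (φ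
        (PiTensorProduct.tprod S fun _ => b)))).comp (tensorPowerMul ι N)
      suffices h : A = B from fun m => LinearMap.congr_fun h m
      refine PiTensorProduct.ext (MultilinearMap.ext fun y => ?_)
      change algebraMap S K (φ (PiTensorProduct.tprod S y)) * tensorPowerMul ι N
        (PiTensorProduct.tprod S fun _ => b) = algebraMap S K (φ
        (PiTensorProduct.tprod S fun _ => b)) * tensorPowerMul ι N (PiTensorProduct.tprod S y)
      rw [tensorPowerMul_tprod, tensorPowerMul_tprod]
      -- write each `y i` as a fraction times `b`
      have hy (i : Fin N) : ∃ p q : S, q ≠ 0 ∧ q • y i = p • b := by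
        obtain ⟨p, q, hq, hpq⟩ := IsFractionRing.div_surjective (A := S) (ι (y i) / ι b)
        have hq0 : algebraMap S K q ≠ 0 :=
          IsFractionRing.to_map_ne_zero_of_mem_nonZeroDivisors hq
        refine ⟨p, q, nonZeroDivisors.ne_zero hq, hι ?_⟩
        rw [map_smul, map_smul, Algebra.smul_def, Algebra.smul_def]
        field_simp at hpq
        linear_combination -hpq
      choose p q hq hpq using hy
      have h1 := congrArg (fun z => φ (PiTensorProduct.tprod S z)) (funext hpq)
      simp only [MultilinearMap.map_smul_univ, map_smul, smul_eq_mul] at h1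
      have h2 : (∏ i, algebraMap S K (q i)) * ∏ i, ι (y i) =
          (∏ i, algebraMap S K (p i)) * ∏ _i : Fin N, ι b := by
        rw [← Finset.prod_mul_distrib, ← Finset.prod_mul_distrib]
        refine Finset.prod_congr rfl fun i _ => ?_
        have := congrArg ι (hpq i)
        rwa [map_smul, map_smul, Algebra.smul_def, Algebra.smul_def] at this
      have h3 := congrArg (algebraMap S K) h1
      rw [map_mul, map_mul, map_prod, map_prod] at h3
      have h4 : ∏ i, algebraMap S K (q i) ≠ 0 := Finset.prod_ne_zero_iff.mpr fun i _ =>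
        (map_ne_zero_iff _ (IsFractionRing.injective S K)).mpr (hq i)
      refine mul_left_cancel₀ h4 ?_
      linear_combination (∏ _i : Fin N, ι b) * h3 - algebraMap S K (φ
        (PiTensorProduct.tprod S fun _ => b)) * h2)
  rw [range_tensorPowerMul, hιr] at e₁
  have hne : (1 / ((J : Submodule S K) ^ N) : Submodule S K) ≠ ⊥ := by
    obtain ⟨a, ha, haJ⟩ := (J ^ N).isFractional
    refine (Submodule.ne_bot_iff _).mpr ⟨algebraMap S K a, ?_,
      IsFractionRing.to_map_ne_zero_of_mem_nonZeroDivisors ha⟩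
    rw [Submodule.mem_div_iff_forall_mul_mem]
    intro y hy
    obtain ⟨s, hs⟩ := haJ y (by rw [FractionalIdeal.coe_pow]; exact hy)
    rw [← Algebra.smul_def, ← hs]
    exact Submodule.algebraMap_mem s
  obtain ⟨e₂⟩ := exists_dual_equiv_of_ne_bot _ hne
  exact ⟨(LinearEquiv.dualMap e₁.symm).trans e₂⟩

/-- Isomorphic fractional ideals differ by a principal one. -/
theorem exists_eq_span_mul [IsDomain S] {J J' : RegularFractionalIdeal S}
    (e : (J : FractionalIdeal S⁰ K) ≃ₗ[S] (J' : FractionalIdeal S⁰ K)) :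
    ∃ u : (K)ˣ, ((J' : FractionalIdeal S⁰ K) : Submodule S K) =
      Submodule.span S {(u : K)} * ((J : FractionalIdeal S⁰ K) : Submodule S K) := by
  obtain ⟨x, hx, hxu⟩ := J.2
  generalize (J : FractionalIdeal S⁰ K) = J at *
  generalize (J' : FractionalIdeal S⁰ K) = J' at *
  have hx0 := hxu.ne_zero
  have hex : (e ⟨x, hx⟩ : K) ≠ 0 := by
    intro h0
    have h1 : e ⟨x, hx⟩ = 0 := Subtype.ext h0
    rw [LinearEquiv.map_eq_zero_iff] at h1
    exact hx0 (congrArg Subtype.val h1)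
  have key (z : (J : Submodule S K)) : (e z : K) = ((e ⟨x, hx⟩ : K) / x) * z := by
    have := linearMap_mul_comm (J : Submodule S K)
      ((J' : Submodule S K).subtype.comp e.toLinearMap) z ⟨x, hx⟩
    field_simp
    exact this
  refine ⟨Units.mk0 _ (div_ne_zero hex hx0), ?_⟩
  ext y
  rw [Submodule.mem_span_singleton_mul, Units.val_mk0]
  constructor
  · intro hy
    refine ⟨e.symm ⟨y, hy⟩, (e.symm ⟨y, hy⟩).2, ?_⟩
    rw [← key, LinearEquiv.apply_symm_apply]
  · rintro ⟨z, hz, rfl⟩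
    rw [← key ⟨z, hz⟩]
    exact (e _).2

theorem HasDivisorClass.unique [IsDomain S] {P : Type*} [AddCommGroup P] [Module S P]
    {c c' : DivisorClassGroup S} (h : HasDivisorClass P c) (h' : HasDivisorClass P c') : c = c' := by
  obtain ⟨J, ⟨e⟩, rfl⟩ := h
  obtain ⟨J', ⟨e'⟩, rfl⟩ := h'
  obtain ⟨u, hu⟩ := exists_eq_span_mul (e'.symm.trans e)
  exact congrArg Additive.ofMul ((Con.eq (linEquivCon S)).mpr ⟨u, by rw [hu]⟩)

theorem one_div_span_singleton (u : (K)ˣ) :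
    1 / Submodule.span S {(u : K)} = Submodule.span S {((u⁻¹ : (K)ˣ) : K)} := by
  ext y
  rw [Submodule.mem_div_iff_forall_mul_mem, Submodule.mem_span_singleton]
  constructor
  · intro h
    obtain ⟨s, hs⟩ := Submodule.mem_one.mp (h u (Submodule.mem_span_singleton_self _))
    refine ⟨s, ?_⟩
    rw [Algebra.smul_def, hs, mul_assoc, Units.mul_inv, mul_one]
  · rintro ⟨s, rfl⟩ z hz
    obtain ⟨t, rfl⟩ := Submodule.mem_span_singleton.mp hz
    rw [smul_mul_smul_comm, Units.inv_mul, Algebra.smul_def, mul_one]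
    exact Submodule.algebraMap_mem _

theorem divisorialHull_span_singleton (u : (K)ˣ) :
    divisorialHull (Submodule.span S {(u : K)}) = Submodule.span S {(u : K)} := by
  rw [divisorialHull, one_div_span_singleton, one_div_span_singleton, inv_inv]

theorem nsmul_divisorClass_eq_zero_iff (J : RegularFractionalIdeal S) (N : ℕ) :
    N • divisorClass J = 0 ↔ ∃ u : (K)ˣ,
      divisorialHull (((J : FractionalIdeal S⁰ K) : Submodule S K) ^ N) =
        Submodule.span S {(u : K)} := by
  have h1 : N • divisorClass J = divisorClass (J ^ N) := rfl
  have h2 : (0 : DivisorClassGroup S) = divisorClass 1 := rfl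
  rw [h1, h2, divisorClass, divisorClass, Additive.ofMul.apply_eq_iff_eq, Con.eq]
  change LinEquiv (((J ^ N : RegularFractionalIdeal S) : FractionalIdeal S⁰ K)) 1 ↔ _
  rw [LinEquiv, SubmonoidClass.coe_pow, FractionalIdeal.coe_pow, FractionalIdeal.coe_one]
  simp only [mul_one, divisorialHull_span_singleton]

theorem isLocallyFree_span_singleton [IsDomain S] (u : (K)ˣ) {P : Type*} [AddCommGroup P]
    [Module S P] (e : P ≃ₗ[S] Submodule.span S {(u : K)}) : IsLocallyFree S P := by
  have h : Module.Free S (Submodule.span S {(u : K)}) :=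
    Module.Free.of_equiv (LinearEquiv.toSpanNonzeroSingleton S K u u.ne_zero)
  have hP : Module.Free S P := Module.Free.of_equiv e.symm
  intro p
  refine ⟨1, p.isPrime.one_notMem, ?_⟩
  exact Module.free_of_isLocalizedModule (Submonoid.powers 1)
    (LocalizedModule.mkLinearMap (Submonoid.powers 1) P)

end Divisors

/-! ### Homogeneous divisorial ideals -/

section Colon

variable {S : Type*} [CommRing S]

/-- The divisorial hull of an integral ideal, computed with colon ideals of `S`. -/
theorem divisorialHull_coeSubmodule [IsDomain S] {I : Ideal S} {a : S} (haI : a ∈ I) (ha : a ≠ 0) :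
    divisorialHull (IsLocalization.coeSubmodule (FractionRing S) I) =
      IsLocalization.coeSubmodule (FractionRing S)
        ((Ideal.span {a}).colon (((Ideal.span {a}).colon (I : Set S) : Ideal S) : Set S)) := by
  have hinj := IsFractionRing.injective S (FractionRing S)
  have ha0 : algebraMap S (FractionRing S) a ≠ 0 := (map_ne_zero_iff _ hinj).mpr ha
  have hcol (s : S) : s ∈ (Ideal.span {a}).colon (I : Set S) ↔
      algebraMap S (FractionRing S) s / algebraMap S (FractionRing S) a ∈
        1 / IsLocalization.coeSubmodule (FractionRing S) I := by
    rw [Submodule.mem_colon, Submodule.mem_div_iff_forall_mul_mem]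
    constructor
    · rintro h _ ⟨i, hi, rfl⟩
      obtain ⟨t, ht⟩ := Ideal.mem_span_singleton'.mp (h i hi)
      refine Submodule.mem_one.mpr ⟨t, ?_⟩
      rw [Algebra.linearMap_apply, div_mul_eq_mul_div, ← map_mul, eq_div_iff ha0, ← map_mul, ht,
        smul_eq_mul]
    · intro h i hi
      obtain ⟨t, ht⟩ := Submodule.mem_one.mp (h _ ⟨i, hi, rfl⟩)
      refine Ideal.mem_span_singleton'.mpr ⟨t, hinj ?_⟩
      rw [Algebra.linearMap_apply, div_mul_eq_mul_div, ← map_mul, eq_div_iff ha0, ← map_mul] at ht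
      rw [ht, smul_eq_mul]
  have haC : a ∈ (Ideal.span {a}).colon (I : Set S) := by
    rw [Submodule.mem_colon]
    exact fun i _ => Ideal.mul_mem_right _ _ (Ideal.mem_span_singleton_self a)
  ext z
  rw [divisorialHull, Submodule.mem_div_iff_forall_mul_mem]
  constructor
  · intro h
    obtain ⟨t, ht⟩ := Submodule.mem_one.mp (h 1 (by
      rw [← div_self ha0]; exact (hcol a).mp haC))
    rw [mul_one] at ht
    refine ⟨t, ?_, ht⟩
    rw [SetLike.mem_coe, Submodule.mem_colon]
    intro s hs
    obtain ⟨w, hw⟩ := Submodule.mem_one.mp (h _ ((hcol s).mp hs))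
    refine Ideal.mem_span_singleton'.mpr ⟨w, hinj ?_⟩
    rw [smul_eq_mul, map_mul, map_mul, hw, ht]
    field_simp
  · rintro ⟨t, ht, rfl⟩ y hy
    have hay : algebraMap S (FractionRing S) a * y ∈ (1 : Submodule S (FractionRing S)) := by
      rw [mul_comm]
      exact Submodule.mem_div_iff_forall_mul_mem.mp hy _ ⟨a, haI, rfl⟩
    obtain ⟨s, hs⟩ := Submodule.mem_one.mp hay
    have hys : y = algebraMap S (FractionRing S) s / algebraMap S (FractionRing S) a := by
      rw [hs]; field_simp
    rw [SetLike.mem_coe, Submodule.mem_colon] at ht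
    obtain ⟨w, hw⟩ := Ideal.mem_span_singleton'.mp (ht s ((hcol s).mpr (hys ▸ hy)))
    refine Submodule.mem_one.mpr ⟨w, ?_⟩
    rw [hys, Algebra.linearMap_apply, ← mul_div_assoc, eq_div_iff ha0, ← map_mul, ← map_mul, hw,
      smul_eq_mul]

theorem comap_colon {R : Type*} [CommRing R] {f : R →+* S} (hf : Function.Surjective f)
    (I J : Ideal S) : (I.colon (J : Set S)).comap f =
      (I.comap f).colon ((J.comap f : Ideal R) : Set R) := by
  ext x
  rw [Ideal.mem_comap, Submodule.mem_colon, Submodule.mem_colon]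
  constructor
  · intro h y hy
    rw [smul_eq_mul, Ideal.mem_comap, map_mul]
    exact h _ hy
  · intro h y hy
    obtain ⟨z, rfl⟩ := hf y
    rw [smul_eq_mul, ← map_mul]
    exact h z hy

/-- If a module isomorphic to an ideal `𝔥` is locally free, then `𝔥` is principal near every point:
some `t` outside the given prime multiplies `𝔥` into `h S` with `h ∈ 𝔥`. -/
theorem IsLocallyFree.exists_mul_mem_span [IsDomain S] {Q : Type*} [AddCommGroup Q] [Module S Q]
    (hQ : IsLocallyFree S Q) {𝔥 : Ideal S} (h𝔥 : 𝔥.FG) (e : Q ≃ₗ[S] 𝔥)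
    (p : PrimeSpectrum S) :
    ∃ t ∉ p.asIdeal, ∃ h ∈ 𝔥, ∀ x ∈ 𝔥, t * x ∈ Ideal.span {h} := by
  obtain ⟨f, hfp, hfree⟩ := hQ p
  by_cases h0 : 𝔥 = ⊥
  · refine ⟨1, p.isPrime.one_notMem, 0, zero_mem _, fun x hx => ?_⟩
    rw [h0] at hx
    rw [(Submodule.mem_bot S).mp hx, mul_zero]
    exact zero_mem _
  have hf0 : f ≠ 0 := fun h => hfp (h ▸ zero_mem _)
  have hpow (c : Submonoid.powers f) : (c : S) ≠ 0 := by
    obtain ⟨c, k, rfl⟩ := c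
    exact pow_ne_zero k hf0
  let φ : 𝔥 →ₗ[S] LocalizedModule (Submonoid.powers f) Q :=
    (LocalizedModule.mkLinearMap (Submonoid.powers f) Q).comp e.symm.toLinearMap
  have hφ : Function.Injective φ := by
    intro x y hxy
    obtain ⟨c, hc⟩ := IsLocalizedModule.exists_of_eq (S := Submonoid.powers f)
      (f := LocalizedModule.mkLinearMap (Submonoid.powers f) Q) hxy
    have h1 : e ((c : S) • e.symm x) = e ((c : S) • e.symm y) := congrArg e hc
    rw [map_smul, map_smul, LinearEquiv.apply_symm_apply, LinearEquiv.apply_symm_apply] at h1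
    exact Subtype.ext (mul_left_cancel₀ (hpow c) (congrArg Subtype.val h1))
  have hsurj (y : LocalizedModule (Submonoid.powers f) Q) :
      ∃ (c : Submonoid.powers f) (x : 𝔥), (c : S) • y = φ x := by
    obtain ⟨⟨q, c⟩, hq⟩ := IsLocalizedModule.surj (Submonoid.powers f)
      (LocalizedModule.mkLinearMap (Submonoid.powers f) Q) y
    refine ⟨c, e q, ?_⟩
    change _ = LocalizedModule.mkLinearMap (Submonoid.powers f) Q (e.symm (e q))
    rw [LinearEquiv.symm_apply_apply]
    exact hq
  let A := Localization.Away f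
  have hAinj : Function.Injective (algebraMap S A) :=
    IsLocalization.injective A (powers_le_nonZeroDivisors_of_noZeroDivisors hf0)
  obtain ⟨ι, b⟩ := Module.Free.exists_basis (R := A) (M := LocalizedModule (Submonoid.powers f) Q)
  have : Nontrivial A := hAinj.nontrivial
  have hcomm (x y : 𝔥) : (x : S) • φ y = (y : S) • φ x := by
    rw [← map_smul, ← map_smul]
    exact congrArg φ (Subtype.ext (mul_comm _ _))
  have hbφ (i : ι) : ∃ (c : Submonoid.powers f) (x : 𝔥), (c : S) • b i = φ x ∧ (x : S) ≠ 0 := by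
    obtain ⟨c, x, hx⟩ := hsurj (b i)
    refine ⟨c, x, hx, fun hx0 => ?_⟩
    have hx1 : x = 0 := Subtype.ext hx0
    rw [hx1, map_zero, ← algebraMap_smul A] at hx
    have h2 := congrArg (fun z => b.repr z i) hx
    simp only [map_smul, Module.Basis.repr_self, Finsupp.smul_single, smul_eq_mul, mul_one,
      Finsupp.single_eq_same, map_zero, Finsupp.zero_apply] at h2
    exact hpow c (hAinj (h2.trans (map_zero _).symm))
  -- a basis has exactly one element, since any two elements of an ideal are linearly dependent
  have hsub : Subsingleton ι := by
    refine ⟨fun i j => by_contra fun hij => ?_⟩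
    obtain ⟨c, x, hx, hx0⟩ := hbφ i
    obtain ⟨d, y, hy, hy0⟩ := hbφ j
    have h1 := hcomm x y
    rw [← hx, ← hy, ← algebraMap_smul A, ← algebraMap_smul A (d : S), ← algebraMap_smul A (y : S),
      ← algebraMap_smul A (c : S)] at h1
    have h2 := congrArg (fun z => b.repr z i) h1
    simp only [map_smul, Module.Basis.repr_self, Finsupp.smul_single, smul_eq_mul, mul_one,
      Finsupp.single_eq_same] at h2
    rw [Finsupp.single_eq_of_ne hij, ← map_mul] at h2
    exact mul_ne_zero hy0 (hpow c) (hAinj (h2.symm.trans (map_zero _).symm))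
  obtain ⟨x₀, hx₀, hx₀0⟩ := (Submodule.ne_bot_iff 𝔥).mp h0
  have hne : Nonempty ι := by
    by_contra hemp
    have := not_nonempty_iff.mp hemp
    have h1 : b.repr (φ ⟨x₀, hx₀⟩) = b.repr (φ 0) := Subsingleton.elim _ _
    exact hx₀0 (congrArg Subtype.val (hφ (b.repr.injective h1)))
  obtain ⟨i⟩ := hne
  obtain ⟨c, h, hh, hh0⟩ := hbφ i
  have hgen (x : 𝔥) : ∃ k : ℕ, f ^ k * (x : S) ∈ Ideal.span {(h : S)} := by
    have h1 : φ x = b.repr (φ x) i • b i := by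
      apply b.repr.injective
      ext j
      rw [Subsingleton.elim j i]
      simp
    obtain ⟨⟨s, ⟨_, l, rfl⟩⟩, hs⟩ := IsLocalization.surj (Submonoid.powers f) (b.repr (φ x) i)
    change b.repr (φ x) i * algebraMap S A (f ^ l) = algebraMap S A s at hs
    obtain ⟨c, m, rfl⟩ := c
    change f ^ m • b i = φ h at hh
    refine ⟨l + m, Ideal.mem_span_singleton'.mpr ⟨s, ?_⟩⟩
    have h2 : (f ^ (l + m)) • φ x = s • φ h := by
      rw [← hh, pow_add, mul_smul, smul_comm, ← algebraMap_smul A (f ^ l)]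
      conv_lhs => rw [h1]
      rw [← mul_smul (algebraMap S A (f ^ l)), mul_comm, hs, algebraMap_smul, smul_comm]
    rw [← map_smul, ← map_smul] at h2
    exact (congrArg Subtype.val (hφ h2)).symm
  obtain ⟨G, hG⟩ := h𝔥
  have hG' (g : S) (hg : g ∈ G) : g ∈ 𝔥 := hG ▸ Ideal.subset_span hg
  choose k hk using hgen
  classical
  let K := G.attach.sup fun g => k ⟨g, hG' g g.2⟩
  refine ⟨f ^ K, fun hmem => hfp (p.isPrime.mem_of_pow_mem _ hmem), h, h.2, ?_⟩
  suffices h1 : 𝔥 ≤ Submodule.comap (LinearMap.mulLeft S (f ^ K)) (Ideal.span {(h : S)}) from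
    fun x hx => h1 hx
  refine hG.ge.trans (Ideal.span_le.mpr ?_)
  intro g hg
  change f ^ K * g ∈ Ideal.span {(h : S)}
  have hle : k ⟨g, hG' g hg⟩ ≤ K :=
    Finset.le_sup (f := fun g : G => k ⟨g, hG' g g.2⟩) (Finset.mem_attach G ⟨g, hg⟩)
  obtain ⟨l, hl⟩ := Nat.exists_eq_add_of_le' hle
  rw [hl, pow_add, mul_assoc]
  exact Ideal.mul_mem_left _ _ (hk _)

end Colon

section Graded

open DirectSum

variable {A σ : Type*} [CommRing A] [SetLike σ A] [AddSubgroupClass σ A] {𝒜 : ℕ → σ} [GradedRing 𝒜]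

theorem isHomogeneous_pow {I : Ideal A} (hI : I.IsHomogeneous 𝒜) (N : ℕ) :
    (I ^ N).IsHomogeneous 𝒜 := by
  induction N with
  | zero => rw [pow_zero, Ideal.one_eq_top]; exact Ideal.IsHomogeneous.top 𝒜
  | succ N ih => rw [pow_succ]; exact ih.mul hI

/-- A graded version of Nakayama's lemma for rank one: modulo a homogeneous prime `P`, a homogeneous
ideal which is principal near the origin is principal. Some homogeneous component of a local
generator is itself a local generator, and a homogeneous local generator is a global one. -/
theorem exists_le_span_sup (h0 : ∀ a ∈ 𝒜 0, a ≠ 0 → IsUnit a) {P 𝔤 : Ideal A} [P.IsPrime]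
    (hP : P.IsHomogeneous 𝒜) (h𝔤 : 𝔤.IsHomogeneous 𝒜) (hP0 : ∀ f ∈ P, (decompose 𝒜 f 0 : A) = 0)
    {t h : A} (ht : (decompose 𝒜 t 0 : A) ≠ 0) (hh : h ∈ 𝔤)
    (hth : ∀ x ∈ 𝔤, t * x ∈ Ideal.span {h} ⊔ P) : ∃ g ∈ 𝔤, 𝔤 ≤ Ideal.span {g} ⊔ P := by
  classical
  have htP : t ∉ P := fun htP => ht (hP0 t htP)
  by_cases hhP : h ∈ P
  · refine ⟨0, zero_mem _, fun x hx => ?_⟩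
    have h1 : Ideal.span {h} ⊔ P ≤ P := by
      rw [sup_le_iff, Ideal.span_singleton_le_iff_mem]
      exact ⟨hhP, le_rfl⟩
    exact Ideal.mem_sup_right ((Ideal.IsPrime.mem_or_mem ‹_› (h1 (hth x hx))).resolve_left htP)
  have hmem (x : A) (hx : x ∈ 𝔤) : ∃ c, t * x - c * h ∈ P := by
    obtain ⟨y, hy, p, hp, hyp⟩ := Submodule.mem_sup.mp (hth x hx)
    obtain ⟨c, rfl⟩ := Ideal.mem_span_singleton'.mp hy
    exact ⟨c, by rw [← hyp, add_sub_cancel_left]; exact hp⟩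
  choose! c hc using hmem
  have hdec (i : ℕ) : (decompose 𝒜 h i : A) ∈ 𝔤 := h𝔤 i hh
  -- comparing `t h` with the sum of the `t hᵢ` shows that some coefficient is a unit at the origin
  have hsum : t - ∑ i ∈ (decompose 𝒜 h).support, c (decompose 𝒜 h i) ∈ P := by
    refine (Ideal.IsPrime.mem_or_mem ‹P.IsPrime› (x := _) (y := h) ?_).resolve_right hhP
    have h1 : (t - ∑ i ∈ (decompose 𝒜 h).support, c (decompose 𝒜 h i)) * h =
        ∑ i ∈ (decompose 𝒜 h).support,
          (t * (decompose 𝒜 h i : A) - c (decompose 𝒜 h i) * h) := by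
      rw [Finset.sum_sub_distrib, ← Finset.mul_sum, ← Finset.sum_mul,
        DirectSum.sum_support_decompose, sub_mul]
    rw [h1]
    exact Ideal.sum_mem _ fun i _ => hc _ (hdec i)
  obtain ⟨i, hi⟩ : ∃ i, (decompose 𝒜 (c (decompose 𝒜 h i)) 0 : A) ≠ 0 := by
    by_contra! hcon
    refine ht ?_
    have h1 := hP0 _ hsum
    change GradedRing.proj 𝒜 0 _ = 0 at h1
    rw [map_sub, map_sum,
      Finset.sum_eq_zero (f := fun i => GradedRing.proj 𝒜 0 (c (decompose 𝒜 h i)))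
        fun i _ => hcon i, sub_zero] at h1
    exact h1
  obtain ⟨g, hg⟩ : ∃ g : A, g = (decompose 𝒜 h i : A) := ⟨_, rfl⟩
  rw [← hg] at hi
  have hg𝔤 : g ∈ 𝔤 := hg ▸ hdec i
  have hP' : (Ideal.span {g} ⊔ P).IsHomogeneous 𝒜 := by
    refine (Ideal.homogeneous_span 𝒜 _ ?_).sup hP
    rintro x rfl
    exact ⟨i, hg ▸ SetLike.coe_mem _⟩
  -- compare `t w ≡ c(w) h` with `t g ≡ c(g) h`, and take the component of the degree of `w`
  refine ⟨g, hg𝔤, fun z hz => ?_⟩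
  rw [← DirectSum.sum_support_decompose 𝒜 z]
  refine Ideal.sum_mem _ fun m _ => ?_
  have hz' : (decompose 𝒜 z m : A) ∈ 𝔤 := h𝔤 m hz
  generalize hw : (decompose 𝒜 z m : A) = w at *
  have hwm : w ∈ 𝒜 m := hw ▸ SetLike.coe_mem _
  have h1 : c g * w ∈ Ideal.span {g} ⊔ P := by
    have h2 : t * (c g * w - c w * g) ∈ P := by
      have : t * (c g * w - c w * g) = c g * (t * w - c w * h) - c w * (t * g - c g * h) := by ring
      rw [this]
      exact sub_mem (Ideal.mul_mem_left _ _ (hc w hz')) (Ideal.mul_mem_left _ _ (hc g hg𝔤))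
    have h3 := (Ideal.IsPrime.mem_or_mem ‹P.IsPrime› h2).resolve_left htP
    have : c g * w = c w * g + (c g * w - c w * g) := by ring
    rw [this]
    exact add_mem (Ideal.mem_sup_left (Ideal.mem_span_singleton'.mpr ⟨_, rfl⟩))
      (Ideal.mem_sup_right h3)
  have h2 := hP' (0 + m) h1
  rw [coe_decompose_mul_add_of_right_mem 𝒜 hwm] at h2
  exact (Ideal.unit_mul_mem_iff_mem _ (h0 _ (SetLike.coe_mem _) hi)).mp h2

end Graded

/-- For the quotient of a graded regular Cohen–Macaulay domain, with a field in degree zero, by a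
homogeneous prime, the canonical module has a divisor class, and its reflexive powers are locally
free exactly when the corresponding multiple of the class vanishes. -/
theorem isLocallyFree_reflexivePower_canonicalModule_iff {R : Type u} [CommRing R] [IsDomain R]
    [IsRegularRing R] (hR : IsGradeFull R) {σ : Type*} [SetLike σ R] [AddSubgroupClass σ R]
    {𝒜 : ℕ → σ} [GradedRing 𝒜] (h0 : ∀ a ∈ 𝒜 0, a ≠ 0 → IsUnit a) {P : Ideal R} [hPp : P.IsPrime]
    (hP : P.IsHomogeneous 𝒜) :
    (∃! c : DivisorClassGroup (R ⧸ P), HasDivisorClass (CanonicalModule P) c) ∧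
    ∀ (N : ℕ) (c : DivisorClassGroup (R ⧸ P)), HasDivisorClass (CanonicalModule P) c →
      (IsLocallyFree (R ⧸ P) (ReflexivePower (R ⧸ P) (CanonicalModule P) N) ↔ N • c = 0) := by
  have hpos : ∀ f ∈ P, f ∈ 𝒜 0 → f = 0 := fun f hf hf0 => by_contra fun hne =>
    hPp.ne_top (Ideal.eq_top_of_isUnit_mem _ hf (h0 f hf0 hne))
  obtain ⟨𝔟, h𝔟, hP𝔟, ⟨e⟩⟩ := exists_homogeneous_ideal_equiv_canonicalModule hR hP hpos
  have hmk : Function.Surjective (Ideal.Quotient.mk P) := Ideal.Quotient.mk_surjective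
  set B := 𝔟.map (Ideal.Quotient.mk P) with hB
  let ι := Algebra.linearMap (R ⧸ P) (FractionRing (R ⧸ P))
  have hι : Function.Injective ι := IsFractionRing.injective _ _
  obtain ⟨b, hb𝔟, hbP⟩ := SetLike.exists_of_lt hP𝔟
  let J : RegularFractionalIdeal (R ⧸ P) := ⟨(B : FractionalIdeal (R ⧸ P)⁰ (FractionRing (R ⧸ P))),
    ι (Ideal.Quotient.mk P b), ⟨_, Ideal.mem_map_of_mem _ hb𝔟, rfl⟩, by
      rw [isUnit_iff_ne_zero, map_ne_zero_iff ι hι, Ne, Ideal.Quotient.eq_zero_iff_mem]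
      exact hbP⟩
  have hJ : ((J : FractionalIdeal (R ⧸ P)⁰ (FractionRing (R ⧸ P))) :
      Submodule (R ⧸ P) (FractionRing (R ⧸ P))) = IsLocalization.coeSubmodule _ B :=
    FractionalIdeal.coe_coeIdeal B
  have eI (I : Ideal (R ⧸ P)) : I ≃ₗ[R ⧸ P] IsLocalization.coeSubmodule (FractionRing (R ⧸ P)) I :=
    Submodule.equivMapOfInjective ι hι I
  let e' : CanonicalModule P ≃ₗ[R ⧸ P] (J : FractionalIdeal (R ⧸ P)⁰ (FractionRing (R ⧸ P))) :=
    e.trans ((eI B).trans (LinearEquiv.ofEq _ _ hJ.symm))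
  have hc : HasDivisorClass (CanonicalModule P) (divisorClass J) := ⟨J, ⟨e'⟩, rfl⟩
  refine ⟨⟨_, hc, fun c' hc' => hc'.unique hc⟩, fun N c hc' => ?_⟩
  rw [hc'.unique hc, nsmul_divisorClass_eq_zero_iff]
  obtain ⟨eN⟩ := exists_reflexivePower_equiv e' N
  refine ⟨fun hfree => ?_, fun ⟨u, hu⟩ => isLocallyFree_span_singleton u
    (eN.trans (LinearEquiv.ofEq _ _ hu))⟩
  have h𝔟N : ¬ 𝔟 ^ N ≤ P := fun hle => hbP (Ideal.IsPrime.le_of_pow_le hle hb𝔟)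
  obtain ⟨d, a, had, haN, haP⟩ := exists_homogeneous_notMem (isHomogeneous_pow h𝔟 N) h𝔟N
  have hBN : B ^ N = (𝔟 ^ N).map (Ideal.Quotient.mk P) := by rw [Ideal.map_pow]
  have ha0 : Ideal.Quotient.mk P a ≠ 0 := by rwa [Ne, Ideal.Quotient.eq_zero_iff_mem]
  have hhull := divisorialHull_coeSubmodule (I := B ^ N) (hBN ▸ Ideal.mem_map_of_mem _ haN) ha0
  set 𝔥 : Ideal (R ⧸ P) := (Ideal.span {Ideal.Quotient.mk P a}).colon
    (((Ideal.span {Ideal.Quotient.mk P a}).colon ((B ^ N : Ideal (R ⧸ P)) : Set (R ⧸ P)) :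
      Ideal (R ⧸ P)) : Set (R ⧸ P)) with h𝔥
  have hcomap (I : Ideal R) : (I.map (Ideal.Quotient.mk P)).comap (Ideal.Quotient.mk P) = I ⊔ P := by
    rw [Ideal.comap_map_of_surjective _ hmk, ← RingHom.ker_eq_comap_bot, Ideal.mk_ker]
  have hspan : (Ideal.span {Ideal.Quotient.mk P a}).comap (Ideal.Quotient.mk P) =
      Ideal.span {a} ⊔ P := by
    rw [← hcomap, Ideal.map_span, Set.image_singleton]
  have h𝔤 : (𝔥.comap (Ideal.Quotient.mk P)).IsHomogeneous 𝒜 := by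
    have h1 : (Ideal.span {a} ⊔ P).IsHomogeneous 𝒜 := by
      refine (Ideal.homogeneous_span 𝒜 _ ?_).sup hP
      rintro x rfl
      exact ⟨d, had⟩
    rw [h𝔥, comap_colon hmk, comap_colon hmk, hspan, hBN, hcomap]
    exact isHomogeneous_colon h1 (isHomogeneous_colon h1 ((isHomogeneous_pow h𝔟 N).sup hP))
  have hJN : (((J : FractionalIdeal (R ⧸ P)⁰ (FractionRing (R ⧸ P))) :
      Submodule (R ⧸ P) (FractionRing (R ⧸ P))) ^ N) = IsLocalization.coeSubmodule _ (B ^ N) := by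
    rw [hJ, ← FractionalIdeal.coe_coeIdeal (S := (R ⧸ P)⁰), ← FractionalIdeal.coe_pow,
      ← FractionalIdeal.coeIdeal_pow, FractionalIdeal.coe_coeIdeal]
  rw [hJN, hhull] at eN ⊢
  -- the point of `Spec R/P` given by the irrelevant ideal
  let M₀ := RingHom.ker (GradedRing.projZeroRingHom 𝒜)
  have hM₀ : M₀.IsPrime := RingHom.ker_isPrime _
  have hM₀mem (x : R) : x ∈ M₀ ↔ (DirectSum.decompose 𝒜 x 0 : R) = 0 := Iff.rfl
  have hP0 : ∀ f ∈ P, (DirectSum.decompose 𝒜 f 0 : R) = 0 := fun f hf =>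
    hpos _ (hP 0 hf) (SetLike.coe_mem _)
  have hM₀' : (M₀.map (Ideal.Quotient.mk P)).IsPrime :=
    Ideal.map_isPrime_of_surjective hmk (by rw [Ideal.mk_ker]; exact hP0)
  obtain ⟨t, ht, h, hh, hth⟩ := hfree.exists_mul_mem_span ((isNoetherianRing_iff_ideal_fg _).mp
    inferInstance 𝔥) (eN.trans (eI 𝔥).symm) ⟨_, hM₀'⟩
  obtain ⟨t, rfl⟩ := hmk t
  obtain ⟨h, rfl⟩ := hmk h
  obtain ⟨g, hg, hle⟩ := exists_le_span_sup h0 hP h𝔤 hP0 (t := t) (h := h)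
    (fun h1 => ht (Ideal.mem_map_of_mem _ ((hM₀mem t).mpr h1))) hh fun x hx => by
      rw [← hcomap, Ideal.map_span, Set.image_singleton, Ideal.mem_comap, map_mul]
      exact hth _ hx
  have h𝔥g : 𝔥 = Ideal.span {Ideal.Quotient.mk P g} := by
    apply le_antisymm
    · intro x hx
      obtain ⟨x, rfl⟩ := hmk x
      have := hle hx
      rwa [← hcomap, Ideal.map_span, Set.image_singleton, Ideal.mem_comap] at this
    · rw [Ideal.span_singleton_le_iff_mem]
      exact hg
  have ha𝔥 : Ideal.Quotient.mk P a ∈ 𝔥 := by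
    rw [h𝔥, Submodule.mem_colon]
    exact fun i _ => Ideal.mul_mem_right _ _ (Ideal.mem_span_singleton_self _)
  have hg0 : Ideal.Quotient.mk P g ≠ 0 := by
    intro hg0
    rw [h𝔥g, hg0, Ideal.span_singleton_zero] at ha𝔥
    exact ha0 ((Submodule.mem_bot _).mp ha𝔥)
  refine ⟨Units.mk0 (ι (Ideal.Quotient.mk P g)) ((map_ne_zero_iff ι hι).mpr hg0), ?_⟩
  rw [h𝔥g, IsLocalization.coeSubmodule_span_singleton]
  rfl

/-! ### Laurent polynomials with bounded exponents -/

section Laurent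

open LaurentPolynomial

variable (O : Type*) [CommRing O]

/-- The Laurent polynomials all of whose exponents are at most `d`, that is `T ^ d O[T⁻¹]`. -/
def expLE (d : ℤ) : Submodule O O[T;T⁻¹] where
  carrier := {p | ∀ a, d < a → p.coeff a = 0}
  zero_mem' _ _ := rfl
  add_mem' hp hq a ha := by
    rw [AddMonoidAlgebra.coeff_add, Finsupp.add_apply, hp a ha, hq a ha, add_zero]
  smul_mem' r p hp a ha := by
    rw [AddMonoidAlgebra.coeff_smul, Finsupp.smul_apply, hp a ha, smul_zero]

/-- The Laurent polynomials all of whose exponents are at least `d`, that is `T ^ d O[T]`. -/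
def expGE (d : ℤ) : Submodule O O[T;T⁻¹] where
  carrier := {p | ∀ a, a < d → p.coeff a = 0}
  zero_mem' _ _ := rfl
  add_mem' hp hq a ha := by
    rw [AddMonoidAlgebra.coeff_add, Finsupp.add_apply, hp a ha, hq a ha, add_zero]
  smul_mem' r p hp a ha := by
    rw [AddMonoidAlgebra.coeff_smul, Finsupp.smul_apply, hp a ha, smul_zero]

variable {O}

theorem mem_expLE {d : ℤ} {p : O[T;T⁻¹]} : p ∈ expLE O d ↔ ∀ a, d < a → p.coeff a = 0 := Iff.rfl

theorem mem_expGE {d : ℤ} {p : O[T;T⁻¹]} : p ∈ expGE O d ↔ ∀ a, a < d → p.coeff a = 0 := Iff.rfl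

theorem invert_mem_expLE {d : ℤ} {p : O[T;T⁻¹]} : invert p ∈ expLE O (-d) ↔ p ∈ expGE O d := by
  rw [mem_expLE, mem_expGE]
  constructor
  · intro h a ha
    have := h (-a) (neg_lt_neg ha)
    rwa [invert_apply, neg_neg] at this
  · intro h a ha
    rw [invert_apply]
    exact h _ (by omega)

theorem expLE_mono {d d' : ℤ} (h : d ≤ d') : expLE O d ≤ expLE O d' :=
  fun _ hp a ha => hp a (h.trans_lt ha)

theorem expGE_anti {d d' : ℤ} (h : d ≤ d') : expGE O d' ≤ expGE O d :=
  fun _ hp a ha => hp a (ha.trans_le h)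

theorem single_mem_expLE {d n : ℤ} (h : n ≤ d) (r : O) :
    (AddMonoidAlgebra.single n r : O[T;T⁻¹]) ∈ expLE O d := by
  intro a ha
  rw [AddMonoidAlgebra.coeff_single, Finsupp.single_eq_of_ne (h.trans_lt ha).ne']

theorem mul_mem_expLE {d d' : ℤ} {p q : O[T;T⁻¹]} (hp : p ∈ expLE O d) (hq : q ∈ expLE O d') :
    p * q ∈ expLE O (d + d') := by
  rw [AddMonoidAlgebra.mul_def]
  refine Submodule.sum_mem _ fun a ha => Submodule.sum_mem _ fun b hb => ?_
  refine single_mem_expLE (add_le_add ?_ ?_) _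
  · by_contra! h
    exact Finsupp.mem_support_iff.mp ha (hp a h)
  · by_contra! h
    exact Finsupp.mem_support_iff.mp hb (hq b h)

theorem mul_mem_expGE {d d' : ℤ} {p q : O[T;T⁻¹]} (hp : p ∈ expGE O d) (hq : q ∈ expGE O d') :
    p * q ∈ expGE O (d + d') := by
  rw [← invert_mem_expLE] at *
  rw [map_mul, neg_add]
  exact mul_mem_expLE hp hq

theorem T_mem_expLE (n : ℤ) : (T n : O[T;T⁻¹]) ∈ expLE O n := single_mem_expLE le_rfl 1

theorem T_mem_expGE (n : ℤ) : (T n : O[T;T⁻¹]) ∈ expGE O n := by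
  rw [← invert_mem_expLE, invert_T]
  exact T_mem_expLE _

theorem C_mem_expLE (r : O) : (C r : O[T;T⁻¹]) ∈ expLE O 0 := single_mem_expLE le_rfl r

theorem C_mem_expGE (r : O) : (C r : O[T;T⁻¹]) ∈ expGE O 0 := by
  rw [← invert_mem_expLE, invert_C, neg_zero]
  exact C_mem_expLE r

theorem T_mul_mem_expLE {d n : ℤ} {p : O[T;T⁻¹]} : T n * p ∈ expLE O d ↔ p ∈ expLE O (d - n) := by
  constructor
  · intro h
    have := mul_mem_expLE (T_mem_expLE (O := O) (-n)) h
    rwa [← mul_assoc, ← T_add, neg_add_cancel, T_zero, one_mul, neg_add_eq_sub] at this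
  · intro h
    have := mul_mem_expLE (T_mem_expLE (O := O) n) h
    rwa [add_sub_cancel] at this

theorem T_mul_mem_expGE {d n : ℤ} {p : O[T;T⁻¹]} : T n * p ∈ expGE O d ↔ p ∈ expGE O (d - n) := by
  rw [← invert_mem_expLE, ← invert_mem_expLE, map_mul, invert_T, T_mul_mem_expLE]
  ring_nf

theorem mem_expGE_zero {p : O[T;T⁻¹]} : p ∈ expGE O 0 ↔ ∃ f : O[X], Polynomial.toLaurent f = p := by
  constructor
  · intro h
    obtain ⟨N, f, hf⟩ := exists_T_pow p
    have hX : Polynomial.X ^ N ∣ f := by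
      rw [Polynomial.X_pow_dvd_iff]
      intro d hd
      have h1 := h (d - N) (by omega)
      have h2 := congrArg (fun q : O[T;T⁻¹] => q.coeff d) hf
      have h3 : (p * T N).coeff d = p.coeff (d - N) := by
        have := AddMonoidAlgebra.coeff_mul_single_apply p (1 : O) (N : ℤ) (d : ℤ)
        rw [mul_one] at this
        exact this
      rw [h3, h1] at h2
      rw [coeff_toLaurent] at h2
      exact (Finsupp.mapDomain_apply Nat.castEmbedding.injective _ d).symm.trans h2
    obtain ⟨g, rfl⟩ := hX
    refine ⟨g, ?_⟩
    rw [map_mul, Polynomial.toLaurent_X_pow, T_mul] at hf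
    have := congrArg (· * T (-(N : ℤ))) hf
    simpa only [mul_T_assoc, add_neg_cancel, T_zero, mul_one] using this
  · rintro ⟨f, rfl⟩ a ha
    rw [coeff_toLaurent]
    exact Finsupp.mapDomain_of_notMem_range _ _ (by
      rintro ⟨b, rfl⟩
      exact absurd ha (not_lt.mpr (Int.natCast_nonneg b)))

theorem exists_expGE_add_expLE (p : O[T;T⁻¹]) (a : ℤ) :
    ∃ p₁ ∈ expGE O a, ∃ p₂ ∈ expLE O (a - 1), p = p₁ + p₂ := by
  classical
  refine ⟨.ofCoeff (p.coeff.filter fun n => a ≤ n), fun b hb => ?_,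
    .ofCoeff (p.coeff.filter fun n => ¬ a ≤ n), fun b hb => ?_, ?_⟩
  · exact Finsupp.filter_apply_neg _ _ (by omega)
  · exact Finsupp.filter_apply_neg _ _ (by omega)
  · apply AddMonoidAlgebra.coeff_injective
    exact (Finsupp.filter_add_filter_not _ _).symm

theorem eq_sum_of_mem {m : ℕ} {p : O[T;T⁻¹]} (hp : p ∈ expGE O 0 ⊓ expLE O m) :
    p = ∑ i ∈ Finset.range (m + 1), p.coeff i • T (i : ℤ) := by
  ext a
  rw [AddMonoidAlgebra.coeff_sum, Finsupp.finsetSum_apply]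
  simp only [AddMonoidAlgebra.coeff_smul, Finsupp.smul_apply, T_apply, smul_eq_mul, mul_ite, mul_one,
    mul_zero]
  by_cases h0 : a < 0
  · rw [hp.1 a h0, Finset.sum_eq_zero]
    intro i _
    rw [if_neg (by omega)]
  obtain ⟨b, rfl⟩ := Int.eq_ofNat_of_zero_le (not_lt.mp h0)
  by_cases hb : b ≤ m
  · rw [Finset.sum_eq_single_of_mem b (Finset.mem_range.mpr (by omega)), if_pos rfl]
    intro i _ hi
    rw [if_neg (by omega)]
  · rw [hp.2 _ (by omega), Finset.sum_eq_zero]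
    intro i hi
    rw [if_neg]
    have := Finset.mem_range.mp hi
    omega

theorem fg_expGE_inf_expLE (m : ℕ) : (expGE O 0 ⊓ expLE O m).FG := by
  classical
  refine ⟨(Finset.range (m + 1)).image fun i : ℕ => T (i : ℤ), le_antisymm ?_ fun p hp => ?_⟩
  · rw [Submodule.span_le]
    intro p hp
    obtain ⟨i, hi, rfl⟩ := Finset.mem_image.mp hp
    have := Finset.mem_range.mp hi
    exact ⟨expGE_anti (Int.natCast_nonneg i) (T_mem_expGE _), expLE_mono (by omega) (T_mem_expLE _)⟩
  · rw [eq_sum_of_mem hp]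
    exact Submodule.sum_mem _ fun i hi => Submodule.smul_mem _ _
      (Submodule.subset_span (Finset.mem_coe.mpr (Finset.mem_image_of_mem _ hi)))

section Map

variable {κ : Type*} [CommRing κ]

/-- The map on Laurent polynomials given by a ring homomorphism on the coefficients. -/
abbrev laurentMap (φ : O →+* κ) : O[T;T⁻¹] →+* κ[T;T⁻¹] := AddMonoidAlgebra.mapRingHom ℤ φ

theorem coeff_laurentMap (φ : O →+* κ) (p : O[T;T⁻¹]) (a : ℤ) :
    (laurentMap φ p).coeff a = φ (p.coeff a) := by
  simp [laurentMap]

theorem laurentMap_C (φ : O →+* κ) (r : O) : laurentMap φ (C r) = C (φ r) := by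
  ext a
  rw [coeff_laurentMap, C_apply, C_apply, apply_ite φ, map_zero]

theorem laurentMap_T (φ : O →+* κ) (n : ℤ) : laurentMap φ (T n) = T n := by
  ext a
  rw [coeff_laurentMap, T_apply, T_apply, apply_ite φ, map_zero, map_one]

theorem laurentMap_comp {κ' : Type*} [CommRing κ'] (φ : O →+* κ) (ψ : κ →+* κ') (p : O[T;T⁻¹]) :
    laurentMap ψ (laurentMap φ p) = laurentMap (ψ.comp φ) p := by
  ext a
  rw [coeff_laurentMap, coeff_laurentMap, coeff_laurentMap, RingHom.comp_apply]

theorem laurentMap_id (p : O[T;T⁻¹]) : laurentMap (RingHom.id O) p = p := by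
  ext a
  rw [coeff_laurentMap, RingHom.id_apply]

theorem laurentMap_mem_expLE (φ : O →+* κ) {p : O[T;T⁻¹]} {d : ℤ} (hp : p ∈ expLE O d) :
    laurentMap φ p ∈ expLE κ d := fun a ha => by rw [coeff_laurentMap, hp a ha, map_zero]

theorem laurentMap_mem_expGE (φ : O →+* κ) {p : O[T;T⁻¹]} {d : ℤ} (hp : p ∈ expGE O d) :
    laurentMap φ p ∈ expGE κ d := fun a ha => by rw [coeff_laurentMap, hp a ha, map_zero]

theorem laurentMap_toLaurent (φ : O →+* κ) (f : O[X]) :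
    laurentMap φ (Polynomial.toLaurent f) = Polynomial.toLaurent (f.map φ) := by
  induction f using Polynomial.induction_on' with
  | add p q hp hq => rw [map_add, map_add, hp, hq, Polynomial.map_add, map_add]
  | monomial n r =>
    rw [← Polynomial.C_mul_X_pow_eq_monomial, Polynomial.toLaurent_C_mul_X_pow, map_mul,
      laurentMap_C, laurentMap_T, Polynomial.map_mul, Polynomial.map_C, Polynomial.map_pow,
      Polynomial.map_X, Polynomial.toLaurent_C_mul_X_pow]

theorem laurentMap_invert (φ : O →+* κ) (p : O[T;T⁻¹]) :
    laurentMap φ (invert p) = invert (laurentMap φ p) := by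
  ext a
  rw [coeff_laurentMap, invert_apply, invert_apply, coeff_laurentMap]

theorem exists_eq_smul_of_laurentMap_eq_zero {φ : O →+* κ} {s : O} (hs : ∀ r, φ r = 0 → s ∣ r)
    {m : ℕ} {p : O[T;T⁻¹]} (hp : p ∈ expGE O 0 ⊓ expLE O m) (h : laurentMap φ p = 0) :
    ∃ q ∈ expGE O 0 ⊓ expLE O m, p = s • q := by
  have hdvd (i : ℕ) : s ∣ p.coeff i := hs _ (by rw [← coeff_laurentMap, h]; rfl)
  choose r hr using hdvd
  refine ⟨∑ i ∈ Finset.range (m + 1), r i • T (i : ℤ), Submodule.sum_mem _ fun i hi => ?_, ?_⟩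
  · have := Finset.mem_range.mp hi
    exact Submodule.smul_mem _ _
      ⟨expGE_anti (Int.natCast_nonneg i) (T_mem_expGE _), expLE_mono (by omega) (T_mem_expLE _)⟩
  · rw [Finset.smul_sum]
    conv_lhs => rw [eq_sum_of_mem hp]
    refine Finset.sum_congr rfl fun i _ => ?_
    rw [hr i, mul_smul]

end Map

section Field

variable {K : Type*} [Field K]

theorem polyToLaurentInv_apply (f : K[X]) :
    polyToLaurentInv K f = invert (Polynomial.toLaurent f) := rfl

theorem polyToLaurentInv_injective : Function.Injective (polyToLaurentInv K) := fun _ _ h =>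
  Polynomial.toLaurent_injective (invert.injective h)

theorem mem_expLE_zero {p : K[T;T⁻¹]} : p ∈ expLE K 0 ↔ ∃ f : K[X], polyToLaurentInv K f = p := by
  have : p ∈ expLE K 0 ↔ invert p ∈ expGE K 0 := by
    rw [← invert_mem_expLE, involutive_invert, neg_zero]
  rw [this, mem_expGE_zero]
  refine exists_congr fun f => ?_
  rw [polyToLaurentInv_apply]
  constructor
  · intro h; rw [h, involutive_invert]
  · intro h; rw [← h, involutive_invert]

end Field

end Laurent

/-! ### The splitting theorem for vector bundles on the projective line -/

section Splitting

open LaurentPolynomial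

variable {K : Type*} [Field K] {ι : Type*} [Fintype ι] [DecidableEq ι]

theorem map_inv_mul_map {R R' : Type*} [CommRing R] [CommRing R'] (φ : R →+* R') (S : GL ι R) :
    ((S⁻¹ : GL ι R) : Matrix ι ι R).map φ * (S : Matrix ι ι R).map φ = 1 := by
  rw [← Matrix.map_mul, Units.inv_mul, Matrix.map_one _ (map_zero φ) (map_one φ)]

theorem map_mul_map_inv {R R' : Type*} [CommRing R] [CommRing R'] (φ : R →+* R') (S : GL ι R) :
    (S : Matrix ι ι R).map φ * ((S⁻¹ : GL ι R) : Matrix ι ι R).map φ = 1 := by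
  rw [← Matrix.map_mul, Units.mul_inv, Matrix.map_one _ (map_zero φ) (map_one φ)]

theorem BundleIso.symm {A B : Matrix ι ι K[T;T⁻¹]} (h : BundleIso A B) : BundleIso B A := by
  obtain ⟨U, V, h⟩ := h
  refine ⟨U⁻¹, V⁻¹, ?_⟩
  calc _ = ((U⁻¹ : GL ι K[X]) : Matrix ι ι K[X]).map Polynomial.toLaurent *
        (B * (V : Matrix ι ι K[X]).map (polyToLaurentInv K)) *
          ((V⁻¹ : GL ι K[X]) : Matrix ι ι K[X]).map (polyToLaurentInv K) := by
        rw [← mul_assoc, mul_assoc _ (Matrix.map _ _) (Matrix.map _ _), map_mul_map_inv, mul_one]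
    _ = _ := by rw [← h, ← mul_assoc, map_inv_mul_map, one_mul]

theorem BundleIso.trans {A B C : Matrix ι ι K[T;T⁻¹]} (h : BundleIso A B) (h' : BundleIso B C) :
    BundleIso A C := by
  obtain ⟨U, V, h⟩ := h
  obtain ⟨U', V', h'⟩ := h'
  refine ⟨U' * U, V' * V, ?_⟩
  rw [Units.val_mul, Units.val_mul, Matrix.map_mul, Matrix.map_mul, mul_assoc, h, ← mul_assoc, h',
    mul_assoc]

theorem BundleIso.map {L : Type*} [Field L] (φ : K →+* L) {A B : Matrix ι ι K[T;T⁻¹]}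
    (h : BundleIso A B) : BundleIso (A.map (laurentMap φ)) (B.map (laurentMap φ)) := by
  obtain ⟨U, V, h⟩ := h
  refine ⟨Matrix.GeneralLinearGroup.map (Polynomial.mapRingHom φ) U,
    Matrix.GeneralLinearGroup.map (Polynomial.mapRingHom φ) V, ?_⟩
  have h1 (U : GL ι K[X]) : ((Matrix.GeneralLinearGroup.map (Polynomial.mapRingHom φ) U : GL ι L[X]) :
      Matrix ι ι L[X]).map Polynomial.toLaurent =
      ((U : Matrix ι ι K[X]).map Polynomial.toLaurent).map (laurentMap φ) := by
    refine Matrix.ext fun i j => ?_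
    exact (laurentMap_toLaurent φ _).symm
  have h2 (U : GL ι K[X]) : ((Matrix.GeneralLinearGroup.map (Polynomial.mapRingHom φ) U : GL ι L[X]) :
      Matrix ι ι L[X]).map (polyToLaurentInv L) =
      ((U : Matrix ι ι K[X]).map (polyToLaurentInv K)).map (laurentMap φ) := by
    refine Matrix.ext fun i j => ?_
    change polyToLaurentInv L (Polynomial.map φ _) = laurentMap φ (polyToLaurentInv K _)
    rw [polyToLaurentInv_apply, polyToLaurentInv_apply, laurentMap_invert, laurentMap_toLaurent]
  rw [h1, h2, ← Matrix.map_mul, h, Matrix.map_mul]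

theorem det_map_toLaurent (U : Matrix ι ι K[X]) :
    (U.map Polynomial.toLaurent).det = Polynomial.toLaurent U.det :=
  (RingHom.map_det (Polynomial.toLaurent : K[X] →+* K[T;T⁻¹]) U).symm

theorem det_map_polyToLaurentInv (U : Matrix ι ι K[X]) :
    (U.map (polyToLaurentInv K)).det = polyToLaurentInv K U.det :=
  (RingHom.map_det (polyToLaurentInv K) U).symm

theorem exists_det_eq_C (U : GL ι K[X]) : ∃ c : K, c ≠ 0 ∧ (U : Matrix ι ι K[X]).det =
    Polynomial.C c := by
  obtain ⟨c, hc, h⟩ := Polynomial.isUnit_iff.mp ((Matrix.isUnit_iff_isUnit_det _).mp U.isUnit)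
  exact ⟨c, hc.ne_zero, h.symm⟩

theorem prod_T (d : ι → ℤ) : ∏ i, (T (d i) : K[T;T⁻¹]) = T (∑ i, d i) := by
  classical
  induction (Finset.univ : Finset ι) using Finset.induction_on with
  | empty => rw [Finset.prod_empty, Finset.sum_empty, T_zero]
  | insert i s hi ih => rw [Finset.prod_insert hi, Finset.sum_insert hi, T_add, ih]

theorem polyToLaurentInv_C_mul_X_pow (c : K) (m : ℕ) :
    polyToLaurentInv K (Polynomial.C c * Polynomial.X ^ m) = C c * T (-(m : ℤ)) := by
  rw [polyToLaurentInv_apply, Polynomial.toLaurent_C_mul_X_pow, map_mul, invert_C, invert_T]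

theorem exists_mem_expLE (p : K[T;T⁻¹]) : ∃ d : ℕ, p ∈ expLE K d := by
  obtain ⟨N, f, hf⟩ := exists_T_pow (invert p)
  refine ⟨N, ?_⟩
  have h1 : T (N : ℤ) * invert p ∈ expGE K 0 := by
    rw [T_mul, ← hf]
    exact mem_expGE_zero.mpr ⟨f, rfl⟩
  rw [T_mul_mem_expGE, ← invert_mem_expLE, involutive_invert, zero_sub, neg_neg] at h1
  exact h1

/-- A basis `S` of sections on the first chart whose members, rescaled by powers of `T`, give
sections `V` on the second one. These form a basis there except possibly at infinity, where `det V`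
vanishes to the order `δ + ∑ fᵢ`; this order is the number of steps left in the proof of the
splitting theorem. -/
theorem exists_det_eq_of_frame {A : Matrix ι ι K[T;T⁻¹]} {δ : ℤ} (hA : A.det = T δ) {S : GL ι K[X]}
    {V : Matrix ι ι K[X]} {f : ι → ℤ} (h : (S : Matrix ι ι K[X]).map Polynomial.toLaurent =
      A * V.map (polyToLaurentInv K) * Matrix.diagonal fun i => T (f i)) :
    ∃ m : ℕ, δ + ∑ i, f i = m ∧ ∃ c : K, c ≠ 0 ∧ V.det = Polynomial.C c * Polynomial.X ^ m := by
  obtain ⟨c, hc, hSc⟩ := exists_det_eq_C S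
  have h1 := congrArg Matrix.det h
  rw [det_map_toLaurent, hSc, Matrix.det_mul, Matrix.det_mul, hA, det_map_polyToLaurentInv,
    Matrix.det_diagonal, prod_T, Polynomial.toLaurent_C, mul_right_comm, ← T_add] at h1
  have h2 : polyToLaurentInv K V.det = C c * T (-(δ + ∑ i, f i)) := by
    rw [h1, mul_comm, ← mul_assoc, ← T_add, neg_add_cancel, T_zero, one_mul]
  have h3 : -(δ + ∑ i, f i) ≤ 0 := by
    by_contra! hcon
    have h4 := (mem_expLE_zero.mpr ⟨V.det, h2⟩) _ hcon
    have h5 : (C c * T (-(δ + ∑ i, f i)) : K[T;T⁻¹]).coeff (-(δ + ∑ i, f i)) = c := by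
      rw [← single_eq_C_mul_T, AddMonoidAlgebra.coeff_single, Finsupp.single_eq_same]
    exact hc (h5.symm.trans h4)
  obtain ⟨m, hm⟩ := Int.eq_ofNat_of_zero_le (neg_nonpos.mp h3)
  refine ⟨m, hm, c, hc, polyToLaurentInv_injective ?_⟩
  rw [h2, hm, polyToLaurentInv_C_mul_X_pow]

/-- If the columns of `V` are linearly dependent at infinity, a column operation over `K[T]` makes
one of them divisible by the local parameter there: in a linear relation, the column with the
largest exponent `f j₀` is replaced by the whole combination, divided by that parameter. -/
theorem exists_frame_of_det_eval_eq_zero {A : Matrix ι ι K[T;T⁻¹]} {S : GL ι K[X]}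
    {V : Matrix ι ι K[X]} {f : ι → ℤ} (h : (S : Matrix ι ι K[X]).map Polynomial.toLaurent =
      A * V.map (polyToLaurentInv K) * Matrix.diagonal fun i => T (f i))
    (hV : V.det.eval 0 = 0) :
    ∃ (S' : GL ι K[X]) (V' : Matrix ι ι K[X]) (f' : ι → ℤ),
      (S' : Matrix ι ι K[X]).map Polynomial.toLaurent =
        A * V'.map (polyToLaurentInv K) * (Matrix.diagonal fun i => T (f' i)) ∧
      ∑ i, f' i = ∑ i, f i - 1 := by
  classical
  have hV0 : (V.map (Polynomial.evalRingHom (0 : K))).det = 0 := by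
    exact (RingHom.map_det (Polynomial.evalRingHom (0 : K)) V).symm.trans hV
  obtain ⟨c, hc0, hc⟩ := Matrix.exists_mulVec_eq_zero_iff.mpr hV0
  obtain ⟨j₁, hj₁⟩ := Function.ne_iff.mp hc0
  obtain ⟨j₀, hj₀, hmax⟩ := Finset.exists_max_image (Finset.univ.filter fun j => c j ≠ 0) f
    ⟨j₁, Finset.mem_filter.mpr ⟨Finset.mem_univ _, hj₁⟩⟩
  have hcj₀ : c j₀ ≠ 0 := (Finset.mem_filter.mp hj₀).2
  have hdvd (i : ι) : ∃ g, ∑ j, V i j * Polynomial.C (c j) = Polynomial.X * g := by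
    rw [← dvd_iff_exists_eq_mul_right, Polynomial.X_dvd_iff, Polynomial.coeff_zero_eq_eval_zero,
      Polynomial.eval_finsetSum]
    refine Eq.trans ?_ (congrFun hc i)
    simp [Matrix.mulVec, dotProduct]
  choose g hg using hdvd
  let w : ι → K[X] := fun j => Polynomial.C (c j) * Polynomial.X ^ (f j₀ - f j).toNat
  let E : Matrix ι ι K[X] := (1 : Matrix ι ι K[X]).updateCol j₀ w
  have hE : IsUnit E.det := by
    have h1 : E.det = Polynomial.C (c j₀) := by
      have h2 :=
        congrFun (congrFun (congrArg DFunLike.coe (Matrix.cramer_one (n := ι) (α := K[X]))) w) j₀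
      rw [Matrix.cramer_apply] at h2
      change E.det = w j₀ at h2
      rw [h2]
      simp [w]
    rw [h1, Polynomial.isUnit_C]
    exact hcj₀.isUnit
  refine ⟨S * Matrix.GeneralLinearGroup.mk'' E hE, V.updateCol j₀ g,
    Function.update f j₀ (f j₀ - 1), ?_, ?_⟩
  · have hEval : ((Matrix.GeneralLinearGroup.mk'' E hE : GL ι K[X]) : Matrix ι ι K[X]) = E := rfl
    rw [Units.val_mul, hEval, Matrix.map_mul, h, mul_assoc, mul_assoc, mul_assoc]
    congr 1
    refine Matrix.ext fun i l => ?_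
    rw [Matrix.mul_diagonal, Matrix.mul_apply, Matrix.map_apply]
    simp only [Matrix.diagonal_mul, Matrix.map_apply]
    by_cases hl : l = j₀
    · subst hl
      rw [Function.update_self, Matrix.updateCol_self, T_sub, mul_comm (T _), ← mul_assoc]
      have h1 : polyToLaurentInv K (g i) * T (-1) =
          ∑ j, polyToLaurentInv K (V i j) * C (c j) := by
        have h2 := congrArg (polyToLaurentInv K) (hg i)
        have hX : polyToLaurentInv K Polynomial.X = T (-1) := by
          rw [polyToLaurentInv_apply, Polynomial.toLaurent_X, invert_T]
        rw [map_mul, hX, map_sum, mul_comm] at h2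
        rw [← h2]
        refine Finset.sum_congr rfl fun j _ => ?_
        rw [map_mul, polyToLaurentInv_apply (Polynomial.C _), Polynomial.toLaurent_C, invert_C]
      rw [h1, Finset.sum_mul]
      refine Finset.sum_congr rfl fun j _ => ?_
      change _ * (_ * Polynomial.toLaurent ((1 : Matrix ι ι K[X]).updateCol l w j l)) = _
      rw [Matrix.updateCol_self, Polynomial.toLaurent_C_mul_X_pow]
      by_cases hj : c j = 0
      · rw [hj, map_zero, zero_mul, mul_zero, mul_zero, zero_mul]
      · have h3 : f j ≤ f l := hmax j (Finset.mem_filter.mpr ⟨Finset.mem_univ _, hj⟩)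
        rw [mul_left_comm (T _), ← T_add, Int.toNat_of_nonneg (by omega), add_sub_cancel, mul_assoc]
    · rw [Function.update_of_ne hl, Matrix.updateCol_ne hl, Finset.sum_eq_single l]
      · change _ * (_ * Polynomial.toLaurent ((1 : Matrix ι ι K[X]).updateCol j₀ w l l)) = _
        rw [Matrix.updateCol_ne hl, Matrix.one_apply_eq, map_one, mul_one]
      · intro j _ hj
        change _ * (_ * Polynomial.toLaurent ((1 : Matrix ι ι K[X]).updateCol j₀ w j l)) = _
        rw [Matrix.updateCol_ne hl, Matrix.one_apply_ne hj, map_zero, mul_zero, mul_zero]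
      · exact fun h => absurd (Finset.mem_univ l) h
  · rw [Finset.sum_update_of_mem (Finset.mem_univ _), ← Finset.add_sum_erase _ _ (Finset.mem_univ j₀),
      Finset.sdiff_singleton_eq_erase]
    ring

/-- **Grothendieck's splitting theorem**: a vector bundle on the projective line over a field is a
direct sum of line bundles. -/
theorem exists_bundleIso_diagonal (A : Matrix ι ι K[T;T⁻¹]) {δ : ℤ} (hA : A.det = T δ) :
    ∃ d : ι → ℤ, BundleIso A (Matrix.diagonal fun i => T (d i)) := by
  suffices H : ∀ (m : ℕ) (S : GL ι K[X]) (V : Matrix ι ι K[X]) (f : ι → ℤ),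
      (S : Matrix ι ι K[X]).map Polynomial.toLaurent =
        A * V.map (polyToLaurentInv K) * (Matrix.diagonal fun i => T (f i)) →
      δ + ∑ i, f i = m → ∃ d : ι → ℤ, BundleIso A (Matrix.diagonal fun i => T (d i)) by
    -- start from the standard basis on the first chart
    let B : Matrix ι ι K[T;T⁻¹] := (T (-δ) : K[T;T⁻¹]) • A.adjugate
    have hAB : A * B = 1 := by
      rw [Matrix.mul_smul, Matrix.mul_adjugate, hA, smul_smul, ← T_add, neg_add_cancel, T_zero,
        one_smul]
    choose F hF using fun i j => exists_mem_expLE (B i j)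
    let F' : ℤ := ∑ i, ∑ j, (F i j : ℤ)
    have hF' (i j : ι) : T (-F') * B i j ∈ expLE K 0 := by
      rw [T_mul_mem_expLE, zero_sub, neg_neg]
      refine expLE_mono ?_ (hF i j)
      refine le_trans ?_ (Finset.single_le_sum (f := fun i => ∑ j, (F i j : ℤ))
        (fun i _ => Finset.sum_nonneg fun j _ => Int.natCast_nonneg _) (Finset.mem_univ i))
      exact Finset.single_le_sum (f := fun j => (F i j : ℤ))
        (fun j _ => Int.natCast_nonneg _) (Finset.mem_univ j)
    choose V hV using fun i j => mem_expLE_zero.mp (hF' i j)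
    have hS : ((1 : GL ι K[X]) : Matrix ι ι K[X]).map Polynomial.toLaurent =
        A * (Matrix.of V).map (polyToLaurentInv K) * (Matrix.diagonal fun _ => T F') := by
      have h1 : (Matrix.of V).map (polyToLaurentInv K) * (Matrix.diagonal fun _ => T F') = B := by
        refine Matrix.ext fun i j => ?_
        rw [Matrix.mul_diagonal, Matrix.map_apply, Matrix.of_apply, hV, mul_comm, ← mul_assoc, ← T_add,
          add_neg_cancel, T_zero, one_mul]
      rw [mul_assoc, h1, hAB, Units.val_one,
        Matrix.map_one _ (map_zero Polynomial.toLaurent) (map_one Polynomial.toLaurent)]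
    obtain ⟨m, hm, -⟩ := exists_det_eq_of_frame hA hS
    exact H m 1 _ _ hS hm
  intro m
  induction m with
  | zero =>
    intro S V f h hm
    obtain ⟨m, hm', c, hc, hVc⟩ := exists_det_eq_of_frame hA h
    obtain rfl : m = 0 := by omega
    rw [pow_zero, mul_one] at hVc
    let W : GL ι K[X] := Matrix.GeneralLinearGroup.mk'' V (by
      rw [hVc, Polynomial.isUnit_C]; exact hc.isUnit)
    have hff : (Matrix.diagonal fun i => T (f i) : Matrix ι ι K[T;T⁻¹]) *
        (Matrix.diagonal fun i => T (-f i)) = 1 := by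
      rw [Matrix.diagonal_mul_diagonal, ← Matrix.diagonal_one]
      congr 1
      funext i
      rw [← T_add, add_neg_cancel, T_zero]
    have hA' : A = (S : Matrix ι ι K[X]).map Polynomial.toLaurent *
        (Matrix.diagonal fun i => T (-f i)) *
          ((W⁻¹ : GL ι K[X]) : Matrix ι ι K[X]).map (polyToLaurentInv K) := by
      have h1 := map_mul_map_inv (polyToLaurentInv K) W
      change V.map _ * _ = 1 at h1
      rw [h, mul_assoc _ (Matrix.diagonal _) (Matrix.diagonal _), hff, mul_one, mul_assoc, h1, mul_one]
    refine ⟨fun i => -f i, S⁻¹, W⁻¹, ?_⟩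
    conv_lhs => rw [hA']
    rw [← mul_assoc, ← mul_assoc, map_inv_mul_map, one_mul]
  | succ m ih =>
    intro S V f h hm
    obtain ⟨m', hm', c, hc, hVc⟩ := exists_det_eq_of_frame hA h
    obtain rfl : m' = m + 1 := by omega
    obtain ⟨S', V', f', h', hsum⟩ := exists_frame_of_det_eval_eq_zero h (by
      rw [hVc]; simp)
    exact ih S' V' f' h' (by push_cast at hm; omega)

theorem exists_perm_le_of_bundleIso {a b : ι → ℤ}
    (h : BundleIso (K := K) (Matrix.diagonal fun i => T (a i)) (Matrix.diagonal fun i => T (b i))) :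
    ∃ σ : Equiv.Perm ι, ∀ j, a j ≤ b (σ j) := by
  obtain ⟨U, V, h⟩ := h
  have hU : (U : Matrix ι ι K[X]).det ≠ 0 := by
    obtain ⟨c, hc, h⟩ := exists_det_eq_C U
    rw [h, Ne, Polynomial.C_eq_zero]
    exact hc
  rw [Matrix.det_apply] at hU
  obtain ⟨σ, -, hσ⟩ := Finset.exists_ne_zero_of_sum_ne_zero hU
  refine ⟨σ, fun j => ?_⟩
  have hσj : (U : Matrix ι ι K[X]) (σ j) j ≠ 0 := by
    intro h0
    have h1 : ∏ i, (U : Matrix ι ι K[X]) (σ i) i = 0 := Finset.prod_eq_zero (Finset.mem_univ j) h0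
    exact hσ ((congrArg _ h1).trans (smul_zero _))
  have h1 := congrFun (congrFun h (σ j)) j
  rw [Matrix.mul_diagonal, Matrix.diagonal_mul, Matrix.map_apply, Matrix.map_apply] at h1
  by_contra! hlt
  -- a nonzero entry would have exponents both `≥ 0` and `< 0`
  refine hσj (Polynomial.toLaurent_injective ?_)
  have h2 : T (a j) * Polynomial.toLaurent ((U : Matrix ι ι K[X]) (σ j) j) ∈ expLE K (b (σ j)) := by
    rw [mul_comm, h1, T_mul_mem_expLE, sub_self]
    exact mem_expLE_zero.mpr ⟨_, rfl⟩
  rw [T_mul_mem_expLE] at h2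
  have h3 := mem_expGE_zero.mpr ⟨(U : Matrix ι ι K[X]) (σ j) j, rfl⟩
  rw [map_zero]
  ext i
  by_cases hi : i < 0
  · exact h3 i hi
  · exact h2 i (by omega)

/-- The splitting type of a vector bundle on the projective line is unique up to order. -/
theorem exists_perm_of_bundleIso {a b : ι → ℤ}
    (h : BundleIso (K := K) (Matrix.diagonal fun i => T (a i)) (Matrix.diagonal fun i => T (b i))) :
    ∃ σ : Equiv.Perm ι, ∀ j, a j = b (σ j) := by
  obtain ⟨σ, hσ⟩ := exists_perm_le_of_bundleIso h
  obtain ⟨τ, hτ⟩ := exists_perm_le_of_bundleIso h.symm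
  refine ⟨σ, fun j => ?_⟩
  have h1 : ∑ i, b i ≤ ∑ i, a i := by
    rw [← Equiv.sum_comp τ a]
    exact Finset.sum_le_sum fun i _ => hτ i
  rw [← Equiv.sum_comp σ b] at h1
  exact (Finset.sum_eq_sum_iff_of_le fun i _ => hσ i).mp
    (le_antisymm (Finset.sum_le_sum fun i _ => hσ i) h1) j (Finset.mem_univ j)

theorem bundleIso_diagonal_of_perm {a b : ι → ℤ} (σ : Equiv.Perm ι) (h : ∀ j, a j = b (σ j)) :
    BundleIso (K := K) (Matrix.diagonal fun i => T (a i)) (Matrix.diagonal fun i => T (b i)) := by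
  let W : GL ι K[X] := Matrix.GeneralLinearGroup.mk'' (Equiv.Perm.permMatrix K[X] σ.symm) (by
    rw [Matrix.det_permutation]
    exact (Units.isUnit (Equiv.Perm.sign σ.symm)).map (Int.castRingHom K[X]))
  refine ⟨W, W, ?_⟩
  refine Matrix.ext fun i j => ?_
  rw [Matrix.mul_diagonal, Matrix.diagonal_mul, Matrix.map_apply, Matrix.map_apply]
  change Polynomial.toLaurent (Equiv.Perm.permMatrix K[X] σ.symm i j) * _ =
    _ * polyToLaurentInv K (Equiv.Perm.permMatrix K[X] σ.symm i j)
  rw [Equiv.Perm.permMatrix, PEquiv.toMatrix_apply]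
  simp only [Equiv.toPEquiv_apply, Option.mem_def, Option.some.injEq]
  split_ifs with hij
  · rw [map_one, map_one, one_mul, mul_one, h, ← hij, Equiv.apply_symm_apply]
  · rw [map_zero, map_zero, zero_mul, mul_zero]

/-- A vector bundle on the projective line which becomes isomorphic to `𝒪(e)` over an extension
field is isomorphic to `𝒪(e)`. -/
theorem BundleIso.of_map {L : Type*} [Field L] (φ : K →+* L) {A : Matrix ι ι K[T;T⁻¹]} {δ : ℤ}
    (hA : A.det = T δ) {e : ι → ℤ}
    (h : BundleIso (A.map (laurentMap φ)) (Matrix.diagonal fun i => T (e i))) :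
    BundleIso A (Matrix.diagonal fun i => T (e i)) := by
  obtain ⟨d, hd⟩ := exists_bundleIso_diagonal A hA
  have h1 := hd.map φ
  have h2 : (Matrix.diagonal fun i => (T (d i) : K[T;T⁻¹])).map (laurentMap φ) =
      Matrix.diagonal fun i => T (d i) := by
    rw [Matrix.diagonal_map (map_zero _)]
    congr 1
    funext i
    exact laurentMap_T φ _
  rw [h2] at h1
  obtain ⟨σ, hσ⟩ := exists_perm_of_bundleIso (h1.symm.trans h)
  exact hd.trans (bundleIso_diagonal_of_perm σ hσ)

end Splitting

/-! ### Frames of the extension bundles -/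

section Frames

open LaurentPolynomial

variable {O : Type*} [CommRing O] {n : ℕ} {M D : ℤ}

/-- The Čech cocycle with coordinates `v`, over an arbitrary base ring. -/
def cocycle (v : ExtIndex n M D → O) (i : Fin n) : O[T;T⁻¹] :=
  ∑ j : Fin (M + D - 1).toNat, C (v (i, j)) * T ((j : ℤ) + 1 - M)

/-- The transition matrix `extensionBundle` over an arbitrary base ring. -/
def extensionMatrix (v : ExtIndex n M D → O) : Matrix (Fin (n + 1)) (Fin (n + 1)) O[T;T⁻¹] :=
  Matrix.reindex finSumFinEquiv finSumFinEquiv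
    (Matrix.fromBlocks (Matrix.diagonal fun _ : Fin n => T (-M))
      (Matrix.of fun (i : Fin n) (_ : Fin 1) => cocycle v i) 0 (Matrix.diagonal fun _ : Fin 1 => T D))

theorem extensionBundle_eq {K : Type*} [Field K] (v : ExtIndex n M D → K) :
    extensionBundle v = extensionMatrix v := rfl

theorem det_extensionMatrix (v : ExtIndex n M D → O) :
    (extensionMatrix v).det = T (D - n * M) := by
  rw [extensionMatrix, Matrix.det_reindex_self, Matrix.det_fromBlocks_zero₂₁, Matrix.det_diagonal,
    Matrix.det_diagonal, Finset.prod_const, Finset.prod_const, T_pow, T_pow, ← T_add]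
  congr 1
  simp
  ring

theorem mul_extensionMatrix_castSucc (v : ExtIndex n M D → O)
    (Q : Matrix (Fin (n + 1)) (Fin (n + 1)) O[T;T⁻¹]) (i : Fin (n + 1)) (j : Fin n) :
    (Q * extensionMatrix v) i j.castSucc = T (-M) * Q i j.castSucc := by
  rw [Matrix.mul_apply, Finset.sum_eq_single j.castSucc]
  · have : extensionMatrix v j.castSucc j.castSucc = T (-M) := by
      simp [extensionMatrix, finSumFinEquiv_symm_apply_castSucc]
    rw [this, mul_comm]
  · intro l _ hl
    have : extensionMatrix v l j.castSucc = 0 := by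
      refine Fin.lastCases ?_ (fun l hl => ?_) l hl
      · intro
        simp [extensionMatrix, finSumFinEquiv_symm_apply_castSucc]
      · have hlj : l ≠ j := fun h => hl (by rw [h])
        simp [extensionMatrix, finSumFinEquiv_symm_apply_castSucc, hlj]
    rw [this, mul_zero]
  · exact fun h => absurd (Finset.mem_univ _) h

theorem mul_extensionMatrix_last (v : ExtIndex n M D → O)
    (Q : Matrix (Fin (n + 1)) (Fin (n + 1)) O[T;T⁻¹]) (i : Fin (n + 1)) :
    (Q * extensionMatrix v) i (Fin.last n) =
      ∑ j : Fin n, Q i j.castSucc * cocycle v j + Q i (Fin.last n) * T D := by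
  rw [Matrix.mul_apply, Fin.sum_univ_castSucc]
  congr 1
  · refine Finset.sum_congr rfl fun j _ => ?_
    simp [extensionMatrix, finSumFinEquiv_symm_apply_castSucc]
  · simp [extensionMatrix]

theorem coeff_C_mul_T (r : O) (a b : ℤ) : (C r * T a : O[T;T⁻¹]).coeff b = if a = b then r else 0 := by
  classical
  rw [← single_eq_C_mul_T, AddMonoidAlgebra.coeff_single, Finsupp.single_apply]

theorem coeff_cocycle (v : ExtIndex n M D → O) (i : Fin n) (j : Fin (M + D - 1).toNat) :
    (cocycle v i).coeff ((j : ℤ) + 1 - M) = v (i, j) := by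
  rw [cocycle, AddMonoidAlgebra.coeff_sum, Finsupp.finsetSum_apply, Finset.sum_eq_single j]
  · rw [coeff_C_mul_T, if_pos rfl]
  · intro l _ hl
    rw [coeff_C_mul_T, if_neg]
    intro h
    exact hl (Fin.ext (by omega))
  · exact fun h => absurd (Finset.mem_univ _) h

/-- Every cocycle is cohomologous to one of the chosen representatives. -/
theorem exists_eq_add_cocycle_add (p : Fin n → O[T;T⁻¹]) :
    ∃ (v : ExtIndex n M D → O) (p₁ p₂ : Fin n → O[T;T⁻¹]), (∀ j, p₁ j ∈ expGE O D) ∧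
      (∀ j, p₂ j ∈ expLE O (-M)) ∧ ∀ j, p j = p₁ j + cocycle v j + p₂ j := by
  choose p₁ hp₁ q hq hpq using fun j => exists_expGE_add_expLE (p j) D
  let v : ExtIndex n M D → O := fun ij => (q ij.1).coeff ((ij.2 : ℤ) + 1 - M)
  refine ⟨v, p₁, fun j => q j - cocycle v j, hp₁, fun j a ha => ?_, fun j => by rw [hpq j]; ring⟩
  rw [AddMonoidAlgebra.coeff_sub, Finsupp.sub_apply]
  by_cases haD : a < D
  · obtain ⟨b, hb⟩ := Int.eq_ofNat_of_zero_le (show 0 ≤ a + M - 1 by omega)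
    have h1 := coeff_cocycle v j ⟨b, by omega⟩
    have h2 : (b : ℤ) + 1 - M = a := by omega
    simp only [v, h2] at h1
    rw [h1, sub_self]
  · rw [hq j a (by omega), cocycle, AddMonoidAlgebra.coeff_sum, Finsupp.finsetSum_apply,
      Finset.sum_eq_zero, sub_zero]
    intro l _
    rw [coeff_C_mul_T, if_neg]
    omega

section Det

variable {ι : Type*} [DecidableEq ι]

theorem prod_mem_expLE (s : Finset ι) (p : ι → O[T;T⁻¹]) (d : ι → ℤ) (h : ∀ i, p i ∈ expLE O (d i)) :
    ∏ i ∈ s, p i ∈ expLE O (∑ i ∈ s, d i) := by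
  induction s using Finset.induction_on with
  | empty => rw [Finset.prod_empty, Finset.sum_empty, ← T_zero]; exact T_mem_expLE 0
  | insert i s hi ih =>
    rw [Finset.prod_insert hi, Finset.sum_insert hi]
    exact mul_mem_expLE (h i) ih

variable [Fintype ι]

theorem det_mem_expLE {A : Matrix ι ι O[T;T⁻¹]} (e a : ι → ℤ) (h : ∀ i j, A i j ∈ expLE O (e i + a j)) :
    A.det ∈ expLE O (∑ i, e i + ∑ j, a j) := by
  rw [Matrix.det_apply]
  refine Submodule.sum_mem _ fun σ _ => ?_
  rw [Units.smul_def]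
  refine zsmul_mem ?_ _
  have := prod_mem_expLE Finset.univ _ _ fun i => h (σ i) i
  rwa [Finset.sum_add_distrib, Equiv.sum_comp σ e] at this

theorem det_mem_expGE {A : Matrix ι ι O[T;T⁻¹]} (h : ∀ i j, A i j ∈ expGE O 0) :
    A.det ∈ expGE O 0 := by
  rw [← invert_mem_expLE]
  have h1 : invert A.det = (A.map invert).det := AlgHom.map_det (invert (R := O)).toAlgHom A
  have := det_mem_expLE (A := A.map invert) (fun _ => 0) (fun _ => 0) fun i j => by
    rw [add_zero, ← neg_zero]
    exact invert_mem_expLE.mpr (h i j)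
  rw [h1]
  simpa using this

theorem cramer_mulVec {R : Type*} [CommRing R] (A : Matrix ι ι R) (w : ι → R) :
    A.cramer (A.mulVec w) = A.det • w := by
  rw [Matrix.cramer_eq_adjugate_mulVec, Matrix.mulVec_mulVec, Matrix.adjugate_mul, Matrix.smul_mulVec,
    Matrix.one_mulVec]

end Det

/-- An isomorphism from the extension with coordinates `v` to `𝒪(e)`, given by its matrix `Q` on the
first chart, normalised to have determinant one. If `E` is the transition matrix of the extension,
the matrix on the second chart is `T ^ (-e) Q E`, which must not involve positive powers of `T`;
this is expressed by a bound on the exponents in the rows of `Q E`. -/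
structure IsFrame (e : Fin (n + 1) → ℤ) (v : ExtIndex n M D → O)
    (Q : Matrix (Fin (n + 1)) (Fin (n + 1)) O[T;T⁻¹]) : Prop where
  mem_expGE : ∀ i j, Q i j ∈ expGE O 0
  mem_expLE : ∀ i j, (Q * extensionMatrix v) i j ∈ expLE O (e i)
  det_eq : Q.det = 1

variable {e : Fin (n + 1) → ℤ}

theorem IsFrame.castSucc_mem {v : ExtIndex n M D → O}
    {Q : Matrix (Fin (n + 1)) (Fin (n + 1)) O[T;T⁻¹]} (h : IsFrame e v Q) (i : Fin (n + 1)) (j : Fin n) :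
    Q i j.castSucc ∈ expLE O (e i + M) := by
  have := h.mem_expLE i j.castSucc
  rwa [mul_extensionMatrix_castSucc, T_mul_mem_expLE, sub_neg_eq_add] at this

theorem extensionMatrix_map {κ : Type*} [CommRing κ] (φ : O →+* κ) (v : ExtIndex n M D → O) :
    (extensionMatrix v).map (laurentMap φ) = extensionMatrix (φ ∘ v) := by
  have h1 (i : Fin n) : laurentMap φ (cocycle v i) = cocycle (φ ∘ v) i := by
    rw [cocycle, cocycle, map_sum]
    refine Finset.sum_congr rfl fun j _ => ?_
    rw [map_mul, laurentMap_C, laurentMap_T]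
    rfl
  rw [extensionMatrix, extensionMatrix, Matrix.reindex_apply, Matrix.reindex_apply,
    ← Matrix.submatrix_map, Matrix.fromBlocks_map, Matrix.diagonal_map (map_zero _),
    Matrix.diagonal_map (map_zero _), Matrix.map_zero _ (map_zero _)]
  simp only [laurentMap_T]
  congr 2
  refine Matrix.ext fun i j => ?_
  exact h1 i

theorem IsFrame.map {κ : Type*} [CommRing κ] (φ : O →+* κ) {v : ExtIndex n M D → O}
    {Q : Matrix (Fin (n + 1)) (Fin (n + 1)) O[T;T⁻¹]} (h : IsFrame e v Q) :
    IsFrame e (φ ∘ v) (Q.map (laurentMap φ)) where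
  mem_expGE i j := laurentMap_mem_expGE φ (h.mem_expGE i j)
  mem_expLE i j := by
    rw [← extensionMatrix_map, ← Matrix.map_mul]
    exact laurentMap_mem_expLE φ (h.mem_expLE i j)
  det_eq := by
    rw [← map_one (laurentMap φ), ← h.det_eq]
    exact (RingHom.map_det (laurentMap φ) Q).symm

theorem mulVec_eq_sum (Q : Matrix (Fin (n + 1)) (Fin (n + 1)) O[T;T⁻¹]) (w : Fin (n + 1) → O[T;T⁻¹])
    (i : Fin (n + 1)) : Q.mulVec w i =
      ∑ j : Fin n, Q i j.castSucc * w j.castSucc + Q i (Fin.last n) * w (Fin.last n) := by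
  rw [Matrix.mulVec, dotProduct, Fin.sum_univ_castSucc]

/-- The last column of a frame can be replaced by one with bounded exponents such that the
determinant takes a prescribed value. Cramer's rule `Q.cramer x (Fin.last n)` stands for the
determinant of `Q` with last column `x`. Geometrically this is the surjectivity of
`H⁰(𝒪(e)(m - D)) → H⁰(𝒪(m))`, whose kernel sheaf `𝒪(m - D - M)ⁿ` has no first cohomology for
`m ≥ M + D`. -/
theorem IsFrame.exists_cramer_eq {v : ExtIndex n M D → O}
    {Q : Matrix (Fin (n + 1)) (Fin (n + 1)) O[T;T⁻¹]} (h : IsFrame e v Q) {m : ℕ} (hm : M + D ≤ m)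
    {g : O[T;T⁻¹]} (hg : g ∈ expGE O 0 ⊓ expLE O m) :
    ∃ x : Fin (n + 1) → O[T;T⁻¹], (∀ i, x i ∈ expGE O 0 ⊓ expLE O (m - D + e i)) ∧
      Q.cramer x (Fin.last n) = g := by
  choose c hc r hr hcr using fun j => exists_expGE_add_expLE (T (-D) * g * cocycle v j) 0
  have hx (i : Fin (n + 1)) : Q.mulVec (Fin.snoc c g) i =
      ∑ j : Fin n, Q i j.castSucc * c j + Q i (Fin.last n) * g := by
    rw [mulVec_eq_sum]
    simp only [Fin.snoc_castSucc, Fin.snoc_last]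
  refine ⟨Q.mulVec (Fin.snoc c g), fun i => ⟨?_, ?_⟩, ?_⟩
  · rw [hx]
    refine add_mem (sum_mem fun j _ => ?_) ?_
    · simpa using mul_mem_expGE (h.mem_expGE i j.castSucc) (hc j)
    · simpa using mul_mem_expGE (h.mem_expGE i (Fin.last n)) hg.1
  · have h1 : Q.mulVec (Fin.snoc c g) i = T (-D) * (g * (Q * extensionMatrix v) i (Fin.last n)) -
        ∑ j : Fin n, Q i j.castSucc * r j := by
      have h2 : T (-D) * T D = (1 : O[T;T⁻¹]) := by rw [← T_add, neg_add_cancel, T_zero]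
      have h3 : ∑ j : Fin n, Q i j.castSucc * c j = T (-D) * (g * ∑ j : Fin n, Q i j.castSucc *
          cocycle v j) - ∑ j : Fin n, Q i j.castSucc * r j := by
        rw [Finset.mul_sum, Finset.mul_sum, ← Finset.sum_sub_distrib]
        refine Finset.sum_congr rfl fun j _ => ?_
        linear_combination -Q i j.castSucc * hcr j
      rw [hx, mul_extensionMatrix_last, h3]
      linear_combination -(Q i (Fin.last n) * g) * h2
    rw [h1]
    refine sub_mem ?_ (sum_mem fun j _ => ?_)
    · rw [T_mul_mem_expLE]
      exact expLE_mono (by omega) (mul_mem_expLE hg.2 (h.mem_expLE i _))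
    · exact expLE_mono (by omega) (mul_mem_expLE (h.castSucc_mem i j) (hr j))
  · rw [cramer_mulVec, h.det_eq, one_smul, Fin.snoc_last]

/-- The extension is determined by the first columns of a frame, that is by the inclusion of
`𝒪(-M)ⁿ` in `𝒪(e)`, since distinct chosen representatives are not cohomologous. -/
theorem IsFrame.eq_of_castSucc_eq (hsum : ∑ i, e i = D - n * M) {v v' : ExtIndex n M D → O}
    {Q Q' : Matrix (Fin (n + 1)) (Fin (n + 1)) O[T;T⁻¹]} (h : IsFrame e v Q) (h' : IsFrame e v' Q')
    (hQ : ∀ i (j : Fin n), Q i j.castSucc = Q' i j.castSucc) : v = v' := by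
  let x : Fin (n + 1) → O[T;T⁻¹] := fun i => Q i (Fin.last n)
  let x' : Fin (n + 1) → O[T;T⁻¹] := fun i => Q' i (Fin.last n)
  have hQx : Q.updateCol (Fin.last n) x = Q := Matrix.updateCol_eq_self Q (Fin.last n)
  have hQx' : Q.updateCol (Fin.last n) x' = Q' := by
    refine Matrix.ext fun i j => ?_
    refine Fin.lastCases ?_ (fun j => ?_) j
    · rw [Matrix.updateCol_self]
    · rw [Matrix.updateCol_ne (Fin.castSucc_ne_last j), hQ]
  let u := Q.cramer (x' - x)
  have hu (j : Fin (n + 1)) : u j ∈ expGE O 0 := by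
    change Q.cramer (x' - x) j ∈ _
    rw [Matrix.cramer_apply]
    refine det_mem_expGE fun i l => ?_
    by_cases hl : l = j
    · rw [hl, Matrix.updateCol_self]
      exact sub_mem (h'.mem_expGE _ _) (h.mem_expGE _ _)
    · rw [Matrix.updateCol_ne hl]
      exact h.mem_expGE _ _
  have hul : u (Fin.last n) = 0 := by
    change Q.cramer (x' - x) (Fin.last n) = 0
    rw [map_sub, Pi.sub_apply, Matrix.cramer_apply, Matrix.cramer_apply, hQx, hQx', h.det_eq, h'.det_eq,
      sub_self]
  have hQu (i : Fin (n + 1)) : ∑ j : Fin n, Q i j.castSucc * u j.castSucc = x' i - x i := by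
    have h1 := congrFun (Matrix.mulVec_cramer Q (x' - x)) i
    rw [h.det_eq, one_smul] at h1
    change Q.mulVec u i = _ at h1
    rw [mulVec_eq_sum, hul, mul_zero, add_zero] at h1
    exact h1
  let ω : Fin n → O[T;T⁻¹] := fun j => cocycle v' j - cocycle v j + T D * u j.castSucc
  have hQω (i : Fin (n + 1)) : ∑ j : Fin n, Q i j.castSucc * ω j ∈ expLE O (e i) := by
    have h1 := sub_mem (h'.mem_expLE i (Fin.last n)) (h.mem_expLE i (Fin.last n))
    rw [mul_extensionMatrix_last, mul_extensionMatrix_last] at h1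
    convert h1 using 1
    have h2 : ∑ j : Fin n, Q i j.castSucc * ω j = ∑ j : Fin n, Q' i j.castSucc * cocycle v' j -
        ∑ j : Fin n, Q i j.castSucc * cocycle v j +
        T D * ∑ j : Fin n, Q i j.castSucc * u j.castSucc := by
      rw [Finset.mul_sum, ← Finset.sum_sub_distrib, ← Finset.sum_add_distrib]
      refine Finset.sum_congr rfl fun j _ => ?_
      rw [← hQ]
      ring
    rw [h2, hQu]
    ring
  -- on the second chart the frame is unimodular over `O[T⁻¹]`
  let V : Matrix (Fin (n + 1)) (Fin (n + 1)) O[T;T⁻¹] :=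
    (Matrix.diagonal fun i => T (-e i)) * (Q * extensionMatrix v)
  have hVij (i j : Fin (n + 1)) : V i j = T (-e i) * (Q * extensionMatrix v) i j :=
    Matrix.diagonal_mul _ _ _ _
  have hV (i j : Fin (n + 1)) : V i j ∈ expLE O 0 := by
    rw [hVij, T_mul_mem_expLE]
    simpa using h.mem_expLE i j
  have hVdet : V.det = 1 := by
    have h1 : ∏ i, (T (-e i) : O[T;T⁻¹]) = T (∑ i, -e i) := by
      induction (Finset.univ : Finset (Fin (n + 1))) using Finset.induction_on with
      | empty => rw [Finset.prod_empty, Finset.sum_empty, T_zero]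
      | insert i s hi ih => rw [Finset.prod_insert hi, Finset.sum_insert hi, T_add, ih]
    rw [Matrix.det_mul, Matrix.det_mul, Matrix.det_diagonal, h.det_eq, det_extensionMatrix, one_mul, h1,
      ← T_add, Finset.sum_neg_distrib, hsum, neg_add_cancel, T_zero]
  let w : Fin (n + 1) → O[T;T⁻¹] := Fin.snoc (fun j => T M * ω j) 0
  have hVw (i : Fin (n + 1)) : V.mulVec w i ∈ expLE O 0 := by
    have h1 : V.mulVec w i = T (-e i) * ∑ j : Fin n, Q i j.castSucc * ω j := by
      rw [mulVec_eq_sum, Finset.mul_sum]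
      simp only [w, Fin.snoc_castSucc, Fin.snoc_last, mul_zero, add_zero]
      refine Finset.sum_congr rfl fun j _ => ?_
      rw [hVij, mul_extensionMatrix_castSucc]
      have h2 : T (-M) * T M = (1 : O[T;T⁻¹]) := by rw [← T_add, neg_add_cancel, T_zero]
      linear_combination (T (-e i) * Q i j.castSucc * ω j) * h2
    rw [h1, T_mul_mem_expLE]
    simpa using hQω i
  have hω (j : Fin n) : ω j ∈ expLE O (-M) := by
    have h1 : w j.castSucc ∈ expLE O 0 := by
      have h2 := congrFun (cramer_mulVec V w) j.castSucc
      rw [hVdet, one_smul, Matrix.cramer_apply] at h2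
      rw [← h2]
      have h3 := det_mem_expLE (A := V.updateCol j.castSucc (V.mulVec w)) (fun _ => 0) (fun _ => 0)
        fun i l => by
          rw [add_zero]
          by_cases hl : l = j.castSucc
          · rw [hl, Matrix.updateCol_self]
            exact hVw i
          · rw [Matrix.updateCol_ne hl]
            exact hV i l
      simpa using h3
    simp only [w, Fin.snoc_castSucc] at h1
    rwa [T_mul_mem_expLE, zero_sub] at h1
  funext ⟨i, j⟩
  have h1 := hω i ((j : ℤ) + 1 - M) (by omega)
  have h2 : (T D * u i.castSucc).coeff ((j : ℤ) + 1 - M) = 0 := by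
    have h3 : T D * u i.castSucc ∈ expGE O D := by
      rw [T_mul_mem_expGE, sub_self]
      exact hu _
    exact h3 _ (by omega)
  simp only [ω, AddMonoidAlgebra.coeff_add, AddMonoidAlgebra.coeff_sub, Finsupp.add_apply,
    Finsupp.sub_apply, coeff_cocycle, h2, add_zero] at h1
  exact (sub_eq_zero.mp h1).symm

section Field

variable {K : Type*} [Field K]

theorem bundleIso_of_frame (hsum : ∑ i, e i = D - n * M) {v : ExtIndex n M D → K}
    {Q : Matrix (Fin (n + 1)) (Fin (n + 1)) K[T;T⁻¹]} (h₀ : ∀ i j, Q i j ∈ expGE K 0)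
    (h₁ : ∀ i j, (Q * extensionMatrix v) i j ∈ expLE K (e i)) {c : K} (hc : c ≠ 0)
    (hQ : Q.det = C c) :
    BundleIso (extensionBundle v) (splitBundle K e) := by
  choose U hU using fun i j => mem_expGE_zero.mp (h₀ i j)
  have hV' (i j : Fin (n + 1)) : T (-e i) * (Q * extensionMatrix v) i j ∈ expLE K 0 := by
    rw [T_mul_mem_expLE]
    simpa using h₁ i j
  choose V hV using fun i j => mem_expLE_zero.mp (hV' i j)
  have hUQ : (Matrix.of U).map Polynomial.toLaurent = Q := Matrix.ext hU
  have hEV : Q * extensionMatrix v = (Matrix.diagonal fun i => T (e i)) *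
      (Matrix.of V).map (polyToLaurentInv K) := by
    refine Matrix.ext fun i j => ?_
    rw [Matrix.diagonal_mul, Matrix.map_apply, Matrix.of_apply, hV, ← mul_assoc, ← T_add, add_neg_cancel,
      T_zero, one_mul]
  have hUdet : (Matrix.of U).det = Polynomial.C c := Polynomial.toLaurent_injective (by
    rw [← det_map_toLaurent, hUQ, hQ, Polynomial.toLaurent_C])
  have hVdet : (Matrix.of V).det = Polynomial.C c := polyToLaurentInv_injective (by
    have h2 := congrArg Matrix.det hEV
    rw [Matrix.det_mul, Matrix.det_mul, Matrix.det_diagonal, prod_T, hQ, det_extensionMatrix, hsum,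
      det_map_polyToLaurentInv, mul_comm] at h2
    rw [polyToLaurentInv_apply (Polynomial.C c), Polynomial.toLaurent_C, invert_C]
    exact ((isUnit_T _).mul_left_cancel h2).symm)
  have hcu : IsUnit (Polynomial.C c) := Polynomial.isUnit_C.mpr hc.isUnit
  refine ⟨Matrix.GeneralLinearGroup.mk'' (Matrix.of U) (hUdet ▸ hcu),
    Matrix.GeneralLinearGroup.mk'' (Matrix.of V) (hVdet ▸ hcu), ?_⟩
  change (Matrix.of U).map Polynomial.toLaurent * extensionMatrix v = _
  rw [hUQ, hEV]
  rfl

theorem bundleIso_iff_exists_isFrame (hsum : ∑ i, e i = D - n * M) {v : ExtIndex n M D → K} :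
    BundleIso (extensionBundle v) (splitBundle K e) ↔ ∃ Q, IsFrame e v Q := by
  constructor
  · rintro ⟨U, V, h⟩
    obtain ⟨c, hc, hUc⟩ := exists_det_eq_C U
    let d : Fin (n + 1) → K := Fin.cons c⁻¹ fun _ => 1
    refine ⟨(Matrix.diagonal fun i => C (d i)) * (U : Matrix _ _ K[X]).map Polynomial.toLaurent,
      ⟨fun i j => ?_, fun i j => ?_, ?_⟩⟩
    · rw [Matrix.diagonal_mul]
      have h1 := mul_mem_expGE (C_mem_expGE (d i))
        (mem_expGE_zero.mpr ⟨(U : Matrix _ _ K[X]) i j, rfl⟩)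
      rwa [add_zero] at h1
    · rw [mul_assoc, ← extensionBundle_eq, h, Matrix.diagonal_mul, splitBundle, Matrix.diagonal_mul]
      have h1 := mul_mem_expLE (C_mem_expLE (d i)) (mul_mem_expLE (T_mem_expLE (O := K) (e i))
        (mem_expLE_zero.mpr ⟨(V : Matrix _ _ K[X]) i j, rfl⟩))
      rwa [zero_add, add_zero] at h1
    · rw [Matrix.det_mul, Matrix.det_diagonal, det_map_toLaurent, hUc, Polynomial.toLaurent_C,
        ← map_prod, ← map_mul, Fin.prod_univ_succ]
      simp [d, hc]
  · rintro ⟨Q, hQ⟩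
    exact bundleIso_of_frame hsum hQ.mem_expGE hQ.mem_expLE one_ne_zero (by rw [hQ.det_eq, map_one])

/-- The splitting type of an extension is invariant under scaling. -/
theorem bundleIso_smul (hsum : ∑ i, e i = D - n * M) {v : ExtIndex n M D → K} {c : K} (hc : c ≠ 0)
    (h : BundleIso (extensionBundle v) (splitBundle K e)) :
    BundleIso (extensionBundle (c • v)) (splitBundle K e) := by
  obtain ⟨Q, hQ⟩ := (bundleIso_iff_exists_isFrame hsum).mp h
  let d : Fin (n + 1) → K := Fin.snoc (fun _ => c⁻¹) 1
  have hd (i j : Fin (n + 1)) : (Q * Matrix.diagonal fun j => C (d j)) i j = C (d j) * Q i j := by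
    rw [Matrix.mul_diagonal, mul_comm]
  have hcoc (j : Fin n) : cocycle (c • v) j = C c * cocycle v j := by
    rw [cocycle, cocycle, Finset.mul_sum]
    refine Finset.sum_congr rfl fun l _ => ?_
    rw [Pi.smul_apply, smul_eq_mul, map_mul, mul_assoc]
  have hcc : C c⁻¹ * C c = (1 : K[T;T⁻¹]) := by rw [← map_mul, inv_mul_cancel₀ hc, map_one]
  refine bundleIso_of_frame hsum (Q := Q * Matrix.diagonal fun j => C (d j)) (fun i j => ?_)
    (fun i j => ?_) (c := ∏ j, d j) ?_ ?_
  · rw [hd]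
    have h1 := mul_mem_expGE (C_mem_expGE (d j)) (hQ.mem_expGE i j)
    rwa [add_zero] at h1
  · refine Fin.lastCases ?_ (fun j => ?_) j
    · have h1 := hQ.mem_expLE i (Fin.last n)
      rw [mul_extensionMatrix_last] at h1 ⊢
      convert h1 using 1
      congr 1
      · refine Finset.sum_congr rfl fun j _ => ?_
        rw [hd, hcoc]
        simp only [d, Fin.snoc_castSucc]
        linear_combination (Q i j.castSucc * cocycle v j) * hcc
      · rw [hd]
        simp only [d, Fin.snoc_last, map_one, one_mul]
    · have h1 := mul_mem_expLE (C_mem_expLE (d j.castSucc)) (hQ.mem_expLE i j.castSucc)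
      rw [mul_extensionMatrix_castSucc, zero_add] at h1
      rwa [mul_extensionMatrix_castSucc, hd, mul_left_comm]
  · refine Finset.prod_ne_zero_iff.mpr fun j _ => ?_
    refine Fin.lastCases ?_ (fun j => ?_) j
    · simp [d]
    · simp [d, hc]
  · rw [Matrix.det_mul, hQ.det_eq, one_mul, Matrix.det_diagonal, map_prod]

end Field

end Frames

/-! ### Connecting two points of the splitting locus -/

section Path

open LaurentPolynomial

variable {n : ℕ} {M D : ℤ} {e : Fin (n + 1) → ℤ}

theorem map_cramer {R R' ι : Type*} [CommRing R] [CommRing R'] [Fintype ι] [DecidableEq ι]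
    (φ : R →+* R') (A : Matrix ι ι R) (x : ι → R) (i : ι) :
    φ (A.cramer x i) = (A.map φ).cramer (φ ∘ x) i := by
  rw [Matrix.cramer_apply, Matrix.cramer_apply, ← Matrix.map_updateCol]
  exact RingHom.map_det φ _

theorem cramer_updateCol {R ι : Type*} [CommRing R] [Fintype ι] [DecidableEq ι]
    (A : Matrix ι ι R) (x y : ι → R) (i : ι) : (A.updateCol i x).cramer y i = A.cramer y i := by
  rw [Matrix.cramer_apply, Matrix.cramer_apply, Matrix.updateCol_idem]

/-- Two frames over `κ` can be joined by a frame over a semilocal ring `O` with two residue maps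
`φ₀`, `φ₁` to `κ`. The first columns are interpolated linearly. By Nakayama's lemma the last column
can be chosen on both charts, because this is possible at both points; the two choices `x` and `y`
differ by a combination of the first columns, whose coefficients give the cocycle of the required
extension. -/
theorem exists_isFrame_interpolating (hsum : ∑ i, e i = D - n * M) {κ O : Type*} [CommRing κ]
    [CommRing O] (ι : κ →+* O) (φ₀ φ₁ : O →+* κ)
    (h₀ : φ₀.comp ι = RingHom.id κ) (h₁ : φ₁.comp ι = RingHom.id κ) (s : O)
    (hs₀ : φ₀ s = 0) (hs₁ : φ₁ s = 1) (hd₀ : ∀ r, φ₀ r = 0 → s ∣ r)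
    (hd₁ : ∀ r, φ₁ r = 0 → (1 - s) ∣ r)
    (hj : s * (1 - s) ∈ (⊥ : Ideal O).jacobson) {v₀ v₁ : ExtIndex n M D → κ}
    {Q₀ Q₁ : Matrix (Fin (n + 1)) (Fin (n + 1)) κ[T;T⁻¹]} (hQ₀ : IsFrame e v₀ Q₀)
    (hQ₁ : IsFrame e v₁ Q₁) :
    ∃ (v : ExtIndex n M D → O) (Q : Matrix (Fin (n + 1)) (Fin (n + 1)) O[T;T⁻¹]),
      IsFrame e v Q ∧ φ₀ ∘ v = v₀ ∧ φ₁ ∘ v = v₁ := by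
  obtain ⟨m, hm⟩ : ∃ m : ℕ, M + D ≤ m := ⟨(M + D).toNat, Int.self_le_toNat _⟩
  -- the interpolating matrix
  let Q : Matrix (Fin (n + 1)) (Fin (n + 1)) O[T;T⁻¹] :=
    (1 - s) • Q₀.map (laurentMap ι) + s • Q₁.map (laurentMap ι)
  have hQij (i j) : Q i j = (1 - s) • laurentMap ι (Q₀ i j) + s • laurentMap ι (Q₁ i j) := rfl
  have hι {φ : O →+* κ} (h : φ.comp ι = RingHom.id κ) (p : κ[T;T⁻¹]) :
      laurentMap φ (laurentMap ι p) = p := by rw [laurentMap_comp, h, laurentMap_id]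
  have hφ₀ : Q.map (laurentMap φ₀) = Q₀ := by
    refine Matrix.ext fun i j => ?_
    rw [Matrix.map_apply, hQij, map_add, smul_eq_C_mul, smul_eq_C_mul, map_mul, map_mul, laurentMap_C,
      laurentMap_C, hι h₀, map_sub, map_one, hs₀, sub_zero, map_zero, map_one, one_mul, zero_mul,
      add_zero]
  have hφ₁ : Q.map (laurentMap φ₁) = Q₁ := by
    refine Matrix.ext fun i j => ?_
    rw [Matrix.map_apply, hQij, map_add, smul_eq_C_mul, smul_eq_C_mul, map_mul, map_mul, laurentMap_C,
      laurentMap_C, hι h₁, map_sub, map_one, hs₁, sub_self, map_zero, map_one, one_mul, zero_mul,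
      zero_add, hι h₁]
  have hQE (i j) : Q i j ∈ expGE O 0 := add_mem
    (Submodule.smul_mem _ _ (laurentMap_mem_expGE ι (hQ₀.mem_expGE i j)))
    (Submodule.smul_mem _ _ (laurentMap_mem_expGE ι (hQ₁.mem_expGE i j)))
  have hQL (i) (j : Fin n) : Q i j.castSucc ∈ expLE O (e i + M) := add_mem
    (Submodule.smul_mem _ _ (laurentMap_mem_expLE ι (hQ₀.castSucc_mem i j)))
    (Submodule.smul_mem _ _ (laurentMap_mem_expLE ι (hQ₁.castSucc_mem i j)))
  -- the determinant as a function of the last column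
  let G : (Fin (n + 1) → O[T;T⁻¹]) →ₗ[O] O[T;T⁻¹] :=
    ((LinearMap.proj (Fin.last n)).comp Q.cramer).restrictScalars O
  have hG (x) : G x = Q.cramer x (Fin.last n) := rfl
  let X : Submodule O (Fin (n + 1) → O[T;T⁻¹]) :=
    Submodule.pi Set.univ fun i => expGE O 0 ⊓ expLE O (m - D + e i)
  have hX (x) : x ∈ X ↔ ∀ i, x i ∈ expGE O 0 ⊓ expLE O (m - D + e i) := by
    simp only [X, Submodule.mem_pi, Set.mem_univ, true_implies]
  have hGX (x) (hx : x ∈ X) : G x ∈ expGE O 0 ⊓ expLE O m := by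
    rw [hX] at hx
    rw [hG, Matrix.cramer_apply]
    constructor
    · refine det_mem_expGE fun i j => ?_
      by_cases hj : j = Fin.last n
      · rw [hj, Matrix.updateCol_self]
        exact (hx i).1
      · rw [Matrix.updateCol_ne hj]
        exact hQE i j
    · have h1 := det_mem_expLE (A := Q.updateCol (Fin.last n) x) e
        (Fin.snoc (α := fun _ => ℤ) (fun _ => M) (m - D)) fun i j => by
          refine Fin.lastCases ?_ (fun j => ?_) j
          · rw [Matrix.updateCol_self, Fin.snoc_last, add_comm]
            exact (hx i).2
          · rw [Matrix.updateCol_ne (Fin.castSucc_ne_last j), Fin.snoc_castSucc]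
            exact hQL i j
      refine expLE_mono (le_of_eq ?_) h1
      rw [hsum, Fin.sum_univ_castSucc]
      simp only [Fin.snoc_castSucc, Fin.snoc_last, Finset.sum_const, Finset.card_univ, Fintype.card_fin,
        nsmul_eq_mul]
      ring
  -- every target value is attained modulo the kernel of a residue map
  have key {φ : O →+* κ} (h : φ.comp ι = RingHom.id κ) {Q'} {v' : ExtIndex n M D → κ}
      (hQ' : IsFrame e v' Q')
      (hφ : Q.map (laurentMap φ) = Q') {t : O} (hd : ∀ r, φ r = 0 → t ∣ r) {z}
      (hz : z ∈ expGE O 0 ⊓ expLE O m) :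
      ∃ x ∈ X, ∃ q ∈ expGE O 0 ⊓ expLE O m, z = G x + t • q := by
    obtain ⟨x, hx, hxz⟩ := hQ'.exists_cramer_eq hm (g := laurentMap φ z)
      ⟨laurentMap_mem_expGE φ hz.1, laurentMap_mem_expLE φ hz.2⟩
    have hxX : laurentMap ι ∘ x ∈ X := by
      rw [hX]
      exact fun i => ⟨laurentMap_mem_expGE ι (hx i).1, laurentMap_mem_expLE ι (hx i).2⟩
    obtain ⟨q, hq, hzq⟩ := exists_eq_smul_of_laurentMap_eq_zero hd (sub_mem hz (hGX _ hxX)) (by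
      rw [map_sub, hG, map_cramer, hφ, sub_eq_zero, ← hxz]
      exact congrArg (fun y => Q'.cramer y (Fin.last n)) (funext fun i => (hι h (x i)).symm))
    exact ⟨_, hxX, q, hq, by rw [← hzq]; ring⟩
  have hsurj : expGE O 0 ⊓ expLE O m ≤ X.map G := by
    refine Submodule.le_of_le_smul_of_le_jacobson_bot (I := Ideal.span {s * (1 - s)})
      (fg_expGE_inf_expLE m) ((Ideal.span_singleton_le_iff_mem _).mpr hj) fun z hz => ?_
    obtain ⟨x₀, hx₀, q₀, hq₀, hz₀⟩ := key h₀ hQ₀ hφ₀ hd₀ hz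
    obtain ⟨x₁, hx₁, q₁, hq₁, hz₁⟩ := key h₁ hQ₁ hφ₁ hd₁ hz
    have h1 : z = G ((1 - s) • x₀ + s • x₁) + (s * (1 - s)) • (q₀ + q₁) := by
      calc z = (1 - s) • z + s • z := by rw [← add_smul, sub_add_cancel, one_smul]
        _ = (1 - s) • (G x₀ + s • q₀) + s • (G x₁ + (1 - s) • q₁) := by rw [← hz₀, ← hz₁]
        _ = _ := by rw [map_add, map_smul, map_smul]; module
    rw [h1]
    exact Submodule.add_mem_sup
      ⟨_, add_mem (X.smul_mem _ hx₀) (X.smul_mem _ hx₁), rfl⟩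
      (Submodule.smul_mem_smul (Ideal.mem_span_singleton_self _) (add_mem hq₀ hq₁))
  -- the last column `x` on the first chart, and `y` on the second one, both of determinant one
  obtain ⟨x, hxX, hx⟩ := hsurj (show (1 : O[T;T⁻¹]) ∈ _ from
    ⟨by rw [← T_zero]; exact T_mem_expGE 0,
      expLE_mono (Int.natCast_nonneg m) (by rw [← T_zero]; exact T_mem_expLE 0)⟩)
  obtain ⟨z, hzX, hz⟩ := hsurj (show (T m : O[T;T⁻¹]) ∈ _ from
    ⟨expGE_anti (Int.natCast_nonneg m) (T_mem_expGE _), T_mem_expLE _⟩)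
  rw [SetLike.mem_coe, hX] at hxX hzX
  rw [hG] at hx hz
  let y : Fin (n + 1) → O[T;T⁻¹] := (T (-m) : O[T;T⁻¹]) • z
  have hy : Q.cramer y (Fin.last n) = 1 := by
    change Q.cramer ((T (-m) : O[T;T⁻¹]) • z) (Fin.last n) = 1
    rw [map_smul, Pi.smul_apply, hz, smul_eq_mul, ← T_add, neg_add_cancel, T_zero]
  have hdet : (Q.updateCol (Fin.last n) x).det = 1 := by rw [← Matrix.cramer_apply, hx]
  let w := (Q.updateCol (Fin.last n) x).cramer (y - x)
  have hwl : w (Fin.last n) = 0 := by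
    change (Q.updateCol (Fin.last n) x).cramer (y - x) (Fin.last n) = 0
    rw [cramer_updateCol, map_sub, Pi.sub_apply, hx, hy, sub_self]
  have hw (i : Fin (n + 1)) : ∑ j : Fin n, Q i j.castSucc * w j.castSucc = y i - x i := by
    have h1 := congrFun (Matrix.mulVec_cramer (Q.updateCol (Fin.last n) x) (y - x)) i
    rw [hdet, one_smul] at h1
    change (Q.updateCol (Fin.last n) x).mulVec w i = _ at h1
    rw [mulVec_eq_sum, hwl, mul_zero, add_zero] at h1
    simp only [Matrix.updateCol_ne (Fin.castSucc_ne_last _)] at h1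
    exact h1
  obtain ⟨v, p₁, p₂, hp₁, hp₂, hp⟩ := exists_eq_add_cocycle_add (M := M) (D := D)
    fun j : Fin n => T D * w j.castSucc
  let u : Fin (n + 1) → O[T;T⁻¹] := Fin.snoc (fun j => T (-D) * p₁ j) 1
  let Q' := Q.updateCol (Fin.last n) ((Q.updateCol (Fin.last n) x).mulVec u)
  have hQ'c (i) (j : Fin n) : Q' i j.castSucc = Q i j.castSucc :=
    Matrix.updateCol_ne (Fin.castSucc_ne_last j)
  have hQ'l (i) : Q' i (Fin.last n) = ∑ j : Fin n, Q i j.castSucc * (T (-D) * p₁ j) + x i := by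
    change Q.updateCol (Fin.last n) ((Q.updateCol (Fin.last n) x).mulVec u) i (Fin.last n) = _
    rw [Matrix.updateCol_self, mulVec_eq_sum]
    simp only [u, Fin.snoc_castSucc, Fin.snoc_last, mul_one, Matrix.updateCol_self,
      Matrix.updateCol_ne (Fin.castSucc_ne_last _)]
  have hDD : T (-D) * T D = (1 : O[T;T⁻¹]) := by rw [← T_add, neg_add_cancel, T_zero]
  have hQ' : IsFrame e v Q' := by
    refine ⟨fun i j => ?_, fun i j => ?_, ?_⟩
    · refine Fin.lastCases ?_ (fun j => ?_) j
      · rw [hQ'l]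
        refine add_mem (sum_mem fun j _ => ?_) (hxX i).1
        have h1 := mul_mem_expGE (hQE i j.castSucc)
          (T_mul_mem_expGE (n := -D) (d := 0).mpr (expGE_anti (by omega) (hp₁ j)))
        rwa [add_zero] at h1
      · rw [hQ'c]
        exact hQE _ _
    · refine Fin.lastCases ?_ (fun j => ?_) j
      · have h1 : (Q' * extensionMatrix v) i (Fin.last n) =
            T D * y i - ∑ j : Fin n, Q i j.castSucc * p₂ j := by
          have h2 : ∑ j : Fin n, Q i j.castSucc * cocycle v j =
              T D * ∑ j : Fin n, Q i j.castSucc * w j.castSucc -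
                T D * ∑ j : Fin n, Q i j.castSucc * (T (-D) * p₁ j) -
                ∑ j : Fin n, Q i j.castSucc * p₂ j := by
            rw [Finset.mul_sum, Finset.mul_sum, ← Finset.sum_sub_distrib, ← Finset.sum_sub_distrib]
            refine Finset.sum_congr rfl fun j _ => ?_
            linear_combination -Q i j.castSucc * hp j + (Q i j.castSucc * p₁ j) * hDD
          rw [mul_extensionMatrix_last, hQ'l]
          simp only [hQ'c]
          rw [h2, hw]
          ring
        rw [h1]
        refine sub_mem ?_ (sum_mem fun j _ => ?_)
        · rw [T_mul_mem_expLE]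
          change T (-m) * z i ∈ _
          rw [T_mul_mem_expLE]
          exact expLE_mono (by omega) (hzX i).2
        · exact expLE_mono (by omega) (mul_mem_expLE (hQL i j) (hp₂ j))
      · rw [mul_extensionMatrix_castSucc, hQ'c, T_mul_mem_expLE, sub_neg_eq_add]
        exact hQL i j
    · rw [← Matrix.cramer_apply, ← cramer_updateCol Q x, cramer_mulVec, hdet, one_smul]
      exact Fin.snoc_last _ _
  refine ⟨v, Q', hQ', ?_, ?_⟩
  · refine (hQ'.map φ₀).eq_of_castSucc_eq hsum hQ₀ fun i j => ?_
    rw [Matrix.map_apply, hQ'c, ← Matrix.map_apply (f := laurentMap φ₀), hφ₀]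
  · refine (hQ'.map φ₁).eq_of_castSucc_eq hsum hQ₁ fun i j => ?_
    rw [Matrix.map_apply, hQ'c, ← Matrix.map_apply (f := laurentMap φ₁), hφ₁]

end Path

/-! ### The ideal of the splitting locus -/

section Semilocal

/-- The polynomials not vanishing at `0` and `1`. -/
def nonvanishingSubmonoid (κ : Type*) [Field κ] : Submonoid κ[X] where
  carrier := {p | p.eval 0 ≠ 0 ∧ p.eval 1 ≠ 0}
  one_mem' := by simp
  mul_mem' hp hq := by
    simp only [Set.mem_ofPred_eq, Polynomial.eval_mul] at *
    exact ⟨mul_ne_zero hp.1 hq.1, mul_ne_zero hp.2 hq.2⟩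

/-- The semilocal ring of the affine line at the points `0` and `1`. -/
abbrev SemilocalLine (κ : Type*) [Field κ] : Type _ := Localization (nonvanishingSubmonoid κ)

variable {κ : Type*} [Field κ]

instance : IsDomain (SemilocalLine κ) := IsLocalization.isDomain_localization fun p hp =>
  mem_nonZeroDivisors_of_ne_zero fun h => hp.1 (by rw [h, Polynomial.eval_zero])

namespace SemilocalLine

/-- Evaluation at `0`. -/
def eval₀ : SemilocalLine κ →+* κ :=
  IsLocalization.lift (M := nonvanishingSubmonoid κ) (g := Polynomial.evalRingHom 0)
    fun p => p.2.1.isUnit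

/-- Evaluation at `1`. -/
def eval₁ : SemilocalLine κ →+* κ :=
  IsLocalization.lift (M := nonvanishingSubmonoid κ) (g := Polynomial.evalRingHom 1)
    fun p => p.2.2.isUnit

theorem eval₀_algebraMap (p : κ[X]) : eval₀ (algebraMap κ[X] (SemilocalLine κ) p) = p.eval 0 :=
  IsLocalization.lift_eq _ p

theorem eval₁_algebraMap (p : κ[X]) : eval₁ (algebraMap κ[X] (SemilocalLine κ) p) = p.eval 1 :=
  IsLocalization.lift_eq _ p

theorem exists_mul_eq (r : SemilocalLine κ) : ∃ (p : κ[X]), ∃ q ∈ nonvanishingSubmonoid κ,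
    r * algebraMap κ[X] (SemilocalLine κ) q = algebraMap κ[X] (SemilocalLine κ) p := by
  obtain ⟨⟨p, q⟩, h⟩ := IsLocalization.surj (nonvanishingSubmonoid κ) r
  exact ⟨p, q, q.2, h⟩

theorem isUnit_algebraMap {q : κ[X]} (hq : q ∈ nonvanishingSubmonoid κ) :
    IsUnit (algebraMap κ[X] (SemilocalLine κ) q) :=
  IsLocalization.map_units (SemilocalLine κ) (⟨q, hq⟩ : nonvanishingSubmonoid κ)

theorem isUnit_of_eval_ne_zero {r : SemilocalLine κ} (h₀ : eval₀ r ≠ 0) (h₁ : eval₁ r ≠ 0) :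
    IsUnit r := by
  obtain ⟨p, q, hq, h⟩ := exists_mul_eq r
  have hp : p ∈ nonvanishingSubmonoid κ := by
    constructor
    · rw [← eval₀_algebraMap, ← h, map_mul, eval₀_algebraMap]
      exact mul_ne_zero h₀ hq.1
    · rw [← eval₁_algebraMap, ← h, map_mul, eval₁_algebraMap]
      exact mul_ne_zero h₁ hq.2
  exact isUnit_of_mul_isUnit_left (h ▸ isUnit_algebraMap hp)

theorem dvd_of_eval₀_eq_zero {r : SemilocalLine κ} (h₀ : eval₀ r = 0) :
    algebraMap κ[X] (SemilocalLine κ) Polynomial.X ∣ r := by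
  obtain ⟨p, q, hq, h⟩ := exists_mul_eq r
  have hp : p.eval 0 = 0 := by rw [← eval₀_algebraMap, ← h, map_mul, h₀, zero_mul]
  rw [← (isUnit_algebraMap hq).dvd_mul_right, h]
  refine map_dvd _ ?_
  rwa [Polynomial.X_dvd_iff, Polynomial.coeff_zero_eq_eval_zero]

theorem dvd_of_eval₁_eq_zero {r : SemilocalLine κ} (h₁ : eval₁ r = 0) :
    1 - algebraMap κ[X] (SemilocalLine κ) Polynomial.X ∣ r := by
  obtain ⟨p, q, hq, h⟩ := exists_mul_eq r
  have hp : p.eval 1 = 0 := by rw [← eval₁_algebraMap, ← h, map_mul, h₁, zero_mul]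
  rw [← (isUnit_algebraMap hq).dvd_mul_right, h, ← neg_dvd, neg_sub,
    ← map_one (algebraMap κ[X] (SemilocalLine κ)), ← map_sub]
  refine map_dvd _ ?_
  rw [← Polynomial.C_1, Polynomial.dvd_iff_isRoot]
  exact hp

theorem mul_one_sub_mem_jacobson : algebraMap κ[X] (SemilocalLine κ) Polynomial.X *
    (1 - algebraMap κ[X] (SemilocalLine κ) Polynomial.X) ∈
      (⊥ : Ideal (SemilocalLine κ)).jacobson := by
  rw [Ideal.mem_jacobson_bot]
  intro y
  apply isUnit_of_eval_ne_zero
  · rw [map_add, map_mul, map_mul, eval₀_algebraMap, Polynomial.eval_X, zero_mul, zero_mul, zero_add,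
      map_one]
    exact one_ne_zero
  · rw [map_add, map_mul, map_mul, map_sub, map_one, eval₁_algebraMap, Polynomial.eval_X, sub_self,
      mul_zero, zero_mul, zero_add]
    exact one_ne_zero

end SemilocalLine

end Semilocal

section Ideal

variable {k : Type u} [Field k] {n : ℕ} {M D : ℤ} {e : Fin (n + 1) → ℤ}

theorem extensionBundle_map {K L : Type*} [Field K] [Field L] (φ : K →+* L)
    (v : ExtIndex n M D → K) :
    (extensionBundle v).map (laurentMap φ) = extensionBundle (φ ∘ v) := extensionMatrix_map φ v

theorem bundleIso_map {K L : Type*} [Field K] [Field L] (φ : K →+* L) {v : ExtIndex n M D → K}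
    (h : BundleIso (extensionBundle v) (splitBundle K e)) :
    BundleIso (extensionBundle (φ ∘ v)) (splitBundle L e) := by
  have h1 := h.map φ
  rw [extensionBundle_map] at h1
  convert h1 using 1
  rw [splitBundle, splitBundle, Matrix.diagonal_map (map_zero _)]
  congr 1
  funext i
  exact (laurentMap_T φ _).symm

/-- A polynomial vanishes on the splitting locus if and only if it vanishes at all points of type
`e` with values in extension fields. Descent to the residue field is `BundleIso.of_map`. -/
theorem mem_splittingIdeal_iff {f : ExtRing k n M D} : f ∈ splittingIdeal k M D e ↔
    ∀ (L : Type u) [Field L] [Algebra k L] (v : ExtIndex n M D → L),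
      BundleIso (extensionBundle v) (splitBundle L e) → MvPolynomial.aeval v f = 0 := by
  rw [splittingIdeal, PrimeSpectrum.mem_vanishingIdeal]
  constructor
  · intro h L _ _ v hv
    let φ : ExtRing k n M D →ₐ[k] L := MvPolynomial.aeval v
    obtain ⟨p, hp⟩ : ∃ p : PrimeSpectrum (ExtRing k n M D), p.asIdeal = RingHom.ker φ.toRingHom :=
      ⟨⟨_, RingHom.ker_isPrime _⟩, rfl⟩
    let ψ : p.asIdeal.ResidueField →+* L := Ideal.ResidueField.lift p.asIdeal φ.toRingHom hp.le
      fun x hx => by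
        change IsUnit (φ x)
        rw [isUnit_iff_ne_zero]
        exact fun h0 => hx (hp.ge h0)
    have hψ : ψ ∘ pointCoords p = v := by
      funext i
      change ψ (algebraMap _ _ _) = v i
      rw [Ideal.ResidueField.lift_algebraMap]
      exact MvPolynomial.aeval_X v i
    refine hp.le (h p ?_)
    change BundleIso _ _
    refine BundleIso.of_map ψ (det_extensionMatrix (pointCoords p)) ?_
    rw [← extensionBundle_eq, extensionBundle_map, hψ]
    exact hv
  · intro h p hp
    have h1 := h _ (pointCoords p) hp
    have h2 : MvPolynomial.aeval (pointCoords p) =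
        IsScalarTower.toAlgHom k (ExtRing k n M D) p.asIdeal.ResidueField :=
      MvPolynomial.algHom_ext fun i => MvPolynomial.aeval_X _ i
    rw [h2] at h1
    exact Ideal.algebraMap_residueField_eq_zero.mp h1

theorem map_aeval_eq {A B ι : Type*} [CommRing A] [CommRing B] [Algebra k A] [Algebra k B]
    (φ : A →+* B) (hφ : φ.comp (algebraMap k A) = algebraMap k B) (v : ι → A) (f : MvPolynomial ι k) :
    φ (MvPolynomial.aeval v f) = MvPolynomial.aeval (φ ∘ v) f := by
  rw [MvPolynomial.map_aeval, hφ]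
  rfl

/-- Two points of type `e` are specialisations of one point of type `e`. -/
theorem exists_interpolation (hsum : ∑ i, e i = D - n * M) {κ : Type*} [Field κ]
    {v₀ v₁ : ExtIndex n M D → κ} (h₀ : BundleIso (extensionBundle v₀) (splitBundle κ e))
    (h₁ : BundleIso (extensionBundle v₁) (splitBundle κ e)) :
    ∃ v : ExtIndex n M D → SemilocalLine κ,
      SemilocalLine.eval₀ ∘ v = v₀ ∧ SemilocalLine.eval₁ ∘ v = v₁ ∧
        BundleIso
          (extensionBundle (algebraMap (SemilocalLine κ) (FractionRing (SemilocalLine κ)) ∘ v))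
          (splitBundle _ e) := by
  obtain ⟨Q₀, hQ₀⟩ := (bundleIso_iff_exists_isFrame hsum).mp h₀
  obtain ⟨Q₁, hQ₁⟩ := (bundleIso_iff_exists_isFrame hsum).mp h₁
  obtain ⟨v, Q, hQ, hv₀, hv₁⟩ := exists_isFrame_interpolating hsum
    ((algebraMap κ[X] (SemilocalLine κ)).comp Polynomial.C) SemilocalLine.eval₀ SemilocalLine.eval₁
    (RingHom.ext fun c => by
      rw [RingHom.comp_apply, RingHom.comp_apply, SemilocalLine.eval₀_algebraMap, Polynomial.eval_C,
        RingHom.id_apply])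
    (RingHom.ext fun c => by
      rw [RingHom.comp_apply, RingHom.comp_apply, SemilocalLine.eval₁_algebraMap, Polynomial.eval_C,
        RingHom.id_apply])
    (algebraMap κ[X] (SemilocalLine κ) Polynomial.X)
    (by rw [SemilocalLine.eval₀_algebraMap, Polynomial.eval_X])
    (by rw [SemilocalLine.eval₁_algebraMap, Polynomial.eval_X])
    (fun _ => SemilocalLine.dvd_of_eval₀_eq_zero) (fun _ => SemilocalLine.dvd_of_eval₁_eq_zero)
    SemilocalLine.mul_one_sub_mem_jacobson hQ₀ hQ₁
  exact ⟨v, hv₀, hv₁, (bundleIso_iff_exists_isFrame hsum).mpr ⟨_, hQ.map _⟩⟩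

theorem exists_common_extension (k L₁ L₂ : Type u) [Field k] [Field L₁] [Field L₂] [Algebra k L₁]
    [Algebra k L₂] : ∃ (κ : Type u) (_ : Field κ) (_ : Algebra k κ),
      Nonempty (L₁ →ₐ[k] κ) ∧ Nonempty (L₂ →ₐ[k] κ) := by
  obtain ⟨𝔪, h𝔪⟩ := Ideal.exists_maximal (L₁ ⊗[k] L₂)
  exact ⟨(L₁ ⊗[k] L₂) ⧸ 𝔪, Ideal.Quotient.field 𝔪, inferInstance,
    ⟨(Ideal.Quotient.mkₐ k 𝔪).comp Algebra.TensorProduct.includeLeft⟩,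
    ⟨(Ideal.Quotient.mkₐ k 𝔪).comp Algebra.TensorProduct.includeRight⟩⟩

/-- The splitting locus is irreducible: if `f` does not vanish at one point of type `e` and `g` not
at another, then `f g` does not vanish at a common generisation of type `e`. -/
theorem isPrime_splittingIdeal (hsum : ∑ i, e i = D - n * M) (hne : splittingIdeal k M D e ≠ ⊤) :
    (splittingIdeal k M D e).IsPrime := by
  refine ⟨hne, fun {f g} hfg => ?_⟩
  by_contra! hcon
  obtain ⟨hf, hg⟩ := hcon
  rw [mem_splittingIdeal_iff] at hf hg
  push Not at hf hg
  obtain ⟨L₁, _, _, v₁, hv₁, hf⟩ := hf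
  obtain ⟨L₂, _, _, v₂, hv₂, hg⟩ := hg
  obtain ⟨κ, _, _, ⟨i₁⟩, ⟨i₂⟩⟩ := exists_common_extension k L₁ L₂
  obtain ⟨v, hev₀, hev₁, hv⟩ := exists_interpolation hsum
    (bundleIso_map i₁.toRingHom hv₁) (bundleIso_map i₂.toRingHom hv₂)
  have hk : algebraMap k (SemilocalLine κ) =
      (algebraMap κ[X] (SemilocalLine κ)).comp (Polynomial.C.comp (algebraMap k κ)) :=
    IsScalarTower.algebraMap_eq k κ[X] (SemilocalLine κ)
  have h1 : MvPolynomial.aeval v f ≠ 0 := by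
    intro h0
    have h2 := congrArg SemilocalLine.eval₀ h0
    rw [map_aeval_eq _ (RingHom.ext fun c => by
      rw [hk, RingHom.comp_apply, RingHom.comp_apply, SemilocalLine.eval₀_algebraMap, RingHom.comp_apply,
        Polynomial.eval_C]), hev₀, map_zero, ← map_aeval_eq i₁.toRingHom i₁.comp_algebraMap] at h2
    exact hf ((map_eq_zero i₁.toRingHom).mp h2)
  have h1' : MvPolynomial.aeval v g ≠ 0 := by
    intro h0
    have h2 := congrArg SemilocalLine.eval₁ h0
    rw [map_aeval_eq _ (RingHom.ext fun c => by
      rw [hk, RingHom.comp_apply, RingHom.comp_apply, SemilocalLine.eval₁_algebraMap, RingHom.comp_apply,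
        Polynomial.eval_C]), hev₁, map_zero, ← map_aeval_eq i₂.toRingHom i₂.comp_algebraMap] at h2
    exact hg ((map_eq_zero i₂.toRingHom).mp h2)
  have h3 := mem_splittingIdeal_iff.mp hfg _ _ hv
  rw [← map_aeval_eq _ (IsScalarTower.algebraMap_eq k _ _).symm,
    map_eq_zero_iff _ (IsFractionRing.injective _ _), map_mul] at h3
  exact mul_ne_zero h1 h1' h3

theorem aeval_smul_of_isHomogeneous {A ι : Type*} [CommRing A] [Algebra k A] (c : A) (v : ι → A)
    {f : MvPolynomial ι k} {d : ℕ} (hf : f.IsHomogeneous d) :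
    MvPolynomial.aeval (c • v) f = c ^ d * MvPolynomial.aeval v f := by
  rw [MvPolynomial.aeval_def, MvPolynomial.aeval_def, MvPolynomial.eval₂_eq, MvPolynomial.eval₂_eq,
    Finset.mul_sum]
  refine Finset.sum_congr rfl fun s hs => ?_
  rw [hf.degree_eq_sum_deg_support hs, ← Finset.prod_pow_eq_pow_sum, mul_left_comm,
    ← Finset.prod_mul_distrib]
  congr 1
  refine Finset.prod_congr rfl fun i _ => ?_
  rw [Pi.smul_apply, smul_eq_mul, mul_pow]

attribute [local instance] MvPolynomial.gradedAlgebra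

/-- The splitting locus is a cone. -/
theorem isHomogeneous_splittingIdeal (hsum : ∑ i, e i = D - n * M) :
    (splittingIdeal k M D e).IsHomogeneous (MvPolynomial.homogeneousSubmodule (ExtIndex n M D) k) := by
  intro d f hf
  have hdec : (DirectSum.decompose (MvPolynomial.homogeneousSubmodule (ExtIndex n M D) k) f d :
      ExtRing k n M D) = MvPolynomial.homogeneousComponent d f :=
    MvPolynomial.decomposition.decompose'_apply f d
  rw [hdec, mem_splittingIdeal_iff]
  intro L _ _ v hv
  -- scale by a transcendental parameter
  let φ : L →+* FractionRing L[X] := (algebraMap L[X] (FractionRing L[X])).comp Polynomial.C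
  have hX : algebraMap L[X] (FractionRing L[X]) Polynomial.X ≠ 0 :=
    (map_ne_zero_iff _ (IsFractionRing.injective _ _)).mpr Polynomial.X_ne_zero
  have h1 := mem_splittingIdeal_iff.mp hf _ _ (bundleIso_smul hsum hX (bundleIso_map φ hv))
  have h2 : (algebraMap L[X] (FractionRing L[X]) Polynomial.X • (φ ∘ v)) =
      algebraMap L[X] (FractionRing L[X]) ∘ ((Polynomial.X : L[X]) • (Polynomial.C ∘ v)) := by
    funext i
    simp [φ]
    ring
  rw [h2, ← map_aeval_eq _ (IsScalarTower.algebraMap_eq k _ _).symm,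
    map_eq_zero_iff _ (IsFractionRing.injective _ _)] at h1
  have h3 (i : ℕ) : MvPolynomial.aeval ((Polynomial.X : L[X]) • (Polynomial.C ∘ v))
      (MvPolynomial.homogeneousComponent i f) =
        Polynomial.X ^ i * Polynomial.C (MvPolynomial.aeval v (MvPolynomial.homogeneousComponent i f)) := by
    rw [aeval_smul_of_isHomogeneous _ _ (MvPolynomial.homogeneousComponent_isHomogeneous i f),
      map_aeval_eq (k := k) (Polynomial.C : L →+* L[X]) rfl]
  rw [← MvPolynomial.sum_homogeneousComponent f, map_sum, Finset.sum_congr rfl fun i _ => h3 i] at h1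
  have h4 := congrArg (fun p : L[X] => p.coeff d) h1
  simp only [Polynomial.coeff_zero, Polynomial.finsetSum_coeff, Polynomial.coeff_X_pow_mul'] at h4
  by_cases hd : d < f.totalDegree + 1
  · rw [Finset.sum_eq_single_of_mem d (Finset.mem_range.mpr hd), if_pos le_rfl, Nat.sub_self,
      Polynomial.coeff_C_zero] at h4
    · exact h4
    · intro i _ hi
      split_ifs with hid
      · exact Polynomial.coeff_C_of_ne_zero (by omega)
      · rfl
  · rw [MvPolynomial.homogeneousComponent_eq_zero _ _ (by omega), map_zero]

end Ideal

end SplittingLoci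

end

open SplittingLoci in
theorem proposition2p4 {k : Type*} [Field k] (n : ℕ) (M D : ℤ) (e : Fin (n + 1) → ℤ)
    (he : Monotone e)
    (hlt : SplittingLoci.SplittingLT (SplittingLoci.unbalancedType n M D) e) :
    (∃! c : SplittingLoci.DivisorClassGroup (SplittingLoci.SplittingRing k M D e),
      SplittingLoci.HasDivisorClass
        (SplittingLoci.CanonicalModule (SplittingLoci.splittingIdeal k M D e)) c) ∧
    ∀ (N : ℕ) (c : SplittingLoci.DivisorClassGroup (SplittingLoci.SplittingRing k M D e)),
      SplittingLoci.HasDivisorClass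
        (SplittingLoci.CanonicalModule (SplittingLoci.splittingIdeal k M D e)) c →
      (SplittingLoci.IsLocallyFree (SplittingLoci.SplittingRing k M D e)
          (SplittingLoci.ReflexivePower (SplittingLoci.SplittingRing k M D e)
            (SplittingLoci.CanonicalModule (SplittingLoci.splittingIdeal k M D e)) N) ↔
        N • c = 0) := by
  have hsum : ∑ i, e i = D - n * M := by
    rw [← hlt.1.1, Fin.sum_univ_castSucc]
    simp [SplittingLoci.unbalancedType]
    ring
  by_cases htop : SplittingLoci.splittingIdeal k M D e = ⊤
  · -- an empty locus has the zero ring as coordinate ring, and every module over it vanishes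
    have : Subsingleton (SplittingLoci.SplittingRing k M D e) :=
      Ideal.Quotient.subsingleton_iff.mpr htop
    have : Subsingleton (SplittingLoci.CanonicalModule (SplittingLoci.splittingIdeal k M D e)) :=
      Module.subsingleton (SplittingLoci.SplittingRing k M D e) _
    have : Subsingleton (SplittingLoci.DivisorClassGroup (SplittingLoci.SplittingRing k M D e)) := by
      have : Subsingleton (FractionRing (SplittingRing k M D e)) :=
        Module.subsingleton (SplittingRing k M D e) _
      have h1 : Subsingleton (RegularFractionalIdeal (SplittingRing k M D e)) :=
        ⟨fun J L => Subtype.ext (FractionalIdeal.coeToSubmodule_injective (Subsingleton.elim _ _))⟩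
      exact Quotient.instSubsingletonQuotient _
    have : Subsingleton (FractionRing (SplittingRing k M D e)) :=
      Module.subsingleton (SplittingRing k M D e) _
    have hc : HasDivisorClass (CanonicalModule (splittingIdeal k M D e))
        (0 : DivisorClassGroup (SplittingRing k M D e)) :=
      ⟨1, ⟨{ (0 : _ →ₗ[SplittingRing k M D e] _) with
        invFun := 0
        left_inv := fun _ => Subsingleton.elim _ _
        right_inv := fun _ => Subsingleton.elim _ _ }⟩, Subsingleton.elim _ _⟩
    exact ⟨⟨0, hc, fun _ _ => Subsingleton.elim _ _⟩, fun N c _ => ⟨fun _ => Subsingleton.elim _ _,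
      fun _ p => (p.isPrime.ne_top (Subsingleton.elim _ _)).elim⟩⟩
  have := SplittingLoci.isPrime_splittingIdeal hsum htop
  let := MvPolynomial.gradedAlgebra (σ := SplittingLoci.ExtIndex n M D) (R := k)
  refine SplittingLoci.isLocallyFree_reflexivePower_canonicalModule_iff
    (SplittingLoci.isGradeFull_mvPolynomial k (SplittingLoci.ExtIndex n M D))
    (𝒜 := MvPolynomial.homogeneousSubmodule (SplittingLoci.ExtIndex n M D) k) (fun a ha ha0 => ?_)
    (SplittingLoci.isHomogeneous_splittingIdeal hsum)
  have h1 := (MvPolynomial.totalDegree_zero_iff_isHomogeneous _).mpr ha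
  rw [MvPolynomial.totalDegree_eq_zero_iff_eq_C] at h1
  rw [h1] at ha0 ⊢
  exact ((map_ne_zero_iff _ (MvPolynomial.C_injective _ _)).mp ha0).isUnit.map MvPolynomial.C
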